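/- All manifolds are smooth ($C^\infty$), Hausdorff and second countable. For relatively prime integers $0<q<p$ let $L_{p,q}$ be the quotient of $S^3=\{(w,z)\in\mathbb C^2:|w|^2+|z|^2=1\}$ by the free action $\xi\cdot(w,z)=(\xi w,\xi^q z)$ of the group $\mu_p$ of $p$-th roots of unity. A lens space is a manifold diffeomorphic to some $L_{p,q}$. For coprime integers $p\ge1$, $q\ge0$ let $f_{p,q}\colon S^1\times D^2\to D^2$, $(u,z)\mapsto u^qz^p$, where $D^2\subset\mathbb C$ is the closed unit disc. Let $C^2=\{w\in\mathbb C:1\le|w|<2\}$, $P=\{(w,z)\in C^2\times\mathbb C:|z|^2=|w|-1\}$ and $\omega\colon P\to C^2$, $\omega(w,z)=w$. Two maps $A\to B$ and $A'\to B'$ are called diffeomorphic if there are diffeomorphisms $A\cong A'$ and $B\cong B'$ that intertwine them. A Werther fibration is a smooth map $f\colon M\to S$ from a $3$-manifold $M$ without boundary to a surface $S$ with boundary such that 1. every interior point of $S$ has a closed neighbourhood $U$, contained in the interior of $S$, such that the restriction $f^{-1}(U)\to U$ of $f$ is diffeomorphic to some $f_{p,q}$; and 2. every boundary point of $S$ has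 an open neighbourhood $U$ such that the restriction $f^{-1}(U)\to U$ of $f$ is diffeomorphic to the restriction of $\omega$ over some open neighbourhood of $1$ in $C^2$. **Theorem.** Let $N_1$ be an oriented connected sum of finitely many (oriented) lens spaces, let $N_2$ be an oriented connected sum of finitely many (oriented) copies of $S^1\times S^2$, and let $M$ be the oriented connected sum $N_1\# N_2$. Here the numbers of summands may be $0$, the empty connected sum being $S^3$, and each summand may carry either orientation. Then there are a compact connected surface $S$ with nonempty boundary and a Werther fibration $f\colon M\to S$. -/

import Mathlib

open Set Metric Topology
open scoped Manifold ContDiff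

universe u

/-! ## Model spaces -/

/-- Real Euclidean `3`-space, the model of `3`-manifolds without boundary. -/
abbrev E3 : Type := EuclideanSpace ℝ (Fin 3)

/-- The `3`-sphere `{(w, z) ∈ ℂ² : |w|² + |z|² = 1}`; the point `x` has `w = x 0`, `z = x 1`. -/
abbrev Sphere3 : Type := sphere (0 : EuclideanSpace ℂ (Fin 2)) 1

/-- The `2`-sphere. -/
abbrev Sphere2 : Type := sphere (0 : EuclideanSpace ℝ (Fin 3)) 1

/-- The real dimension of `ℂ²` is `4`, which makes `Sphere3` a smooth `3`-manifold. -/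
instance finrank_real_complexPlane :
    Fact (Module.finrank ℝ (EuclideanSpace ℂ (Fin 2)) = 3 + 1) := ⟨by
  have h := Module.finrank_mul_finrank ℝ ℂ (EuclideanSpace ℂ (Fin 2))
  simp [Complex.finrank_real_complex] at h
  omega⟩

/-! ## Lens spaces -/

/-- The group `μ_p` of `p`-th roots of unity in `ℂ`, tagged by the number `q` which determines
its action on the `3`-sphere. -/
def Mu (p _q : ℕ) : Type := rootsOfUnity p ℂ

namespace Mu

variable {p q : ℕ}

noncomputable instance : CommGroup (Mu p q) := inferInstanceAs (CommGroup (rootsOfUnity p ℂ))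

instance [NeZero p] : Finite (Mu p q) := inferInstanceAs (Finite (rootsOfUnity p ℂ))

/-- The complex number underlying an element of `μ_p`. -/
def val (ξ : Mu p q) : ℂ :=
  Units.val (Subtype.val (α := ℂˣ) (p := fun x => x ∈ rootsOfUnity p ℂ) ξ)

theorem val_one : (1 : Mu p q).val = 1 := rfl

theorem val_mul (ξ η : Mu p q) : (ξ * η).val = ξ.val * η.val := rfl

theorem val_injective : Function.Injective (val : Mu p q → ℂ) := fun _ _ h =>
  Subtype.ext (Units.ext h)

theorem val_pow (ξ : Mu p q) : ξ.val ^ p = 1 := by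
  have h := (mem_rootsOfUnity p _).1 (Subtype.property (p := fun x => x ∈ rootsOfUnity p ℂ) ξ)
  have h2 := congrArg (Units.val) h
  rw [Units.val_pow_eq_pow_val, Units.val_one] at h2
  exact h2

theorem norm_val [NeZero p] (ξ : Mu p q) : ‖ξ.val‖ = 1 :=
  Complex.norm_eq_one_of_pow_eq_one ξ.val_pow (NeZero.ne p)

/-- The action `ξ · (w, z) = (ξ w, ξ ^ q z)` of `μ_p` on the `3`-sphere. -/
noncomputable instance [NeZero p] : MulAction (Mu p q) Sphere3 where
  smul ξ x := ⟨!₂[ξ.val * x.1 0, ξ.val ^ q * x.1 1], by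
    have hx := x.2
    rw [mem_sphere_zero_iff_norm, EuclideanSpace.norm_eq] at hx ⊢
    simpa [Fin.sum_univ_two, norm_mul, norm_pow, norm_val] using hx⟩
  one_smul x := by
    apply Subtype.ext
    ext i
    fin_cases i
    · change (1 : Mu p q).val * x.1 0 = x.1 0
      rw [val_one, one_mul]
    · change (1 : Mu p q).val ^ q * x.1 1 = x.1 1
      rw [val_one, one_pow, one_mul]
  mul_smul ξ η x := by
    apply Subtype.ext
    ext i
    fin_cases i
    · change (ξ * η).val * x.1 0 = ξ.val * (η.val * x.1 0)
      rw [val_mul, mul_assoc]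
    · change (ξ * η).val ^ q * x.1 1 = ξ.val ^ q * (η.val ^ q * x.1 1)
      rw [val_mul, mul_pow, mul_assoc]

theorem smul_zero_apply [NeZero p] (ξ : Mu p q) (x : Sphere3) :
    (ξ • x).1 0 = ξ.val * x.1 0 := rfl

theorem smul_one_apply [NeZero p] (ξ : Mu p q) (x : Sphere3) :
    (ξ • x).1 1 = ξ.val ^ q * x.1 1 := rfl

instance [NeZero p] : ContinuousConstSMul (Mu p q) Sphere3 where
  continuous_const_smul ξ := by
    refine Continuous.subtype_mk ?_ _
    refine (PiLp.continuous_toLp 2 _).comp (continuous_pi fun i => ?_)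
    fin_cases i
    · change Continuous fun x : Sphere3 => ξ.val * x.1 0
      fun_prop
    · change Continuous fun x : Sphere3 => ξ.val ^ q * x.1 1
      fun_prop

/-- The action is free when `p` and `q` are relatively prime. -/
instance [NeZero p] [Fact (p.Coprime q)] : IsCancelSMul (Mu p q) Sphere3 where
  left_cancel' ξ x y h := by simpa using h
  right_cancel' ξ η x h := by
    have h0 : ξ.val * x.1 0 = η.val * x.1 0 := by
      rw [← smul_zero_apply, ← smul_zero_apply, h]
    have h1 : ξ.val ^ q * x.1 1 = η.val ^ q * x.1 1 := by
      rw [← smul_one_apply, ← smul_one_apply, h]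
    apply val_injective
    by_cases hw : x.1 0 = 0
    · have hz : x.1 1 ≠ 0 := by
        intro hz
        have hx := x.2
        rw [mem_sphere_zero_iff_norm, EuclideanSpace.norm_eq] at hx
        simp [Fin.sum_univ_two, hw, hz] at hx
      have hq : ξ.val ^ q = η.val ^ q := mul_right_cancel₀ hz h1
      have hη : η.val ≠ 0 := by
        intro h0
        have := η.norm_val
        simp [h0] at this
      have e1 : (ξ.val / η.val) ^ p = 1 := by rw [div_pow, val_pow, val_pow, div_one]
      have e2 : (ξ.val / η.val) ^ q = 1 := by
        rw [div_pow, hq, div_self (pow_ne_zero _ hη)]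
      have hg : Nat.gcd p q = 1 := (Fact.out : p.Coprime q)
      have e3 : (ξ.val / η.val) ^ Nat.gcd p q = 1 := pow_gcd_eq_one.2 ⟨e1, e2⟩
      rw [hg, pow_one] at e3
      exact (div_eq_one_iff_eq hη).1 e3
    · exact mul_right_cancel₀ hw h0

end Mu

/-- The lens space `L_{p,q}`, the quotient of the `3`-sphere by the action of `μ_p`. For `p` and
`q` relatively prime the action is free, and the space carries Mathlib's charts of a quotient by a
free properly discontinuous action (local inverses of the projection followed by charts of the
sphere). -/
abbrev LensSpace (p q : ℕ) [NeZero p] : Type := MulAction.orbitRel.Quotient (Mu p q) Sphere3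

/-! ## Orientations -/

/-- An orientation of a smooth `3`-manifold, given by an oriented atlas: a family of smooth charts
that cover the manifold, with coordinate changes of positive Jacobian determinant. -/
structure OrientedAtlas (M : Type u) [TopologicalSpace M] [ChartedSpace E3 M] where
  /-- The positively oriented charts of the atlas. -/
  charts : Set (OpenPartialHomeomorph M E3)
  charts_subset : charts ⊆ IsManifold.maximalAtlas (𝓡 3) ∞ M
  covers : ∀ x : M, ∃ φ ∈ charts, x ∈ φ.source
  compatible : ∀ φ ∈ charts, ∀ ψ ∈ charts, ∀ x ∈ φ.source ∩ ψ.source,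
    0 < (fderiv ℝ (ψ ∘ φ.symm) (φ x)).det

/-- The standard orientation of Euclidean `3`-space. -/
noncomputable def stdOrientation : OrientedAtlas E3 where
  charts := {OpenPartialHomeomorph.refl E3}
  charts_subset := by
    rintro φ rfl
    exact StructureGroupoid.subset_maximalAtlas _ rfl
  covers x := ⟨_, rfl, mem_univ x⟩
  compatible := by
    rintro φ rfl ψ rfl x -
    change 0 < (fderiv ℝ (id : E3 → E3) x).det
    rw [fderiv_id]
    simp [ContinuousLinearMap.det]

section
variable {M N : Type*} [TopologicalSpace M] [ChartedSpace E3 M]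
  [TopologicalSpace N] [ChartedSpace E3 N]

/-- `f` preserves orientations at every point of `A`: its Jacobian determinant in positively
oriented charts is positive. -/
def PreservesOrientationOn (oM : OrientedAtlas M) (oN : OrientedAtlas N) (f : M → N)
    (A : Set M) : Prop :=
  ∀ x ∈ A, ∀ φ ∈ oM.charts, ∀ ψ ∈ oN.charts, x ∈ φ.source → f x ∈ ψ.source →
    0 < (fderiv ℝ (ψ ∘ f ∘ φ.symm) (φ x)).det

/-- `f` reverses orientations at every point of `A`: its Jacobian determinant in positively
oriented charts is negative. -/
def ReversesOrientationOn (oM : OrientedAtlas M) (oN : OrientedAtlas N) (f : M → N)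
    (A : Set M) : Prop :=
  ∀ x ∈ A, ∀ φ ∈ oM.charts, ∀ ψ ∈ oN.charts, x ∈ φ.source → f x ∈ ψ.source →
    (fderiv ℝ (ψ ∘ f ∘ φ.symm) (φ x)).det < 0

end

/-- An oriented smooth `3`-manifold without boundary. -/
structure OrientedThreeManifold : Type (u + 1) where
  /-- The underlying space. -/
  carrier : Type u
  [top : TopologicalSpace carrier]
  [charted : ChartedSpace E3 carrier]
  [manifold : IsManifold (𝓡 3) ∞ carrier]
  [t2 : T2Space carrier]
  [secondCountable : SecondCountableTopology carrier]
  /-- The orientation. -/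
  orientation : OrientedAtlas carrier

attribute [instance] OrientedThreeManifold.top OrientedThreeManifold.charted
  OrientedThreeManifold.manifold OrientedThreeManifold.t2 OrientedThreeManifold.secondCountable

/-! ## Diffeomorphisms between subsets of manifolds -/

/-- The partial bijection `e` is a diffeomorphism from the subset `A` of `X` onto the subset `B` of
`Y`, both directions being smooth along the subset. -/
structure IsDiffeoBetween {EX HX EY HY X Y : Type*}
    [NormedAddCommGroup EX] [NormedSpace ℝ EX] [TopologicalSpace HX]
    [NormedAddCommGroup EY] [NormedSpace ℝ EY] [TopologicalSpace HY]
    [TopologicalSpace X] [ChartedSpace HX X] [TopologicalSpace Y] [ChartedSpace HY Y]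
    (I : ModelWithCorners ℝ EX HX) (J : ModelWithCorners ℝ EY HY)
    (e : PartialEquiv X Y) (A : Set X) (B : Set Y) : Prop where
  source_eq : e.source = A
  target_eq : e.target = B
  contMDiffOn : ContMDiffOn I J ∞ e A
  contMDiffOn_symm : ContMDiffOn J I ∞ e.symm B

/-! ## Oriented connected sums -/

/-- `M` is an oriented connected sum of `M₁` and `M₂`: there are smooth embeddings `e₁`, `e₂` of
the closed unit ball in `M₁`, `M₂` (defined on the concentric open ball of radius `2`), `e₁`
preserving and `e₂` reversing orientations, such that `M` is the oriented manifold obtained from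
`M₁ ∖ {e₁ 0}` and `M₂ ∖ {e₂ 0}` by identifying `e₁ (t u)` with `e₂ ((1 - t) u)` for every unit
vector `u` and every `0 < t < 1`. The maps `j₁` and `j₂` are the resulting inclusions of the two
pieces as open subsets of `M`. -/
def IsOrientedConnectedSum (M M₁ M₂ : OrientedThreeManifold.{u}) : Prop :=
  ∃ (e₁ : PartialEquiv E3 M₁.carrier) (e₂ : PartialEquiv E3 M₂.carrier)
    (j₁ : PartialEquiv M₁.carrier M.carrier) (j₂ : PartialEquiv M₂.carrier M.carrier),
    IsDiffeoBetween (𝓡 3) (𝓡 3) e₁ (ball 0 2) e₁.target ∧ IsOpen e₁.target ∧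
    IsDiffeoBetween (𝓡 3) (𝓡 3) e₂ (ball 0 2) e₂.target ∧ IsOpen e₂.target ∧
    PreservesOrientationOn stdOrientation M₁.orientation e₁ (ball 0 2) ∧
    ReversesOrientationOn stdOrientation M₂.orientation e₂ (ball 0 2) ∧
    IsDiffeoBetween (𝓡 3) (𝓡 3) j₁ {e₁ 0}ᶜ j₁.target ∧ IsOpen j₁.target ∧
    IsDiffeoBetween (𝓡 3) (𝓡 3) j₂ {e₂ 0}ᶜ j₂.target ∧ IsOpen j₂.target ∧
    PreservesOrientationOn M₁.orientation M.orientation j₁ {e₁ 0}ᶜ ∧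
    PreservesOrientationOn M₂.orientation M.orientation j₂ {e₂ 0}ᶜ ∧
    j₁.target ∪ j₂.target = univ ∧
    ∀ x ∈ ({e₁ 0}ᶜ : Set M₁.carrier), ∀ y ∈ ({e₂ 0}ᶜ : Set M₂.carrier),
      j₁ x = j₂ y ↔ ∃ t : ℝ, 0 < t ∧ t < 1 ∧ ∃ v : E3, ‖v‖ = 1 ∧
        x = e₁ (t • v) ∧ y = e₂ ((1 - t) • v)

/-- Oriented connected sums of finitely many pieces, each of which satisfies `P`. The connected sum
of no piece at all is the `3`-sphere. -/
inductive IsFiniteConnectedSum (P : OrientedThreeManifold.{u} → Prop) :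
    OrientedThreeManifold.{u} → Prop
  | empty (M : OrientedThreeManifold.{u}) (h : Nonempty (M.carrier ≃ₘ^∞⟮𝓡 3, 𝓡 3⟯ Sphere3)) :
      IsFiniteConnectedSum P M
  | piece (M : OrientedThreeManifold.{u}) (h : P M) : IsFiniteConnectedSum P M
  | sum (M M₁ M₂ : OrientedThreeManifold.{u}) (h₁ : IsFiniteConnectedSum P M₁)
      (h₂ : IsFiniteConnectedSum P M₂) (h : IsOrientedConnectedSum M M₁ M₂) :
      IsFiniteConnectedSum P M

/-- An oriented `3`-manifold whose underlying manifold is diffeomorphic to some `L_{p,q}`, with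
`0 < q < p` relatively prime. Both orientations are allowed. -/
def IsLensSpace (M : OrientedThreeManifold.{u}) : Prop :=
  ∃ (p q : ℕ) (_ : NeZero p) (_ : Fact (p.Coprime q)), 0 < q ∧ q < p ∧
    Nonempty (M.carrier ≃ₘ^∞⟮𝓡 3, 𝓡 3⟯ LensSpace p q)

/-- An oriented `3`-manifold whose underlying manifold is diffeomorphic to `S¹ × S²`. Both
orientations are allowed. -/
def IsCircleTimesSphere (M : OrientedThreeManifold.{u}) : Prop :=
  Nonempty (M.carrier ≃ₘ^∞⟮𝓡 3, (𝓡 1).prod (𝓡 2)⟯ Circle × Sphere2)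

/-! ## Seifert and Werther fibrations -/

/-- The local model `f_{p,q} : S¹ × D² → D²`, `(u, z) ↦ u ^ q z ^ p`, of a Seifert fibration (as a
map on `S¹ × ℂ`, of which only the restriction to `S¹ × D²` is used). -/
noncomputable def seifertModel (p q : ℕ) : Circle × ℂ → ℂ := fun x => (x.1 : ℂ) ^ q * x.2 ^ p

/-- The half-open collar `C² = {w ∈ ℂ : 1 ≤ |w| < 2}`. -/
def collar : Set ℂ := {w | 1 ≤ ‖w‖ ∧ ‖w‖ < 2}

/-- The `3`-manifold `P = {(w, z) ∈ C² × ℂ : |z|² = |w| - 1}`. The pinched map `ω : P → C²` is the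
first projection. -/
def pinchedSpace : Set (ℂ × ℂ) := {x | x.1 ∈ collar ∧ ‖x.2‖ ^ 2 = ‖x.1‖ - 1}

section
variable {M S : Type*} [TopologicalSpace M] [ChartedSpace E3 M]
  [TopologicalSpace S] [ChartedSpace (EuclideanHalfSpace 2) S]

/-- The restriction of `f : M → S` over the open subset `V` of `S` is a Seifert fibration: every
point of `V` has a closed neighbourhood `U` in `V` such that the restriction of `f` to `f⁻¹(U)` is
diffeomorphic to some `f_{p,q} : S¹ × D² → D²` with `p ≠ 0` and `p`, `q` relatively prime. -/
def IsSeifertFibrationOver (f : M → S) (V : Set S) : Prop :=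
  ∀ P ∈ V, ∃ U : Set S, U ⊆ V ∧ U ∈ 𝓝 P ∧ IsClosed U ∧
    ∃ p q : ℕ, p ≠ 0 ∧ p.Coprime q ∧
      ∃ (Φ : PartialEquiv M (Circle × ℂ)) (φ : PartialEquiv S ℂ),
        IsDiffeoBetween (𝓡 3) ((𝓡 1).prod 𝓘(ℝ, ℂ)) Φ (f ⁻¹' U)
          {x : Circle × ℂ | x.2 ∈ closedBall (0 : ℂ) 1} ∧
        IsDiffeoBetween (𝓡∂ 2) 𝓘(ℝ, ℂ) φ U (closedBall 0 1) ∧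
        ∀ x ∈ f ⁻¹' U, φ (f x) = seifertModel p q (Φ x)

/-- A Werther fibration: a smooth map from a `3`-manifold without boundary to a surface with
boundary that is a Seifert fibration over the interior, and such that each boundary point has an
open neighbourhood `U` over which the map is diffeomorphic to the restriction of `ω` over an open
neighbourhood of `1` in the collar. -/
structure IsWertherFibration (f : M → S) : Prop where
  contMDiff : ContMDiff (𝓡 3) (𝓡∂ 2) ∞ f
  seifert : IsSeifertFibrationOver f ((𝓡∂ 2).interior S)
  pinched : ∀ P ∈ (𝓡∂ 2).boundary S, ∃ U : Set S, IsOpen U ∧ P ∈ U ∧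
    ∃ O : Set ℂ, IsOpen O ∧ (1 : ℂ) ∈ O ∧
      ∃ (Φ : PartialEquiv M (ℂ × ℂ)) (φ : PartialEquiv S ℂ),
        IsDiffeoBetween (𝓡 3) 𝓘(ℝ, ℂ × ℂ) Φ (f ⁻¹' U) {x ∈ pinchedSpace | x.1 ∈ O} ∧
        IsDiffeoBetween (𝓡∂ 2) 𝓘(ℝ, ℂ) φ U (collar ∩ O) ∧
        ∀ x ∈ f ⁻¹' U, φ (f x) = (Φ x).1

end

/-!
The surface is found in the plane: the fibration is a smooth map `f : M → ℂ`, and the surface is its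
image. Locally over its image, `f` is asked to be either a *circle model*, the projection to the
plane of the hypersurface `{(w, ζ) | ‖ζ‖ ^ 2 = ρ w}` for a function `ρ` that is regular where it
vanishes, or a Seifert model `(u, z) ↦ u ^ q * z ^ p`. A circle model is a trivial circle bundle over
`{ρ > 0}` and folds along `{ρ = 0}`. Hence the image of a compact `M` is a region with smooth boundary,
the boundary being `{ρ = 0}`, and `f` is a Werther fibration over it
(`IsCappedWertherMap.isWertherFibration`).

For an induction over connected sums, `f` is required in addition to have *caps*
(`IsCappedWertherMap`): over the leftmost and over the rightmost point of its image it looks like the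
projection `(w, z) ↦ w` of the `3`-sphere to the disc.

* On a lens space, and on the sphere, `(w, z) ↦ w ^ p` is such a map to the unit disc, with a multiple
  fibre over `0` (`IsSphereQuotient.isCappedWertherMap_powMap`).
* On `S¹ × S²`, the map `(u, v) ↦ (2 + v₀) u / 3` is such a map to an annulus
  (`hasCappedWertherMap_of_diffeomorph_circle_prod_sphere`).
* On a connected sum, such maps on the summands are glued (`IsGluing.exists_isCappedWertherMap`), and
  the image is a boundary connected sum of the two images.

The gluing goes as follows. The part of `M` over a small cap of the image is a ball, on which `f` is
the projection `(x₀, x₁, x₂) ↦ (√(1 - ‖x‖ ^ 2), x₀)` up to translation. A connected sum may be formed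
along any embedded ball, but two embedded balls in a connected manifold differ, after shrinking one
of them, by a diffeomorphism and possibly a reflection (`exists_diffeomorph_ball_eq`). The
projection above does not see the reflection in `x₂`. So `f` can be made standard on the given ball
whether or not the ball preserves an orientation (`exists_isStandardOn`), and this is why the
orientations of the summands play no role. The cap is then replaced by a neck, on which the sphere
of radius `t` in the ball is projected to a vertical segment (`neckMap`). The profile of the neck is
symmetric under `t ↦ 1 - t`, the inversion used in the connected sum, so that the neck for one
summand and the mirror image of the neck for the other one agree where the two are glued.

The uniqueness of balls is obtained without isotopies. A germ of a local diffeomorphism at the origin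
is realized by a diffeomorphism supported in a ball, up to its derivative, by a cutoff; an invertible
linear map is, up to a reflection, a product of transvections and positive diagonal matrices, which
are powers of maps close to the identity, and these can again be cut off
(`IsRealizableUpToReflection`).
-/

/-! ### Diffeomorphisms of Euclidean space with support in a ball -/

/-- A perturbation of the identity whose derivative is bounded by `1 / 2` is a diffeomorphism. -/
theorem exists_diffeomorph_id_add {E : Type*} [NormedAddCommGroup E] [NormedSpace ℝ E]
    [CompleteSpace E] {u : E → E} (hu : ContDiff ℝ ∞ u) (h : ∀ x, ‖fderiv ℝ u x‖ ≤ 1 / 2) :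
    ∃ Φ : E ≃ₘ^∞⟮𝓘(ℝ, E), 𝓘(ℝ, E)⟯ E, ∀ x, Φ x = x + u x := by
  have hd : Differentiable ℝ u := hu.differentiable (by simp)
  have hlip : LipschitzWith (1 / 2) u :=
    lipschitzWith_of_nnnorm_fderiv_le hd fun x => by
      have := h x
      rw [← NNReal.coe_le_coe]
      simpa using this
  have happ : ApproximatesLinearOn (fun x => x + u x)
      ((ContinuousLinearEquiv.refl ℝ E : E ≃L[ℝ] E) : E →L[ℝ] E) univ (1 / 2) := by
    refine ApproximatesLinearOn.approximatesLinearOn_iff_lipschitzOnWith.2 ?_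
    have : (fun x => x + u x) - ⇑((ContinuousLinearEquiv.refl ℝ E : E ≃L[ℝ] E) : E →L[ℝ] E) = u := by
      ext x; simp
    rw [this]
    exact hlip.lipschitzOnWith
  have hc : Subsingleton E ∨ (1 / 2 : NNReal) <
      ‖((ContinuousLinearEquiv.refl ℝ E).symm : E →L[ℝ] E)‖₊⁻¹ := by
    by_cases hE : Subsingleton E
    · exact Or.inl hE
    · right
      have : Nontrivial E := not_subsingleton_iff_nontrivial.1 hE
      have h1 : ‖((ContinuousLinearEquiv.refl ℝ E).symm : E →L[ℝ] E)‖₊ = 1 := by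
        ext
        exact ContinuousLinearMap.norm_id
      rw [h1, ← NNReal.coe_lt_coe]
      norm_num
  let F := happ.toHomeomorph _ hc
  have hF : ∀ x, F x = x + u x := fun x => rfl
  have hFs : ContDiff ℝ ∞ F := contDiff_id.add hu
  have hinv : ∀ x, ∃ f' : E ≃L[ℝ] E,
      (f' : E →L[ℝ] E) = ContinuousLinearMap.id ℝ E + fderiv ℝ u x := by
    intro x
    have h2 : ‖-fderiv ℝ u x‖ < 1 := by rw [norm_neg]; linarith [h x]
    refine ⟨ContinuousLinearEquiv.unitsEquiv ℝ E (Units.oneSub _ h2), ?_⟩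
    ext y
    change (1 - -fderiv ℝ u x) y = _
    simp
  choose f' hf' using hinv
  have hsymm : ContDiff ℝ ∞ F.symm := by
    refine F.contDiff_symm (f₀' := f') (fun a => ?_) hFs
    rw [hf']
    exact (hasFDerivAt_id a).add (hd a).hasFDerivAt
  exact ⟨⟨F.toEquiv, hFs.contMDiff, hsymm.contMDiff⟩, hF⟩

/-- Cutting off a perturbation `w` of the identity: if `w` and its derivative are small on the ball
of radius `ε`, in scale-invariant terms, then `x ↦ x + w x` extends from the ball of radius
`3 ε / 4` to a diffeomorphism that is the identity off the ball of radius `ε`. -/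
theorem exists_diffeomorph_cutoff :
    ∃ C : ℝ, 0 < C ∧ ∀ (ε : ℝ) (w : E3 → E3) (a b : ℝ) (U : Set E3), 0 < ε → IsOpen U →
      closedBall 0 ε ⊆ U → ContDiffOn ℝ ∞ w U →
      (∀ x ∈ closedBall (0 : E3) ε, ‖w x‖ ≤ a * ε ∧ ‖fderiv ℝ w x‖ ≤ b) → C * a + b ≤ 1 / 2 →
      ∃ Φ : E3 ≃ₘ^∞⟮𝓡 3, 𝓡 3⟯ E3, (∀ x, ε ≤ ‖x‖ → Φ x = x) ∧
        ∀ x, ‖x‖ ≤ 3 / 4 * ε → Φ x = x + w x := by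
  let χ : ContDiffBump (0 : E3) := ⟨3 / 4, 1, by norm_num, by norm_num⟩
  have hχ : ContDiff ℝ ∞ χ := χ.contDiff
  obtain ⟨C, hC⟩ := (χ.hasCompactSupport.fderiv (𝕜 := ℝ)).exists_bound_of_continuous
    (hχ.continuous_fderiv (by simp))
  refine ⟨max C 1, lt_max_of_lt_right one_pos, fun ε w a b U hε hUo hU hw hb hab => ?_⟩
  let u : E3 → E3 := fun x => χ (ε⁻¹ • x) • w x
  have hχε : ContDiff ℝ ∞ fun x : E3 => χ (ε⁻¹ • x) := hχ.comp (contDiff_const_smul _)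
  have hzero : ∀ x : E3, ε ≤ ‖x‖ → χ (ε⁻¹ • x) = 0 := by
    intro x hx
    apply χ.zero_of_le_dist
    rw [dist_zero_right, norm_smul, norm_inv, Real.norm_of_nonneg hε.le]
    change 1 ≤ ε⁻¹ * ‖x‖
    rw [inv_mul_eq_div, le_div_iff₀ hε]
    linarith
  have hu0 : ∀ x ∈ (closedBall (0 : E3) ε)ᶜ, u =ᶠ[𝓝 x] fun _ => 0 := by
    intro x hx
    filter_upwards [isClosed_closedBall.isOpen_compl.mem_nhds hx] with y hy
    have : ε ≤ ‖y‖ := by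
      have : ¬ ‖y‖ ≤ ε := by simpa using hy
      linarith
    simp [u, hzero y this]
  have hu : ContDiff ℝ ∞ u := by
    rw [contDiff_iff_contDiffAt]
    intro x
    by_cases hx : x ∈ closedBall (0 : E3) ε
    · exact hχε.contDiffAt.smul (hw.contDiffAt (hUo.mem_nhds (hU hx)))
    · exact contDiffAt_const.congr_of_eventuallyEq (hu0 x hx)
  have hbound : ∀ x, ‖fderiv ℝ u x‖ ≤ 1 / 2 := by
    intro x
    by_cases hx : x ∈ closedBall (0 : E3) ε
    · have hwd : DifferentiableAt ℝ w x :=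
        (hw.contDiffAt (hUo.mem_nhds (hU hx))).differentiableAt (by simp)
      have hd1 : HasFDerivAt (fun x : E3 => χ (ε⁻¹ • x))
          ((fderiv ℝ χ (ε⁻¹ • x)).comp (ε⁻¹ • ContinuousLinearMap.id ℝ E3)) x := by
        have h1 : HasFDerivAt χ (fderiv ℝ χ (ε⁻¹ • x)) (ε⁻¹ • x) :=
          (hχ.differentiable (by simp) _).hasFDerivAt
        exact HasFDerivAt.comp (g := χ) x h1 ((hasFDerivAt_id x).const_smul ε⁻¹)
      have hd := hd1.smul hwd.hasFDerivAt
      have : fderiv ℝ u x = _ := hd.fderiv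
      rw [this]
      obtain ⟨h1, h2⟩ := hb x hx
      have hn1 : ‖(fderiv ℝ χ (ε⁻¹ • x)).comp (ε⁻¹ • ContinuousLinearMap.id ℝ E3)‖
          ≤ max C 1 * ε⁻¹ := by
        refine (ContinuousLinearMap.opNorm_comp_le _ _).trans ?_
        refine mul_le_mul ((hC _).trans (le_max_left _ _)) ?_ (norm_nonneg _) (by positivity)
        rw [norm_smul, norm_inv, Real.norm_of_nonneg hε.le]
        exact mul_le_of_le_one_right (by positivity) ContinuousLinearMap.norm_id_le
      have hχ1 : ‖χ (ε⁻¹ • x)‖ ≤ 1 := by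
        rw [Real.norm_of_nonneg χ.nonneg]; exact χ.le_one
      have hb0 : 0 ≤ b := (norm_nonneg _).trans h2
      calc _ ≤ ‖χ (ε⁻¹ • x) • fderiv ℝ w x‖ +
            ‖((fderiv ℝ χ (ε⁻¹ • x)).comp (ε⁻¹ • ContinuousLinearMap.id ℝ E3)).smulRight (w x)‖ :=
            norm_add_le _ _
        _ ≤ 1 * b + (max C 1 * ε⁻¹) * (a * ε) := by
            rw [norm_smul, ContinuousLinearMap.norm_smulRight_apply]
            gcongr
        _ = max C 1 * a + b := by field_simp; ring
        _ ≤ 1 / 2 := hab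
    · rw [(hu0 x hx).fderiv_eq]
      simp
  obtain ⟨Φ, hΦ⟩ := exists_diffeomorph_id_add hu hbound
  refine ⟨Φ, fun x hx => ?_, fun x hx => ?_⟩
  · rw [hΦ]; simp [u, hzero x hx]
  · rw [hΦ]
    have : χ (ε⁻¹ • x) = 1 := by
      apply χ.one_of_mem_closedBall
      rw [mem_closedBall_zero_iff, norm_smul, norm_inv, Real.norm_of_nonneg hε.le]
      change ε⁻¹ * ‖x‖ ≤ 3 / 4
      rw [inv_mul_eq_div, div_le_iff₀ hε]
      exact hx
    simp [u, this]

/-- `Φ` is a diffeomorphism of Euclidean space that is the identity near and beyond the sphere of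
radius `r`. -/
def SupportedInBall (r : ℝ) (Φ : E3 ≃ₘ^∞⟮𝓡 3, 𝓡 3⟯ E3) : Prop :=
  ∃ r' < r, 0 < r' ∧ ∀ x, r' ≤ ‖x‖ → Φ x = x

theorem SupportedInBall.symm {r : ℝ} {Φ : E3 ≃ₘ^∞⟮𝓡 3, 𝓡 3⟯ E3} (h : SupportedInBall r Φ) :
    SupportedInBall r Φ.symm := by
  obtain ⟨r', hr, h0, h⟩ := h
  refine ⟨r', hr, h0, fun x hx => ?_⟩
  rw [← h x hx, Φ.symm_apply_apply, h x hx]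

theorem SupportedInBall.trans {r : ℝ} {Φ Ψ : E3 ≃ₘ^∞⟮𝓡 3, 𝓡 3⟯ E3} (hΦ : SupportedInBall r Φ)
    (hΨ : SupportedInBall r Ψ) : SupportedInBall r (Φ.trans Ψ) := by
  obtain ⟨r₁, hr₁, h₁0, h₁⟩ := hΦ
  obtain ⟨r₂, hr₂, h₂0, h₂⟩ := hΨ
  refine ⟨max r₁ r₂, max_lt hr₁ hr₂, lt_max_of_lt_left h₁0, fun x hx => ?_⟩
  rw [Diffeomorph.coe_trans, Function.comp_apply, h₁ x (le_trans (le_max_left _ _) hx),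
    h₂ x (le_trans (le_max_right _ _) hx)]

theorem SupportedInBall.norm_lt {r : ℝ} {Φ : E3 ≃ₘ^∞⟮𝓡 3, 𝓡 3⟯ E3} (h : SupportedInBall r Φ)
    {x : E3} (hx : ‖x‖ < r) : ‖Φ x‖ < r := by
  obtain ⟨r', hr, -, h⟩ := h
  by_contra hc
  have h1 : Φ (Φ x) = Φ x := h _ (by linarith)
  have h2 : Φ x = x := Φ.injective h1
  rw [h2] at hc
  exact hc hx

/-- A translation by a small vector is realized, at the origin, by a diffeomorphism supported in a
given ball. -/
theorem exists_supported_translation {r : ℝ} (hr : 0 < r) :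
    ∃ δ > 0, ∀ v : E3, ‖v‖ < δ → ∃ Φ, SupportedInBall r Φ ∧ Φ 0 = v := by
  obtain ⟨C, hC, h⟩ := exists_diffeomorph_cutoff
  refine ⟨r / 2 / (2 * C), by positivity, fun v hv => ?_⟩
  have hb : ‖v‖ ≤ 1 / (2 * C) * (r / 2) := hv.le.trans (le_of_eq (by ring))
  obtain ⟨Φ, h1, h2⟩ := h (r / 2) (fun _ => v) (1 / (2 * C)) 0 univ (by positivity) isOpen_univ
    (subset_univ _) contDiffOn_const (fun x _ => ⟨hb, by simp⟩) (by field_simp; simp)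
  refine ⟨Φ, ⟨r / 2, by linarith, by positivity, h1⟩, ?_⟩
  rw [h2 0 (by rw [norm_zero]; positivity), zero_add]

/-- A contraction with ratio close to `1` extends from the unit ball to a diffeomorphism supported
in the ball of radius `2`. -/
theorem exists_supported_contraction :
    ∃ μ : ℝ, 0 < μ ∧ μ < 1 ∧ ∃ Φ, SupportedInBall 2 Φ ∧ ∀ x, ‖x‖ ≤ 1 → Φ x = μ • x := by
  obtain ⟨C, hC, h⟩ := exists_diffeomorph_cutoff
  set δ := 1 / (2 * (C + 1)) with hδ
  have hδ0 : 0 < δ := by positivity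
  have hδ1 : δ < 1 := by
    rw [hδ, div_lt_one (by positivity)]; linarith
  have hf : ∀ x, fderiv ℝ (fun x : E3 => (-δ) • x) x = (-δ) • ContinuousLinearMap.id ℝ E3 :=
    fun x => ((hasFDerivAt_id x).const_smul (-δ)).fderiv
  have hb : ∀ x ∈ closedBall (0 : E3) (3 / 2), ‖(-δ) • x‖ ≤ δ * (3 / 2) ∧
      ‖fderiv ℝ (fun x : E3 => (-δ) • x) x‖ ≤ δ := by
    intro x hx
    constructor
    · rw [norm_smul, norm_neg, Real.norm_of_nonneg hδ0.le]
      have : ‖x‖ ≤ 3 / 2 := by simpa using hx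
      gcongr
    · rw [hf, norm_smul, norm_neg, Real.norm_of_nonneg hδ0.le]
      exact mul_le_of_le_one_right hδ0.le ContinuousLinearMap.norm_id_le
  obtain ⟨Φ, h1, h2⟩ := h (3 / 2) (fun x => (-δ) • x) δ δ univ (by positivity) isOpen_univ
    (subset_univ _) (contDiff_const_smul _).contDiffOn hb (by rw [hδ]; field_simp; linarith)
  refine ⟨1 - δ, by linarith, by linarith, Φ, ⟨3 / 2, by norm_num, by norm_num, h1⟩, ?_⟩
  intro x hx
  rw [h2 x (by linarith), sub_smul, one_smul, neg_smul, sub_eq_add_neg]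

/-- A local diffeomorphism at the origin agrees near the origin with its derivative up to a
diffeomorphism supported in a given small ball. -/
theorem exists_supported_linearization {g : E3 → E3} {L : E3 ≃L[ℝ] E3} {U : Set E3}
    (hU : U ∈ 𝓝 (0 : E3)) (hg : ContDiffOn ℝ ∞ g U) (g0 : g 0 = 0)
    (hL : HasFDerivAt g (L : E3 →L[ℝ] E3) 0) {r : ℝ} (hr : 0 < r) :
    ∃ Φ, SupportedInBall r Φ ∧ ∀ᶠ x in 𝓝 (0 : E3), Φ (L x) = g x := by
  obtain ⟨C, hC, h⟩ := exists_diffeomorph_cutoff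
  let w : E3 → E3 := fun y => g (L.symm y) - y
  have hLs : Filter.Tendsto L.symm (𝓝 0) (𝓝 0) := by
    have := L.symm.continuous.tendsto 0
    rwa [map_zero] at this
  obtain ⟨V, hVU, hVo, hV0⟩ := _root_.mem_nhds_iff.1 (hLs hU)
  have hw : ContDiffOn ℝ ∞ w V := by
    refine ContDiffOn.sub ?_ contDiffOn_id
    exact hg.comp L.symm.contDiff.contDiffOn hVU
  have hw0 : w 0 = 0 := by simp [w, g0]
  have hwd : HasFDerivAt w (0 : E3 →L[ℝ] E3) 0 := by
    have h1 : HasFDerivAt (fun y => g (L.symm y))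
        ((L : E3 →L[ℝ] E3).comp (L.symm : E3 →L[ℝ] E3)) 0 := by
      refine HasFDerivAt.comp (0 : E3) ?_ L.symm.hasFDerivAt
      rwa [map_zero]
    have := h1.sub (hasFDerivAt_id (0 : E3))
    convert! this using 1
    ext x
    simp
  have hcont : ContinuousAt (fderiv ℝ w) 0 :=
    (hw.continuousOn_fderiv_of_isOpen hVo (by simp)).continuousAt (hVo.mem_nhds hV0)
  set c := 1 / (2 * (C + 1)) with hc
  have hc0 : 0 < c := by positivity
  have hsmall : ∀ᶠ x in 𝓝 (0 : E3), ‖fderiv ℝ w x‖ ≤ c := by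
    have h1 := hcont.norm
    rw [ContinuousAt, hwd.fderiv, norm_zero] at h1
    exact h1.eventually (ge_mem_nhds hc0)
  have hlin : ∀ᶠ x in 𝓝 (0 : E3), ‖w x‖ ≤ c * ‖x‖ := by
    have := (hasFDerivAt_iff_isLittleO_nhds_zero.1 hwd).bound hc0
    filter_upwards [this] with x hx
    simpa [hw0] using hx
  obtain ⟨η, hη, hball⟩ := Metric.eventually_nhds_iff_ball.1
    (hsmall.and (hlin.and (hVo.eventually_mem hV0)))
  have hε : 0 < min (η / 2) (r / 2) := by positivity
  set ε := min (η / 2) (r / 2) with hεd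
  have hin : closedBall (0 : E3) ε ⊆ ball 0 η :=
    closedBall_subset_ball (lt_of_le_of_lt (min_le_left _ _) (by linarith))
  have hb : ∀ x ∈ closedBall (0 : E3) ε, ‖w x‖ ≤ c * ε ∧ ‖fderiv ℝ w x‖ ≤ c := by
    refine fun x hx => ⟨(hball x (hin hx)).2.1.trans ?_, (hball x (hin hx)).1⟩
    have : ‖x‖ ≤ ε := by simpa using hx
    gcongr
  obtain ⟨Φ, h1, h2⟩ := h ε w c c V hε hVo (fun x hx => hball x (hin hx) |>.2.2) hw hb
    (by rw [hc]; field_simp; linarith)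
  refine ⟨Φ, ⟨ε, lt_of_le_of_lt (min_le_right _ _) (by linarith), hε, h1⟩, ?_⟩
  have hLt : Filter.Tendsto L (𝓝 0) (𝓝 0) := by
    have := L.continuous.tendsto 0
    rwa [map_zero] at this
  filter_upwards [hLt (closedBall_mem_nhds (0 : E3) (show 0 < 3 / 4 * ε by positivity))] with x hx
  rw [h2 (L x) (by simpa using hx)]
  simp [w]

/-! ### Linear germs of compactly supported diffeomorphisms -/

/-- The linear map `A` agrees near the origin with diffeomorphisms of arbitrarily small support. -/
def IsRealizable (A : E3 →L[ℝ] E3) : Prop :=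
  ∀ r > 0, ∃ Φ, SupportedInBall r Φ ∧ ∀ᶠ x in 𝓝 (0 : E3), Φ x = A x

theorem IsRealizable.mul {A B : E3 →L[ℝ] E3} (hA : IsRealizable A) (hB : IsRealizable B) :
    IsRealizable (A * B) := by
  intro r hr
  obtain ⟨Φ, hΦ, hΦA⟩ := hA r hr
  obtain ⟨Ψ, hΨ, hΨB⟩ := hB r hr
  refine ⟨Ψ.trans Φ, hΨ.trans hΦ, ?_⟩
  have hBt : Filter.Tendsto B (𝓝 0) (𝓝 0) := by
    have := B.continuous.tendsto 0
    rwa [map_zero] at this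
  filter_upwards [hΨB, hBt.eventually hΦA] with x h1 h2
  rw [Diffeomorph.coe_trans, Function.comp_apply, h1, h2]
  rfl

theorem isRealizable_one : IsRealizable 1 := fun r hr =>
  ⟨Diffeomorph.refl _ _ _, ⟨r / 2, by linarith, by positivity, fun _ _ => rfl⟩,
    Filter.Eventually.of_forall fun _ => rfl⟩

theorem IsRealizable.pow {A : E3 →L[ℝ] E3} (hA : IsRealizable A) (n : ℕ) :
    IsRealizable (A ^ n) := by
  induction n with
  | zero => rw [pow_zero]; exact isRealizable_one
  | succ n ih => rw [pow_succ]; exact ih.mul hA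

/-- Linear maps close to the identity can be cut off, at every scale. -/
theorem exists_isRealizable_of_norm_sub_lt :
    ∃ δ > 0, ∀ A : E3 →L[ℝ] E3, ‖A - 1‖ < δ → IsRealizable A := by
  obtain ⟨C, hC, h⟩ := exists_diffeomorph_cutoff
  refine ⟨1 / (2 * (C + 1)), by positivity, fun A hA r hr => ?_⟩
  have hb : ∀ x ∈ closedBall (0 : E3) (r / 2), ‖(A - 1 : E3 →L[ℝ] E3) x‖ ≤ ‖A - 1‖ * (r / 2) ∧
      ‖fderiv ℝ (A - 1 : E3 →L[ℝ] E3) x‖ ≤ ‖A - 1‖ := by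
    intro x hx
    rw [ContinuousLinearMap.fderiv]
    refine ⟨((A - 1).le_opNorm x).trans ?_, le_rfl⟩
    have : ‖x‖ ≤ r / 2 := by simpa using hx
    gcongr
  have hc : C * ‖A - 1‖ + ‖A - 1‖ ≤ 1 / 2 := by
    have h1 : (C + 1) * ‖A - 1‖ ≤ (C + 1) * (1 / (2 * (C + 1))) := by gcongr
    have h2 : (C + 1) * (1 / (2 * (C + 1))) = 1 / 2 := by field_simp
    linarith
  obtain ⟨Φ, h1, h2⟩ := h (r / 2) (A - 1 : E3 →L[ℝ] E3) ‖A - 1‖ ‖A - 1‖ univ (by positivity) isOpen_univ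
    (subset_univ _) (A - 1 : E3 →L[ℝ] E3).contDiff.contDiffOn hb hc
  refine ⟨Φ, ⟨r / 2, by linarith, by positivity, h1⟩, ?_⟩
  filter_upwards [closedBall_mem_nhds (0 : E3) (show 0 < 3 / 4 * (r / 2) by positivity)] with x hx
  rw [h2 x (by simpa using hx)]
  simp

/-- The linear map of Euclidean `3`-space given by a matrix. -/
noncomputable def matrixMap (A : Matrix (Fin 3) (Fin 3) ℝ) : E3 →L[ℝ] E3 :=
  Matrix.toEuclideanCLM (n := Fin 3) (𝕜 := ℝ) A

theorem matrixMap_mul (A B : Matrix (Fin 3) (Fin 3) ℝ) :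
    matrixMap (A * B) = matrixMap A * matrixMap B := map_mul _ A B

theorem matrixMap_one : matrixMap 1 = 1 := map_one _

/-- Every member of a one-parameter group is a power of members close to the identity. -/
theorem isRealizable_of_oneParameter {γ : ℝ → Matrix (Fin 3) (Fin 3) ℝ} (hc : Continuous γ)
    (h0 : γ 0 = 1) (hadd : ∀ s t, γ (s + t) = γ s * γ t) (t : ℝ) :
    IsRealizable (matrixMap (γ t)) := by
  obtain ⟨δ, hδ, h⟩ := exists_isRealizable_of_norm_sub_lt
  have hm : Continuous matrixMap := LinearMap.continuous_of_finiteDimensional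
    (Matrix.toEuclideanCLM (n := Fin 3) (𝕜 := ℝ)).toAlgEquiv.toLinearMap
  have hlim : Filter.Tendsto (fun n : ℕ => matrixMap (γ (t / n))) Filter.atTop (𝓝 1) := by
    have h1 := (hm.comp hc).tendsto 0
    rw [Function.comp_apply, h0, matrixMap_one] at h1
    exact h1.comp (tendsto_const_div_atTop_nhds_zero_nat t)
  have hev := (hlim.eventually (Metric.ball_mem_nhds _ hδ)).and (Filter.eventually_gt_atTop 0)
  obtain ⟨n, hn, hn0⟩ := hev.exists
  have hpow : ∀ (s : ℝ) (k : ℕ), γ (k * s) = γ s ^ k := by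
    intro s k
    induction k with
    | zero => simp [h0]
    | succ k ih => rw [pow_succ, ← ih, ← hadd]; push_cast; ring_nf
  have hmp : ∀ (A : Matrix (Fin 3) (Fin 3) ℝ) (k : ℕ), matrixMap (A ^ k) = matrixMap A ^ k :=
    fun A k => map_pow _ A k
  have hn' : (n : ℝ) ≠ 0 := by exact_mod_cast hn0.ne'
  have : γ t = γ (t / n) ^ n := by
    rw [← hpow]; congr 1; field_simp
  rw [this, hmp]
  exact (h _ (by simpa [dist_eq_norm] using hn)).pow n

/-- The reflection `(x₀, x₁, x₂) ↦ (x₀, x₁, -x₂)`. -/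
noncomputable def reflectLast : E3 ≃ₗᵢ[ℝ] E3 :=
  LinearIsometryEquiv.piLpCongrRight 2
    (fun i : Fin 3 => if i = 2 then LinearIsometryEquiv.neg ℝ else LinearIsometryEquiv.refl ℝ ℝ)

theorem reflectLast_apply_zero (x : E3) : reflectLast x 0 = x 0 := by
  simp [reflectLast]

theorem reflectLast_apply_one (x : E3) : reflectLast x 1 = x 1 := by
  simp [reflectLast]

theorem reflectLast_apply_two (x : E3) : reflectLast x 2 = -x 2 := by
  simp [reflectLast]

theorem reflectLast_reflectLast (x : E3) : reflectLast (reflectLast x) = x := by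
  ext i
  fin_cases i
  · exact (reflectLast_apply_zero _).trans (reflectLast_apply_zero _)
  · exact (reflectLast_apply_one _).trans (reflectLast_apply_one _)
  · exact (reflectLast_apply_two _).trans (by rw [reflectLast_apply_two, neg_neg]; rfl)

/-- `reflectLast` as a continuous linear map. -/
noncomputable def reflectLastCLM : E3 →L[ℝ] E3 :=
  (reflectLast.toContinuousLinearEquiv : E3 →L[ℝ] E3)

theorem reflectLastCLM_mul_self : reflectLastCLM * reflectLastCLM = 1 := by
  ext1 x
  exact reflectLast_reflectLast x

theorem matrixMap_diagonal_eq_reflectLastCLM :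
    matrixMap (Matrix.diagonal ![1, 1, -1]) = reflectLastCLM := by
  ext x i
  have h : matrixMap (Matrix.diagonal ![1, 1, -1]) x i = (![1, 1, -1] : Fin 3 → ℝ) i * x i := by
    simp [matrixMap, Matrix.mulVec_diagonal]
  rw [h]
  change _ = reflectLast x i
  fin_cases i
  · exact (by simp : _ = x 0).trans (reflectLast_apply_zero x).symm
  · exact (by simp : _ = x 1).trans (reflectLast_apply_one x).symm
  · exact (by simp : _ = - x 2).trans (reflectLast_apply_two x).symm

theorem IsRealizable.conj_reflectLast {A : E3 →L[ℝ] E3} (hA : IsRealizable A) :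
    IsRealizable (reflectLastCLM * A * reflectLastCLM) := by
  intro r hr
  obtain ⟨Φ, ⟨r', hr', h0, hΦ⟩, hΦA⟩ := hA r hr
  let σ : E3 ≃ₘ^∞⟮𝓡 3, 𝓡 3⟯ E3 := reflectLast.toContinuousLinearEquiv.toDiffeomorph
  have hσ : ∀ x, σ x = reflectLast x := fun x => rfl
  refine ⟨(σ.trans Φ).trans σ, ⟨r', hr', h0, fun x hx => ?_⟩, ?_⟩
  · simp only [Diffeomorph.coe_trans, Function.comp_apply, hσ]
    rw [hΦ _ (by rwa [reflectLast.norm_map]), reflectLast_reflectLast]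
  · have ht : Filter.Tendsto reflectLast (𝓝 0) (𝓝 0) := by
      have := reflectLast.continuous.tendsto 0
      rwa [map_zero] at this
    filter_upwards [ht.eventually hΦA] with x hx
    simp only [Diffeomorph.coe_trans, Function.comp_apply, hσ, hx]
    rfl

/-- `A` is realizable, possibly after composition with `reflectLast`. -/
def IsRealizableUpToReflection (A : E3 →L[ℝ] E3) : Prop :=
  IsRealizable A ∨ ∃ B, IsRealizable B ∧ A = B * reflectLastCLM

theorem IsRealizableUpToReflection.mul {A B : E3 →L[ℝ] E3} (hA : IsRealizableUpToReflection A)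
    (hB : IsRealizableUpToReflection B) : IsRealizableUpToReflection (A * B) := by
  have hs := reflectLastCLM_mul_self
  rcases hA with hA | ⟨A, hA, rfl⟩ <;> rcases hB with hB | ⟨B, hB, rfl⟩
  · exact Or.inl (hA.mul hB)
  · exact Or.inr ⟨A * B, hA.mul hB, by rw [mul_assoc]⟩
  · refine Or.inr ⟨_, hA.mul hB.conj_reflectLast, ?_⟩
    rw [mul_assoc, mul_assoc, mul_assoc, mul_assoc, hs, mul_one]
  · refine Or.inl ?_
    have := hA.mul hB.conj_reflectLast
    simpa only [mul_assoc] using this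

theorem isRealizable_transvection {i j : Fin 3} (hij : i ≠ j) (c : ℝ) :
    IsRealizable (matrixMap (Matrix.transvection i j c)) := by
  refine isRealizable_of_oneParameter (γ := fun t => Matrix.transvection i j t) ?_
    (Matrix.transvection_zero i j) (fun s t => ?_) c
  · simp only [Matrix.transvection]
    refine continuous_const.add ?_
    refine continuous_matrix fun a b => ?_
    simp only [Matrix.single_apply]
    split_ifs
    · exact continuous_id
    · exact continuous_const
  · rw [Matrix.transvection_mul_transvection_same _ _ hij]

theorem isRealizable_diagonal_update_of_pos (i : Fin 3) {d : ℝ} (hd : 0 < d) :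
    IsRealizable (matrixMap (Matrix.diagonal (Function.update 1 i d))) := by
  have h := isRealizable_of_oneParameter
    (γ := fun t => Matrix.diagonal (Function.update (1 : Fin 3 → ℝ) i (Real.exp t)))
    ?_ ?_ ?_ (Real.log d)
  · simpa only [Real.exp_log hd] using h
  · exact Continuous.matrix_diagonal (continuous_const.update i Real.continuous_exp)
  · rw [Real.exp_zero]
    have : Function.update (1 : Fin 3 → ℝ) i 1 = 1 := Function.update_eq_self i 1
    rw [this]; exact Matrix.diagonal_one
  · intro s t
    rw [Matrix.diagonal_mul_diagonal, Real.exp_add]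
    congr 1
    ext k
    by_cases hk : k = i
    · subst hk; simp
    · simp [hk]

/-- The reflection in any coordinate is conjugate to `reflectLast` by a product of transvections. -/
theorem isRealizableUpToReflection_neg_one (i : Fin 3) :
    IsRealizableUpToReflection (matrixMap (Matrix.diagonal (Function.update 1 i (-1)))) := by
  have h2 : IsRealizableUpToReflection (matrixMap (Matrix.diagonal ![1, 1, -1])) :=
    Or.inr ⟨1, isRealizable_one, by rw [one_mul, matrixMap_diagonal_eq_reflectLastCLM]⟩
  by_cases hi : i = 2
  · subst hi
    convert! h2 using 3
    ext k
    fin_cases k <;> simp [Function.update]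
  · -- A quarter turn in the plane of the coordinates `i` and `2` is a product of transvections,
    -- and it conjugates one reflection to the other.
    have ht : ∀ {a b : Fin 3} (_ : a ≠ b) (c : ℝ),
        IsRealizableUpToReflection (matrixMap (Matrix.transvection a b c)) :=
      fun hab c => Or.inl (isRealizable_transvection hab c)
    have hi' : (2 : Fin 3) ≠ i := fun h => hi h.symm
    have key := ((((((ht hi 1).mul (ht hi' (-1))).mul (ht hi 1)).mul h2).mul (ht hi (-1))).mul
      (ht hi' 1)).mul (ht hi (-1))
    simp only [← matrixMap_mul] at key
    convert! key using 2
    have e : ∀ c : ℝ, Matrix.transvection (0 : Fin 3) 2 c = !![1, 0, c; 0, 1, 0; 0, 0, 1] ∧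
        Matrix.transvection (2 : Fin 3) 0 c = !![1, 0, 0; 0, 1, 0; c, 0, 1] ∧
        Matrix.transvection (1 : Fin 3) 2 c = !![1, 0, 0; 0, 1, c; 0, 0, 1] ∧
        Matrix.transvection (2 : Fin 3) 1 c = !![1, 0, 0; 0, 1, 0; 0, c, 1] := by
      intro c
      refine ⟨?_, ?_, ?_, ?_⟩ <;> ext a b <;> fin_cases a <;> fin_cases b <;>
        simp [Matrix.transvection]
    have d : Matrix.diagonal (![1, 1, -1] : Fin 3 → ℝ) = !![1, 0, 0; 0, 1, 0; 0, 0, -1] := by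
      ext a b; fin_cases a <;> fin_cases b <;> simp
    fin_cases i
    · have d0 : Matrix.diagonal (Function.update (1 : Fin 3 → ℝ) 0 (-1)) =
          !![-1, 0, 0; 0, 1, 0; 0, 0, 1] := by
        ext a b; fin_cases a <;> fin_cases b <;> simp
      change Matrix.diagonal (Function.update (1 : Fin 3 → ℝ) 0 (-1)) =
        Matrix.transvection (0 : Fin 3) 2 1 * Matrix.transvection (2 : Fin 3) 0 (-1) *
          Matrix.transvection (0 : Fin 3) 2 1 * Matrix.diagonal ![1, 1, -1] *
          Matrix.transvection (0 : Fin 3) 2 (-1) * Matrix.transvection (2 : Fin 3) 0 1 *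
          Matrix.transvection (0 : Fin 3) 2 (-1)
      rw [d0, d, (e 1).1, (e (-1)).1, (e 1).2.1, (e (-1)).2.1]
      simp only [Matrix.mul_fin_three]
      norm_num
    · have d1 : Matrix.diagonal (Function.update (1 : Fin 3 → ℝ) 1 (-1)) =
          !![1, 0, 0; 0, -1, 0; 0, 0, 1] := by
        ext a b; fin_cases a <;> fin_cases b <;> simp
      change Matrix.diagonal (Function.update (1 : Fin 3 → ℝ) 1 (-1)) =
        Matrix.transvection (1 : Fin 3) 2 1 * Matrix.transvection (2 : Fin 3) 1 (-1) *
          Matrix.transvection (1 : Fin 3) 2 1 * Matrix.diagonal ![1, 1, -1] *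
          Matrix.transvection (1 : Fin 3) 2 (-1) * Matrix.transvection (2 : Fin 3) 1 1 *
          Matrix.transvection (1 : Fin 3) 2 (-1)
      rw [d1, d, (e 1).2.2.1, (e (-1)).2.2.1, (e 1).2.2.2, (e (-1)).2.2.2]
      simp only [Matrix.mul_fin_three]
      norm_num
    · exact absurd rfl hi

theorem isRealizableUpToReflection_diagonal_update (i : Fin 3) {d : ℝ} (hd : d ≠ 0) :
    IsRealizableUpToReflection (matrixMap (Matrix.diagonal (Function.update 1 i d))) := by
  rcases lt_or_gt_of_ne hd with hd | hd
  · have h := IsRealizableUpToReflection.mul (Or.inl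
      (isRealizable_diagonal_update_of_pos i (neg_pos.2 hd))) (isRealizableUpToReflection_neg_one i)
    rw [← matrixMap_mul, Matrix.diagonal_mul_diagonal] at h
    convert! h using 3
    ext k
    by_cases hk : k = i
    · subst hk; simp
    · simp [hk]
  · exact Or.inl (isRealizable_diagonal_update_of_pos i hd)

/-- Every invertible linear map is realizable up to a reflection, by elimination. -/
theorem isRealizableUpToReflection_of_equiv (L : E3 ≃L[ℝ] E3) :
    IsRealizableUpToReflection (L : E3 →L[ℝ] E3) := by
  obtain ⟨A, hA⟩ : ∃ A, matrixMap A = (L : E3 →L[ℝ] E3) :=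
    (Matrix.toEuclideanCLM (n := Fin 3) (𝕜 := ℝ)).surjective _
  obtain ⟨B, hB⟩ : ∃ B, matrixMap B = (L.symm : E3 →L[ℝ] E3) :=
    (Matrix.toEuclideanCLM (n := Fin 3) (𝕜 := ℝ)).surjective _
  have hAB : A * B = 1 := by
    apply (Matrix.toEuclideanCLM (n := Fin 3) (𝕜 := ℝ)).injective
    change matrixMap (A * B) = matrixMap 1
    rw [matrixMap_mul, hA, hB, matrixMap_one]
    ext1 x
    simp
  have hdet : A.det ≠ 0 := by
    intro h0
    have := congrArg Matrix.det hAB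
    rw [Matrix.det_mul, h0, zero_mul, Matrix.det_one] at this
    exact zero_ne_one this
  rw [← hA]
  refine Matrix.diagonal_transvection_induction_of_det_ne_zero
    (fun A => IsRealizableUpToReflection (matrixMap A)) A hdet ?_ ?_ ?_
  · intro D hD
    rw [Matrix.det_diagonal, Finset.prod_ne_zero_iff] at hD
    have h := ((isRealizableUpToReflection_diagonal_update 0 (hD 0 (Finset.mem_univ _))).mul
      (isRealizableUpToReflection_diagonal_update 1 (hD 1 (Finset.mem_univ _)))).mul
      (isRealizableUpToReflection_diagonal_update 2 (hD 2 (Finset.mem_univ _)))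
    simp only [← matrixMap_mul, Matrix.diagonal_mul_diagonal] at h
    convert! h using 3
    ext k
    fin_cases k <;> simp [Function.update]
  · exact fun t => Or.inl (isRealizable_transvection t.hij t.c)
  · intro A B _ _ hA hB
    rw [matrixMap_mul]
    exact hA.mul hB

/-! ### Uniqueness of embedded balls up to diffeomorphism -/

section
variable {M : Type*} [TopologicalSpace M] [ChartedSpace E3 M]

/-- `s` is a diffeomorphism of the ball of radius `r` about the origin onto an open subset. -/
structure IsBallEmbedding (s : PartialEquiv E3 M) (r : ℝ) : Prop where
  isDiffeo : IsDiffeoBetween (𝓡 3) (𝓡 3) s (ball 0 r) s.target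
  isOpen_target : IsOpen s.target

namespace IsBallEmbedding

variable {s : PartialEquiv E3 M} {r : ℝ}

theorem mem_source (hs : IsBallEmbedding s r) {x : E3} : x ∈ s.source ↔ ‖x‖ < r := by
  rw [hs.isDiffeo.source_eq, mem_ball_zero_iff]

theorem map_mem (hs : IsBallEmbedding s r) {x : E3} (hx : ‖x‖ < r) : s x ∈ s.target :=
  s.map_source (hs.mem_source.2 hx)

theorem norm_symm_lt (hs : IsBallEmbedding s r) {y : M} (hy : y ∈ s.target) : ‖s.symm y‖ < r :=
  hs.mem_source.1 (s.map_target hy)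

theorem left_inv (hs : IsBallEmbedding s r) {x : E3} (hx : ‖x‖ < r) : s.symm (s x) = x :=
  s.left_inv (hs.mem_source.2 hx)

theorem continuousOn (hs : IsBallEmbedding s r) : ContinuousOn s (ball 0 r) :=
  hs.isDiffeo.contMDiffOn.continuousOn

theorem continuousOn_symm (hs : IsBallEmbedding s r) : ContinuousOn s.symm s.target :=
  hs.isDiffeo.contMDiffOn_symm.continuousOn

/-- `s` as an open partial homeomorphism. -/
noncomputable def toOpenPartialHomeomorph (hs : IsBallEmbedding s r) :
    OpenPartialHomeomorph E3 M where
  toPartialEquiv := s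
  open_source := by rw [hs.isDiffeo.source_eq]; exact isOpen_ball
  open_target := hs.isOpen_target
  continuousOn_toFun := by rw [hs.isDiffeo.source_eq]; exact hs.continuousOn
  continuousOn_invFun := hs.continuousOn_symm

theorem isOpen_image (hs : IsBallEmbedding s r) {A : Set E3} (hA : IsOpen A)
    (hAr : A ⊆ ball 0 r) : IsOpen (s '' A) :=
  hs.toOpenPartialHomeomorph.isOpen_image_of_subset_source hA
    (by change A ⊆ s.source; rwa [hs.isDiffeo.source_eq])

theorem isClosed_image_closedBall [T2Space M] (hs : IsBallEmbedding s r) {r' : ℝ} (hr : r' < r) :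
    IsClosed (s '' closedBall 0 r') :=
  ((isCompact_closedBall _ _).image_of_continuousOn
    (hs.continuousOn.mono (closedBall_subset_ball hr))).isClosed

theorem contMDiffAt (hs : IsBallEmbedding s r) {x : E3} (hx : ‖x‖ < r) :
    ContMDiffAt (𝓡 3) (𝓡 3) ∞ s x :=
  hs.isDiffeo.contMDiffOn.contMDiffAt (isOpen_ball.mem_nhds (mem_ball_zero_iff.2 hx))

theorem contMDiffAt_symm (hs : IsBallEmbedding s r) {y : M} (hy : y ∈ s.target) :
    ContMDiffAt (𝓡 3) (𝓡 3) ∞ s.symm y :=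
  hs.isDiffeo.contMDiffOn_symm.contMDiffAt (hs.isOpen_target.mem_nhds hy)

end IsBallEmbedding

open Classical in
/-- The extension by the identity of a diffeomorphism of a ball along an embedding of the ball. -/
noncomputable def extendByIdentity (s : PartialEquiv E3 M) (Φ : E3 → E3) (y : M) : M :=
  if y ∈ s.target then s (Φ (s.symm y)) else y

theorem contMDiff_extendByIdentity [T2Space M] {s : PartialEquiv E3 M} {r : ℝ}
    (hs : IsBallEmbedding s r) {Φ : E3 ≃ₘ^∞⟮𝓡 3, 𝓡 3⟯ E3} (hΦ : SupportedInBall r Φ) :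
    ContMDiff (𝓡 3) (𝓡 3) ∞ (extendByIdentity s Φ) := by
  intro y
  have hΦ' := hΦ
  obtain ⟨r', hr, h0, h⟩ := hΦ
  by_cases hy : y ∈ s.target
  · have h1 : ContMDiffAt (𝓡 3) (𝓡 3) ∞ (s ∘ Φ ∘ s.symm) y :=
      ContMDiffAt.comp y (hs.contMDiffAt (hΦ'.norm_lt (hs.norm_symm_lt hy)))
        (ContMDiffAt.comp y Φ.contMDiff.contMDiffAt (hs.contMDiffAt_symm hy))
    refine h1.congr_of_eventuallyEq ?_
    filter_upwards [hs.isOpen_target.mem_nhds hy] with z hz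
    simp [extendByIdentity, hz]
  · have hc := hs.isClosed_image_closedBall hr
    have hyc : y ∈ (s '' closedBall 0 r')ᶜ := by
      rintro ⟨x, hx, rfl⟩
      exact hy (hs.map_mem (lt_of_le_of_lt (by simpa using hx) hr))
    refine contMDiffAt_id.congr_of_eventuallyEq ?_
    filter_upwards [hc.isOpen_compl.mem_nhds hyc] with z hz
    by_cases hzt : z ∈ s.target
    · have : r' ≤ ‖s.symm z‖ := by
        by_contra hlt
        exact hz ⟨s.symm z, by simpa using (not_le.1 hlt).le, s.right_inv hzt⟩
      simp [extendByIdentity, hzt, h _ this, s.right_inv hzt]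
    · simp [extendByIdentity, hzt]

theorem extendByIdentity_symm_apply {s : PartialEquiv E3 M} {r : ℝ}
    (hs : IsBallEmbedding s r) {Φ : E3 ≃ₘ^∞⟮𝓡 3, 𝓡 3⟯ E3} (hΦ : SupportedInBall r Φ) (y : M) :
    extendByIdentity s Φ.symm (extendByIdentity s Φ y) = y := by
  by_cases hy : y ∈ s.target
  · have h1 := hΦ.norm_lt (hs.norm_symm_lt hy)
    simp [extendByIdentity, hy, hs.map_mem h1, hs.left_inv h1, s.right_inv hy]
  · simp [extendByIdentity, hy]

/-- A diffeomorphism supported in a ball extends along an embedding of the ball. -/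
theorem exists_diffeomorph_extension [T2Space M] {s : PartialEquiv E3 M} {r : ℝ}
    (hs : IsBallEmbedding s r) {Φ : E3 ≃ₘ^∞⟮𝓡 3, 𝓡 3⟯ E3} (hΦ : SupportedInBall r Φ) :
    ∃ h : M ≃ₘ^∞⟮𝓡 3, 𝓡 3⟯ M, ∀ x, ‖x‖ < r → h (s x) = s (Φ x) := by
  refine ⟨⟨⟨extendByIdentity s Φ, extendByIdentity s Φ.symm,
    extendByIdentity_symm_apply hs hΦ, ?_⟩, contMDiff_extendByIdentity hs hΦ,
    contMDiff_extendByIdentity hs hΦ.symm⟩, fun x hx => ?_⟩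
  · intro y
    exact extendByIdentity_symm_apply hs hΦ.symm y
  · change extendByIdentity s Φ (s x) = _
    simp [extendByIdentity, hs.map_mem hx, hs.left_inv hx]

/-- A chart, recentred, embeds a ball with any given centre. -/
theorem exists_isBallEmbedding [IsManifold (𝓡 3) ∞ M] (p : M) :
    ∃ (s : PartialEquiv E3 M) (r : ℝ), 0 < r ∧ IsBallEmbedding s r ∧ s 0 = p := by
  let φ := chartAt E3 p
  have hφ : ContMDiffOn (𝓡 3) (𝓡 3) ∞ φ φ.source := contMDiffOn_chart
  have hφs : ContMDiffOn (𝓡 3) (𝓡 3) ∞ φ.symm φ.target := contMDiffOn_chart_symm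
  obtain ⟨r, hr, hball⟩ := Metric.isOpen_iff.1 φ.open_target (φ p)
    (φ.map_source (mem_chart_source E3 p))
  let s : PartialEquiv E3 M :=
    { toFun := fun x => φ.symm (φ p + x)
      invFun := fun y => φ y - φ p
      source := ball 0 r
      target := φ.source ∩ φ ⁻¹' ball (φ p) r
      map_source' := fun x hx => by
        have : φ p + x ∈ ball (φ p) r := by simpa using hx
        exact ⟨φ.map_target (hball this), by rwa [mem_preimage, φ.right_inv (hball this)]⟩
      map_target' := fun y hy => by
        have := hy.2
        rw [mem_preimage, mem_ball, dist_eq_norm] at this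
        rwa [mem_ball_zero_iff]
      left_inv' := fun x hx => by
        have : φ p + x ∈ ball (φ p) r := by simpa using hx
        rw [φ.right_inv (hball this), add_sub_cancel_left]
      right_inv' := fun y hy => by rw [add_sub_cancel, φ.left_inv hy.1] }
  refine ⟨s, r, hr, ⟨⟨rfl, rfl, ?_, ?_⟩, ?_⟩, ?_⟩
  · refine hφs.comp (contDiff_const.add contDiff_id).contMDiff.contMDiffOn fun x hx => ?_
    exact hball (by simpa using hx)
  · have h1 : ContMDiffOn (𝓡 3) (𝓡 3) ∞ (fun y => φ y - φ p) φ.source :=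
      ContMDiff.comp_contMDiffOn (I' := 𝓡 3) (g := fun v : E3 => v - φ p)
        (contDiff_id.sub contDiff_const).contMDiff hφ
    exact h1.mono inter_subset_left
  · exact φ.isOpen_inter_preimage isOpen_ball
  · change φ.symm (φ p + 0) = p
    rw [add_zero, φ.left_inv (mem_chart_source E3 p)]

/-- The diffeomorphism group of a connected manifold is transitive. -/
theorem exists_diffeomorph_map_eq [IsManifold (𝓡 3) ∞ M] [T2Space M] [PreconnectedSpace M]
    (p q : M) : ∃ h : M ≃ₘ^∞⟮𝓡 3, 𝓡 3⟯ M, h p = q := by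
  let O : Set M := {q | ∃ h : M ≃ₘ^∞⟮𝓡 3, 𝓡 3⟯ M, h p = q}
  have hloc : ∀ y : M, ∀ᶠ z in 𝓝 y, ∃ h : M ≃ₘ^∞⟮𝓡 3, 𝓡 3⟯ M, h y = z := by
    intro y
    obtain ⟨s, r, hr, hs, rfl⟩ := exists_isBallEmbedding y
    obtain ⟨δ, hδ, ht⟩ := exists_supported_translation hr
    have hmem : s '' (ball 0 (min δ r)) ∈ 𝓝 (s 0) :=
      (hs.isOpen_image isOpen_ball (ball_subset_ball (min_le_right _ _))).mem_nhds
        ⟨0, by simp [hδ, hr], rfl⟩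
    filter_upwards [hmem]
    rintro _ ⟨v, hv, rfl⟩
    rw [mem_ball_zero_iff, lt_min_iff] at hv
    obtain ⟨Φ, hΦ, hΦv⟩ := ht v hv.1
    obtain ⟨h, hh⟩ := exists_diffeomorph_extension hs hΦ
    exact ⟨h, by rw [hh 0 (by simpa using hr), hΦv]⟩
  have hclopen : IsClopen O := by
    constructor
    · rw [← isOpen_compl_iff, isOpen_iff_mem_nhds]
      intro y hy
      filter_upwards [hloc y] with z ⟨h, hz⟩
      rintro ⟨k, hk⟩
      exact hy ⟨k.trans h.symm, by
        rw [Diffeomorph.coe_trans, Function.comp_apply, hk, ← hz, h.symm_apply_apply]⟩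
    · rw [isOpen_iff_mem_nhds]
      rintro y ⟨k, hk⟩
      filter_upwards [hloc y] with z ⟨h, hz⟩
      exact ⟨k.trans h, by rw [Diffeomorph.coe_trans, Function.comp_apply, hk, hz]⟩
  have : O = univ := hclopen.eq_univ ⟨p, Diffeomorph.refl _ _ _, rfl⟩
  have hq : q ∈ O := this ▸ mem_univ q
  exact hq

theorem exists_hasFDerivAt_equiv {g g' : E3 → E3} {a : E3} (hg : DifferentiableAt ℝ g a)
    (hg' : DifferentiableAt ℝ g' (g a)) (h : ∀ᶠ x in 𝓝 a, g' (g x) = x)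
    (h' : ∀ᶠ y in 𝓝 (g a), g (g' y) = y) :
    ∃ L : E3 ≃L[ℝ] E3, HasFDerivAt g (L : E3 →L[ℝ] E3) a := by
  have e : g' (g a) = a := h.self_of_nhds
  have h1 : (fderiv ℝ g' (g a)).comp (fderiv ℝ g a) = ContinuousLinearMap.id ℝ E3 := by
    refine HasFDerivAt.unique (f := g' ∘ g) (hg'.hasFDerivAt.comp a hg.hasFDerivAt) ?_
    exact (hasFDerivAt_id a).congr_of_eventuallyEq h
  have h2 : (fderiv ℝ g a).comp (fderiv ℝ g' (g a)) = ContinuousLinearMap.id ℝ E3 := by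
    refine HasFDerivAt.unique (f := g ∘ g')
      (HasFDerivAt.comp (g a) (by rw [e]; exact hg.hasFDerivAt) hg'.hasFDerivAt) ?_
    exact (hasFDerivAt_id _).congr_of_eventuallyEq h'
  refine ⟨ContinuousLinearEquiv.equivOfInverse _ _ (fun x => congrArg (· x) h1)
    (fun x => congrArg (· x) h2), ?_⟩
  exact hg.hasFDerivAt

/-- Two embedded balls in a connected `3`-manifold differ, after shrinking one of them, by a
diffeomorphism of the manifold and possibly a reflection. The ball is shrunk by the powers of one
number, which makes it possible to choose the same factor for several pairs of balls. -/
theorem exists_diffeomorph_ball_eq : ∃ μ : ℝ, 0 < μ ∧ μ < 1 ∧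
    ∀ {M : Type u} [TopologicalSpace M] [ChartedSpace E3 M] [IsManifold (𝓡 3) ∞ M] [T2Space M]
      [PreconnectedSpace M] {e s : PartialEquiv E3 M} {r : ℝ},
      IsBallEmbedding e 2 → IsBallEmbedding s r → 0 < r →
      ∃ n₀ : ℕ, ∀ n ≥ n₀, ∃ h : M ≃ₘ^∞⟮𝓡 3, 𝓡 3⟯ M,
        (∀ x, ‖x‖ < 1 → h (e x) = s (μ ^ n • x)) ∨
        (∀ x, ‖x‖ < 1 → h (e x) = s (reflectLast (μ ^ n • x))) := by
  obtain ⟨μ, hμ0, hμ1, K, hK, hKμ⟩ := exists_supported_contraction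
  refine ⟨μ, hμ0, hμ1, ?_⟩
  intro M _ _ _ _ _ e s r he hs hr
  obtain ⟨h₁, hh₁⟩ := exists_diffeomorph_map_eq (e 0) (s 0)
  -- The comparison of the two embeddings near the origin.
  let g : E3 → E3 := fun x => s.symm (h₁ (e x))
  let g' : E3 → E3 := fun x => e.symm (h₁.symm (s x))
  have hs0 : s 0 ∈ s.target := hs.map_mem (by simpa using hr)
  have he0 : e 0 ∈ e.target := he.map_mem (by simp)
  let U : Set E3 := ball 0 2 ∩ (fun x => h₁ (e x)) ⁻¹' s.target
  have hUo : IsOpen U :=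
    (h₁.continuous.comp_continuousOn he.continuousOn).isOpen_inter_preimage isOpen_ball
      hs.isOpen_target
  have hU0 : (0 : E3) ∈ U := ⟨by simp, by rw [mem_preimage, hh₁]; exact hs0⟩
  let U' : Set E3 := ball 0 r ∩ (fun x => h₁.symm (s x)) ⁻¹' e.target
  have hUo' : IsOpen U' :=
    (h₁.symm.continuous.comp_continuousOn hs.continuousOn).isOpen_inter_preimage isOpen_ball
      he.isOpen_target
  have hU0' : (0 : E3) ∈ U' :=
    ⟨by simpa using hr, by rw [mem_preimage, ← hh₁, h₁.symm_apply_apply]; exact he0⟩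
  have hg : ContDiffOn ℝ ∞ g U := by
    rw [← contMDiffOn_iff_contDiffOn]
    refine hs.isDiffeo.contMDiffOn_symm.comp (t := s.target) ?_ (fun x hx => hx.2)
    exact (h₁.contMDiff.comp_contMDiffOn he.isDiffeo.contMDiffOn).mono inter_subset_left
  have hg' : ContDiffOn ℝ ∞ g' U' := by
    rw [← contMDiffOn_iff_contDiffOn]
    refine he.isDiffeo.contMDiffOn_symm.comp (t := e.target) ?_ (fun x hx => hx.2)
    exact (h₁.symm.contMDiff.comp_contMDiffOn hs.isDiffeo.contMDiffOn).mono inter_subset_left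
  have g0 : g 0 = 0 := by
    simp only [g]; rw [hh₁, hs.left_inv (by simpa using hr)]
  obtain ⟨L, hL⟩ : ∃ L : E3 ≃L[ℝ] E3, HasFDerivAt g (L : E3 →L[ℝ] E3) 0 := by
    refine exists_hasFDerivAt_equiv (g' := g')
      ((hg.contDiffAt (hUo.mem_nhds hU0)).differentiableAt (by simp))
      (by rw [g0]; exact (hg'.contDiffAt (hUo'.mem_nhds hU0')).differentiableAt (by simp)) ?_ ?_
    · filter_upwards [hUo.mem_nhds hU0] with x hx
      simp only [g, g']
      rw [s.right_inv hx.2, h₁.symm_apply_apply, he.left_inv (by simpa using hx.1)]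
    · rw [g0]
      filter_upwards [hUo'.mem_nhds hU0'] with x hx
      simp only [g, g']
      rw [e.right_inv hx.2, h₁.apply_symm_apply, hs.left_inv (by simpa using hx.1)]
  obtain ⟨Φ₁, hΦ₁, hΦ₁g⟩ := exists_supported_linearization (hUo.mem_nhds hU0) hg g0 hL hr
  -- A diffeomorphism that standardizes the germ of `h₁ ∘ e` up to `T`, the identity or the
  -- reflection.
  obtain ⟨T, hT, hTn, h₂, hh₂⟩ : ∃ T : E3 → E3, (T = id ∨ T = reflectLast) ∧
      (∀ x, ‖T x‖ = ‖x‖) ∧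
      ∃ h : M ≃ₘ^∞⟮𝓡 3, 𝓡 3⟯ M, ∀ᶠ x in 𝓝 (0 : E3), h (h₁ (e x)) = s (T x) := by
    obtain ⟨T, hT, hTn, hTc, A, hA, hLA⟩ : ∃ T : E3 → E3, (T = id ∨ T = reflectLast) ∧
        (∀ x, ‖T x‖ = ‖x‖) ∧ Continuous T ∧
        ∃ A : E3 →L[ℝ] E3, IsRealizable A ∧ ∀ x, L x = A (T x) := by
      rcases isRealizableUpToReflection_of_equiv L with h | ⟨B, hB, hLB⟩
      · exact ⟨id, Or.inl rfl, fun _ => rfl, continuous_id, L, h, fun x => rfl⟩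
      · exact ⟨reflectLast, Or.inr rfl, reflectLast.norm_map, reflectLast.continuous, B, hB,
          fun x => congrArg (· x) hLB⟩
    obtain ⟨Φ₂, hΦ₂, hΦ₂A⟩ := hA r hr
    obtain ⟨k, hk⟩ := exists_diffeomorph_extension hs (hΦ₂.trans hΦ₁)
    refine ⟨T, hT, hTn, k.symm, ?_⟩
    have hT0 : Filter.Tendsto T (𝓝 0) (𝓝 0) := by
      have := hTc.tendsto 0
      rwa [norm_eq_zero.1 ((hTn 0).trans norm_zero)] at this
    filter_upwards [hΦ₁g, hT0.eventually hΦ₂A, hUo.mem_nhds hU0, ball_mem_nhds (0 : E3) hr]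
      with x h1 h2 hx hxr
    have h3 := hk (T x) (by rw [hTn]; simpa using hxr)
    rw [Diffeomorph.coe_trans, Function.comp_apply, h2, ← hLA, h1] at h3
    have h4 : s (g x) = h₁ (e x) := s.right_inv hx.2
    rw [← h4, ← h3, k.symm_apply_apply]
  obtain ⟨ε, hε, hεx⟩ := Metric.eventually_nhds_iff_ball.1 hh₂
  obtain ⟨k, hk⟩ := exists_diffeomorph_extension he hK
  have hkn : ∀ n : ℕ, ∃ kn : M ≃ₘ^∞⟮𝓡 3, 𝓡 3⟯ M, ∀ x, ‖x‖ < 1 → kn (e x) = e (μ ^ n • x) := by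
    intro n
    induction n with
    | zero => exact ⟨Diffeomorph.refl _ _ _, fun x _ => by simp⟩
    | succ n ih =>
      obtain ⟨kn, hkn⟩ := ih
      refine ⟨kn.trans k, fun x hx => ?_⟩
      have hle : ‖μ ^ n • x‖ ≤ 1 := by
        rw [norm_smul, norm_pow, Real.norm_of_nonneg hμ0.le]
        exact mul_le_one₀ (pow_le_one₀ hμ0.le hμ1.le) (norm_nonneg _) hx.le
      rw [Diffeomorph.coe_trans, Function.comp_apply, hkn x hx, hk _ (by linarith), hKμ _ hle,
        smul_smul, pow_succ']
  obtain ⟨n₀, hn₀⟩ := exists_pow_lt_of_lt_one hε hμ1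
  refine ⟨n₀, fun n hn => ?_⟩
  obtain ⟨kn, hkn⟩ := hkn n
  have key : ∀ x, ‖x‖ < 1 → ((kn.trans h₁).trans h₂) (e x) = s (T (μ ^ n • x)) := by
    intro x hx
    rw [Diffeomorph.coe_trans, Function.comp_apply, Diffeomorph.coe_trans, Function.comp_apply,
      hkn x hx]
    refine hεx _ ?_
    rw [mem_ball_zero_iff, norm_smul, norm_pow, Real.norm_of_nonneg hμ0.le]
    have : μ ^ n ≤ μ ^ n₀ := pow_le_pow_of_le_one hμ0.le hμ1.le hn
    nlinarith [norm_nonneg x, pow_pos hμ0 n]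
  refine ⟨(kn.trans h₁).trans h₂, ?_⟩
  rcases hT with rfl | rfl
  · exact Or.inl key
  · exact Or.inr key

end

/-! ### Local models of maps to the plane -/

section
variable {M M' : Type*} [TopologicalSpace M] [ChartedSpace E3 M]
  [TopologicalSpace M'] [ChartedSpace E3 M']

/-- Over the open set `U` of the plane, the map `f` is the projection of the hypersurface
`{(w, ζ) : ‖ζ‖² = ρ w}`: the fibre coordinate is `z`, and `Ψ` is the inverse of `(f, z)`. Over
`{ρ > 0}` this is a trivial circle bundle, and over the regular curve `{ρ = 0}` the circles shrink
to points. -/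
structure IsCircleModel (f : M → ℂ) (U : Set ℂ) (ρ : ℂ → ℝ) (z : M → ℂ) (Ψ : ℂ × ℂ → M) :
    Prop where
  isOpen : IsOpen U
  contDiffOn : ContDiffOn ℝ ∞ ρ U
  regular : ∀ w ∈ U, ρ w = 0 → fderiv ℝ ρ w ≠ 0
  contMDiffOn : ContMDiffOn (𝓡 3) 𝓘(ℝ, ℂ) ∞ z (f ⁻¹' U)
  contMDiffOn_inv :
    ContMDiffOn 𝓘(ℝ, ℂ × ℂ) (𝓡 3) ∞ Ψ {x : ℂ × ℂ | x.1 ∈ U ∧ ‖x.2‖ ^ 2 = ρ x.1}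
  norm_sq : ∀ x, f x ∈ U → ‖z x‖ ^ 2 = ρ (f x)
  left_inv : ∀ x, f x ∈ U → Ψ (f x, z x) = x
  apply_inv : ∀ w ∈ U, ∀ ζ : ℂ, ‖ζ‖ ^ 2 = ρ w → f (Ψ (w, ζ)) = w
  coord_inv : ∀ w ∈ U, ∀ ζ : ℂ, ‖ζ‖ ^ 2 = ρ w → z (Ψ (w, ζ)) = ζ

/-- Over arbitrarily small closed neighbourhoods of `P`, the map `f` is diffeomorphic to the
Seifert model of some coprime `p ≠ 0` and `q`. -/
def IsSeifertAt (f : M → ℂ) (P : ℂ) : Prop :=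
  ∀ V ∈ 𝓝 P, ∃ U ⊆ V, U ∈ 𝓝 P ∧ IsClosed U ∧ ∃ p q : ℕ, p ≠ 0 ∧ p.Coprime q ∧
    ∃ (Φ : PartialEquiv M (Circle × ℂ)) (φ : PartialEquiv ℂ ℂ),
      IsDiffeoBetween (𝓡 3) ((𝓡 1).prod 𝓘(ℝ, ℂ)) Φ (f ⁻¹' U)
        {x : Circle × ℂ | x.2 ∈ closedBall (0 : ℂ) 1} ∧
      IsDiffeoBetween 𝓘(ℝ, ℂ) 𝓘(ℝ, ℂ) φ U (closedBall 0 1) ∧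
      ∀ x ∈ f ⁻¹' U, φ (f x) = seifertModel p q (Φ x)

/-- Near `P`, the map `f` has the local structure of a Werther fibration. -/
def IsWertherAt (f : M → ℂ) (P : ℂ) : Prop :=
  (∃ U ρ z Ψ, P ∈ U ∧ IsCircleModel f U ρ z Ψ) ∨ IsSeifertAt f P

/-- The map `f` restricted over `V` is carried by `j` to the restriction of `f'` over the image of
`V` under the diffeomorphism `T` of the plane. -/
structure IsFiberDiffeo (f : M → ℂ) (f' : M' → ℂ) (V : Set ℂ)
    (T : ℂ ≃ₘ^∞⟮𝓘(ℝ, ℂ), 𝓘(ℝ, ℂ)⟯ ℂ) (j : PartialEquiv M M') : Prop where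
  isOpen : IsOpen V
  isDiffeo : IsDiffeoBetween (𝓡 3) (𝓡 3) j (f ⁻¹' V) (f' ⁻¹' (T '' V))
  comm : ∀ x, f x ∈ V → f' (j x) = T (f x)

namespace IsCircleModel
variable {f : M → ℂ} {U : Set ℂ} {ρ : ℂ → ℝ} {z : M → ℂ} {Ψ : ℂ × ℂ → M}

theorem mono (h : IsCircleModel f U ρ z Ψ) {V : Set ℂ} (hV : IsOpen V) (hVU : V ⊆ U) :
    IsCircleModel f V ρ z Ψ where
  isOpen := hV
  contDiffOn := h.contDiffOn.mono hVU
  regular w hw := h.regular w (hVU hw)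
  contMDiffOn := h.contMDiffOn.mono fun _ hx => hVU hx
  contMDiffOn_inv := h.contMDiffOn_inv.mono fun _ hx => ⟨hVU hx.1, hx.2⟩
  norm_sq x hx := h.norm_sq x (hVU hx)
  left_inv x hx := h.left_inv x (hVU hx)
  apply_inv w hw := h.apply_inv w (hVU hw)
  coord_inv w hw := h.coord_inv w (hVU hw)

theorem congr (h : IsCircleModel f U ρ z Ψ) {ρ' : ℂ → ℝ} (he : EqOn ρ' ρ U) :
    IsCircleModel f U ρ' z Ψ where
  isOpen := h.isOpen
  contDiffOn := h.contDiffOn.congr he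
  regular w hw h0 := by
    have : ρ' =ᶠ[𝓝 w] ρ := by
      filter_upwards [h.isOpen.mem_nhds hw] with y hy using he hy
    rw [this.fderiv_eq]
    exact h.regular w hw (by rw [← he hw, h0])
  contMDiffOn := h.contMDiffOn
  contMDiffOn_inv := h.contMDiffOn_inv.mono fun x hx => ⟨hx.1, by rw [← he hx.1]; exact hx.2⟩
  norm_sq x hx := by rw [he hx]; exact h.norm_sq x hx
  left_inv := h.left_inv
  apply_inv w hw ζ hζ := h.apply_inv w hw ζ (by rw [← he hw, hζ])
  coord_inv w hw ζ hζ := h.coord_inv w hw ζ (by rw [← he hw, hζ])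

/-- The image of `f` over `U` is `{ρ ≥ 0}`. -/
theorem mem_range_iff (h : IsCircleModel f U ρ z Ψ) {w : ℂ} (hw : w ∈ U) :
    w ∈ range f ↔ 0 ≤ ρ w := by
  constructor
  · rintro ⟨x, rfl⟩
    rw [← h.norm_sq x hw]
    positivity
  · intro h0
    refine ⟨Ψ (w, (√(ρ w) : ℝ)), h.apply_inv w hw _ ?_⟩
    rw [Complex.norm_real, Real.norm_of_nonneg (Real.sqrt_nonneg _), Real.sq_sqrt h0]

/-- Multiplying the defining function `ρ` by a positive function rescales the fibre coordinate. -/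
theorem rescale (h : IsCircleModel f U ρ z Ψ) (hf : ContMDiff (𝓡 3) 𝓘(ℝ, ℂ) ∞ f) {κ : ℂ → ℝ}
    (hκ : ContDiffOn ℝ ∞ κ U) (hpos : ∀ w ∈ U, 0 < κ w) :
    IsCircleModel f U (fun w => κ w * ρ w) (fun x => (√(κ (f x)) : ℝ) * z x)
      (fun x => Ψ (x.1, ((√(κ x.1) : ℝ) : ℂ)⁻¹ * x.2)) := by
  have hs : ContDiffOn ℝ ∞ (fun w => ((√(κ w) : ℝ) : ℂ)) U :=
    Complex.ofRealCLM.contDiff.comp_contDiffOn (hκ.sqrt fun w hw => (hpos w hw).ne')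
  have hs0 : ∀ w ∈ U, ((√(κ w) : ℝ) : ℂ) ≠ 0 := fun w hw => by
    exact_mod_cast (Real.sqrt_pos.2 (hpos w hw)).ne'
  have hnorm : ∀ w ∈ U, ∀ ζ : ℂ, ‖((√(κ w) : ℝ) : ℂ) * ζ‖ ^ 2 = κ w * ‖ζ‖ ^ 2 := by
    intro w hw ζ
    rw [norm_mul, Complex.norm_real, Real.norm_of_nonneg (Real.sqrt_nonneg _), mul_pow,
      Real.sq_sqrt (hpos w hw).le]
  have hinv : ∀ w ∈ U, ∀ ζ : ℂ, ‖ζ‖ ^ 2 = κ w * ρ w →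
      ‖((√(κ w) : ℝ) : ℂ)⁻¹ * ζ‖ ^ 2 = ρ w := by
    intro w hw ζ hζ
    have h1 := hnorm w hw (((√(κ w) : ℝ) : ℂ)⁻¹ * ζ)
    rw [mul_inv_cancel_left₀ (hs0 w hw), hζ] at h1
    exact (mul_left_cancel₀ (hpos w hw).ne' h1).symm
  refine ⟨h.isOpen, hκ.mul h.contDiffOn, ?_, ?_, ?_, ?_, ?_, ?_, ?_⟩
  · intro w hw h0
    have hρ0 : ρ w = 0 := (mul_eq_zero.1 h0).resolve_left (hpos w hw).ne'
    have hd1 : DifferentiableAt ℝ κ w :=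
      (hκ.contDiffAt (h.isOpen.mem_nhds hw)).differentiableAt (by simp)
    have hd2 : DifferentiableAt ℝ ρ w :=
      (h.contDiffOn.contDiffAt (h.isOpen.mem_nhds hw)).differentiableAt (by simp)
    rw [fderiv_fun_mul hd1 hd2, hρ0, zero_smul, add_zero]
    exact smul_ne_zero (hpos w hw).ne' (h.regular w hw hρ0)
  · have h1 : ContMDiffOn (𝓡 3) 𝓘(ℝ, ℂ) ∞ (fun x => ((√(κ (f x)) : ℝ) : ℂ)) (f ⁻¹' U) :=
      hs.contMDiffOn.comp hf.contMDiffOn fun x hx => hx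
    have h2 : ContMDiff 𝓘(ℝ, ℂ × ℂ) 𝓘(ℝ, ℂ) ∞ fun x : ℂ × ℂ => x.1 * x.2 :=
      (contDiff_fst.mul contDiff_snd).contMDiff
    exact h2.comp_contMDiffOn (h1.prodMk_space h.contMDiffOn)
  · refine h.contMDiffOn_inv.comp ?_ fun x hx => ⟨hx.1, hinv _ hx.1 _ hx.2⟩
    refine ContDiffOn.contMDiffOn ?_
    refine contDiff_fst.contDiffOn.prodMk (ContDiffOn.mul ?_ contDiff_snd.contDiffOn)
    exact (hs.comp contDiff_fst.contDiffOn fun x hx => hx.1).inv fun x hx => hs0 _ hx.1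
  · intro x hx
    rw [hnorm _ hx, h.norm_sq x hx]
  · intro x hx
    simp only
    rw [inv_mul_cancel_left₀ (hs0 _ hx), h.left_inv x hx]
  · intro w hw ζ hζ
    exact h.apply_inv w hw _ (hinv w hw ζ hζ)
  · intro w hw ζ hζ
    simp only
    rw [h.apply_inv w hw _ (hinv w hw ζ hζ), h.coord_inv w hw _ (hinv w hw ζ hζ),
      mul_inv_cancel_left₀ (hs0 w hw)]

theorem transport {f' : M' → ℂ} {V : Set ℂ} {T : ℂ ≃ₘ^∞⟮𝓘(ℝ, ℂ), 𝓘(ℝ, ℂ)⟯ ℂ}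
    {j : PartialEquiv M M'} (h : IsCircleModel f U ρ z Ψ) (hj : IsFiberDiffeo f f' V T j)
    (hUV : U ⊆ V) :
    IsCircleModel f' (T '' U) (fun w => ρ (T.symm w)) (fun y => z (j.symm y))
      (fun x => j (Ψ (T.symm x.1, x.2))) := by
  have hTs : ContDiff ℝ ∞ T.symm := T.symm.contMDiff.contDiff
  have hT : ContDiff ℝ ∞ T := T.contMDiff.contDiff
  have hmem : ∀ {w : ℂ}, w ∈ T '' U ↔ T.symm w ∈ U := by
    intro w
    constructor
    · rintro ⟨v, hv, rfl⟩; rwa [T.symm_apply_apply]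
    · intro hw; exact ⟨_, hw, T.apply_symm_apply w⟩
  have hy : ∀ y, f' y ∈ T '' U → j.symm y ∈ j.source ∧ f (j.symm y) = T.symm (f' y) ∧
      j (j.symm y) = y := by
    intro y hy
    have hyt : y ∈ j.target := by
      rw [hj.isDiffeo.target_eq]; exact image_mono hUV hy
    have hys := j.map_target hyt
    have hys' := hys
    rw [hj.isDiffeo.source_eq] at hys'
    refine ⟨hys, ?_, j.right_inv hyt⟩
    have := hj.comm _ hys'
    rw [j.right_inv hyt] at this
    rw [this, T.symm_apply_apply]
  have hsrc : ∀ x, f x ∈ V → x ∈ j.source := fun x hx => by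
    rw [hj.isDiffeo.source_eq]; exact hx
  have hΨ : ∀ w ∈ T '' U, ∀ ζ : ℂ, ‖ζ‖ ^ 2 = ρ (T.symm w) →
      f (Ψ (T.symm w, ζ)) = T.symm w :=
    fun w hw ζ hζ => h.apply_inv _ (hmem.1 hw) ζ hζ
  refine ⟨T.toHomeomorph.isOpenMap _ h.isOpen, ?_, ?_, ?_, ?_, ?_, ?_, ?_, ?_⟩
  · exact h.contDiffOn.comp hTs.contDiffOn fun w hw => hmem.1 hw
  · intro w hw h0 hd
    have hUw := hmem.1 hw
    apply h.regular _ hUw h0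
    have hcomp : ρ =ᶠ[𝓝 (T.symm w)] fun v => (fun w => ρ (T.symm w)) (T v) :=
      Filter.Eventually.of_forall fun v => by simp only [T.symm_apply_apply]
    have hd1 : DifferentiableAt ℝ (fun w => ρ (T.symm w)) w :=
      ((h.contDiffOn.contDiffAt (h.isOpen.mem_nhds hUw)).differentiableAt (by simp)).comp w
        (hTs.differentiable (by simp) w)
    have hd2 : DifferentiableAt ℝ T (T.symm w) := hT.differentiable (by simp) _
    have hd1' : HasFDerivAt (fun w => ρ (T.symm w)) (0 : ℂ →L[ℝ] ℝ) (T (T.symm w)) := by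
      rw [T.apply_symm_apply, ← hd]; exact hd1.hasFDerivAt
    have := (hd1'.comp (T.symm w) hd2.hasFDerivAt).congr_of_eventuallyEq hcomp
    rw [this.fderiv]
    exact ContinuousLinearMap.zero_comp _
  · refine h.contMDiffOn.comp (hj.isDiffeo.contMDiffOn_symm.mono ?_) ?_
    · exact preimage_mono (image_mono hUV)
    · intro y hyU
      change f (j.symm y) ∈ U
      rw [(hy y hyU).2.1]
      exact hmem.1 hyU
  · refine hj.isDiffeo.contMDiffOn.comp (t := f ⁻¹' V) (h.contMDiffOn_inv.comp
      (t := {x : ℂ × ℂ | x.1 ∈ U ∧ ‖x.2‖ ^ 2 = ρ x.1}) ?_ ?_) ?_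
    · exact ((hTs.comp contDiff_fst).prodMk contDiff_snd).contMDiff.contMDiffOn
    · exact fun x hx => ⟨hmem.1 hx.1, hx.2⟩
    · intro x hx
      change f (Ψ (T.symm x.1, x.2)) ∈ V
      rw [hΨ _ hx.1 _ hx.2]
      exact hUV (hmem.1 hx.1)
  · intro y hyU
    obtain ⟨-, h2, -⟩ := hy y hyU
    rw [h.norm_sq _ (by rw [h2]; exact hmem.1 hyU), h2]
  · intro y hyU
    obtain ⟨-, h2, h3⟩ := hy y hyU
    simp only
    rw [← h2, h.left_inv _ (by rw [h2]; exact hmem.1 hyU), h3]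
  · intro w hw ζ hζ
    have := hΨ w hw ζ hζ
    rw [hj.comm _ (by rw [this]; exact hUV (hmem.1 hw)), this, T.apply_symm_apply]
  · intro w hw ζ hζ
    have := hΨ w hw ζ hζ
    simp only
    rw [j.left_inv (hsrc _ (by rw [this]; exact hUV (hmem.1 hw)))]
    exact h.coord_inv _ (hmem.1 hw) ζ hζ

end IsCircleModel

theorem IsSeifertAt.transport {f : M → ℂ} {f' : M' → ℂ} {V : Set ℂ}
    {T : ℂ ≃ₘ^∞⟮𝓘(ℝ, ℂ), 𝓘(ℝ, ℂ)⟯ ℂ} {j : PartialEquiv M M'} {P : ℂ} (h : IsSeifertAt f P)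
    (hj : IsFiberDiffeo f f' V T j) (hP : P ∈ V) : IsSeifertAt f' (T P) := by
  intro W hW
  have hW' : T ⁻¹' W ∩ V ∈ 𝓝 P :=
    Filter.inter_mem (T.continuous.continuousAt hW) (hj.isOpen.mem_nhds hP)
  obtain ⟨U, hUW, hUP, hUc, p, q, hp, hpq, Φ, φ, hΦ, hφ, hcomm⟩ := h _ hW'
  have hUV : U ⊆ V := fun w hw => (hUW hw).2
  have hmem : ∀ {w : ℂ}, w ∈ T '' U ↔ T.symm w ∈ U := by
    intro w
    constructor
    · rintro ⟨v, hv, rfl⟩; rwa [T.symm_apply_apply]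
    · intro hw; exact ⟨_, hw, T.apply_symm_apply w⟩
  have hsub : f' ⁻¹' (T '' U) ⊆ f' ⁻¹' (T '' V) := preimage_mono (image_mono hUV)
  have hy : ∀ y, f' y ∈ T '' V → f (j.symm y) = T.symm (f' y) := by
    intro y hy
    have hyt : y ∈ j.target := by rw [hj.isDiffeo.target_eq]; exact hy
    have hys := j.map_target hyt
    rw [hj.isDiffeo.source_eq] at hys
    have := hj.comm _ hys
    rw [j.right_inv hyt] at this
    rw [this, T.symm_apply_apply]
  have hms : MapsTo j.symm (f' ⁻¹' (T '' U)) (f ⁻¹' U) := by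
    intro y hyU
    rw [mem_preimage, hy y (hsub hyU)]
    exact hmem.1 hyU
  refine ⟨T '' U, ?_, ?_, T.toHomeomorph.isClosedMap _ hUc, p, q, hp, hpq, j.symm.trans Φ,
    T.symm.toEquiv.toPartialEquiv.trans φ, ⟨?_, ?_, ?_, ?_⟩, ⟨?_, ?_, ?_, ?_⟩, ?_⟩
  · rintro _ ⟨w, hw, rfl⟩; exact (hUW hw).1
  · exact T.toHomeomorph.isOpenMap.image_mem_nhds hUP
  · ext y
    rw [PartialEquiv.trans_source, PartialEquiv.symm_source, hj.isDiffeo.target_eq,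
      hΦ.source_eq]
    constructor
    · rintro ⟨h1, h2⟩
      rw [mem_preimage, mem_preimage, hy y h1] at h2
      exact hmem.2 h2
    · exact fun h1 => ⟨hsub h1, hms h1⟩
  · rw [PartialEquiv.trans_target, PartialEquiv.symm_target, hj.isDiffeo.source_eq, hΦ.target_eq]
    refine inter_eq_left.2 fun x hx => ?_
    have := Φ.map_target (hΦ.target_eq ▸ hx)
    rw [hΦ.source_eq] at this
    exact hUV this
  · exact hΦ.contMDiffOn.comp (hj.isDiffeo.contMDiffOn_symm.mono hsub) hms
  · refine hj.isDiffeo.contMDiffOn.comp (t := f ⁻¹' V) hΦ.contMDiffOn_symm ?_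
    intro x hx
    have := Φ.map_target (hΦ.target_eq ▸ hx)
    rw [hΦ.source_eq] at this
    exact hUV this
  · ext w
    rw [PartialEquiv.trans_source, hφ.source_eq, hmem]
    exact ⟨fun h => h.2, fun h => ⟨mem_univ _, h⟩⟩
  · rw [PartialEquiv.trans_target, hφ.target_eq]
    exact inter_eq_left.2 fun _ _ => mem_univ _
  · exact hφ.contMDiffOn.comp T.symm.contMDiff.contMDiffOn fun w hw => hmem.1 hw
  · exact T.contMDiff.comp_contMDiffOn hφ.contMDiffOn_symm
  · intro y hyU
    change φ (T.symm (f' y)) = seifertModel p q (Φ (j.symm y))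
    rw [← hy y (hsub hyU)]
    exact hcomm _ (hms hyU)

theorem IsWertherAt.transport {f : M → ℂ} {f' : M' → ℂ} {V : Set ℂ}
    {T : ℂ ≃ₘ^∞⟮𝓘(ℝ, ℂ), 𝓘(ℝ, ℂ)⟯ ℂ} {j : PartialEquiv M M'} {P : ℂ} (h : IsWertherAt f P)
    (hj : IsFiberDiffeo f f' V T j) (hP : P ∈ V) : IsWertherAt f' (T P) := by
  rcases h with ⟨U, ρ, z, Ψ, hPU, h⟩ | h
  · exact Or.inl ⟨_, _, _, _, mem_image_of_mem T (show P ∈ U ∩ V from ⟨hPU, hP⟩),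
      (h.mono (h.isOpen.inter hj.isOpen) inter_subset_left).transport hj inter_subset_right⟩
  · exact Or.inr (h.transport hj hP)

/-- The reflection `w ↦ -w̄` of the plane in the imaginary axis. -/
noncomputable def planeReflection : ℂ ≃ₘ^∞⟮𝓘(ℝ, ℂ), 𝓘(ℝ, ℂ)⟯ ℂ :=
  (Complex.conjCLE.trans (ContinuousLinearEquiv.neg ℝ)).toDiffeomorph

theorem planeReflection_apply (w : ℂ) : planeReflection w = -(starRingEnd ℂ) w := rfl

theorem planeReflection_re (w : ℂ) : (planeReflection w).re = -w.re := by
  simp [planeReflection_apply]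

theorem planeReflection_im (w : ℂ) : (planeReflection w).im = w.im := by
  simp [planeReflection_apply]

theorem planeReflection_planeReflection (w : ℂ) : planeReflection (planeReflection w) = w := by
  simp [planeReflection_apply]

/-- The translation of the plane by a real number. -/
noncomputable def planeTranslation (τ : ℝ) : ℂ ≃ₘ^∞⟮𝓘(ℝ, ℂ), 𝓘(ℝ, ℂ)⟯ ℂ where
  toEquiv := Equiv.addRight (τ : ℂ)
  contMDiff_toFun := (contDiff_id.add contDiff_const).contMDiff
  contMDiff_invFun := (contDiff_id.add contDiff_const).contMDiff

theorem planeTranslation_apply (τ : ℝ) (w : ℂ) : planeTranslation τ w = w + τ := rfl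

theorem planeTranslation_symm_apply (τ : ℝ) (w : ℂ) : (planeTranslation τ).symm w = w - τ := by
  rw [sub_eq_add_neg]; rfl

/-- The map `f` attains the maximum of its real part over the point `c + 1` only, and there it is
the projection `(w, ζ) ↦ w` of the sphere `‖w - c‖² + ‖ζ‖² = 1`. -/
def HasRightCap (f : M → ℂ) (c : ℝ) : Prop :=
  (∃ U z Ψ, (c + 1 : ℂ) ∈ U ∧ IsCircleModel f U (fun w => 1 - ‖w - c‖ ^ 2) z Ψ) ∧
    ∀ x, (f x).re ≤ c + 1 ∧ ((f x).re = c + 1 → f x = c + 1)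

/-- The map `f` attains the minimum of its real part over one point only, where it looks like the
projection of a sphere. -/
def HasLeftCap (f : M → ℂ) (c : ℝ) : Prop := HasRightCap (fun x => planeReflection (f x)) c

/-- A smooth map from a `3`-manifold to the plane that is a Werther fibration over its image, and
that looks like the projection of the `3`-sphere to the disc over the leftmost and the rightmost
point of its image. -/
structure IsCappedWertherMap (f : M → ℂ) : Prop where
  contMDiff : ContMDiff (𝓡 3) 𝓘(ℝ, ℂ) ∞ f
  isWertherAt : ∀ x, IsWertherAt f (f x)
  rightCap : ∃ c, HasRightCap f c
  leftCap : ∃ c, HasLeftCap f c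

theorem isDiffeoBetween_ofSet (A : Set M) :
    IsDiffeoBetween (𝓡 3) (𝓡 3) (PartialEquiv.ofSet A) A A :=
  ⟨rfl, rfl, contMDiffOn_id, contMDiffOn_id⟩

theorem isFiberDiffeo_comp (f : M → ℂ) (T : ℂ ≃ₘ^∞⟮𝓘(ℝ, ℂ), 𝓘(ℝ, ℂ)⟯ ℂ)
    (h : M' ≃ₘ^∞⟮𝓡 3, 𝓡 3⟯ M) :
    IsFiberDiffeo f (fun x => T (f (h x))) univ T h.symm.toEquiv.toPartialEquiv := by
  refine ⟨isOpen_univ, ⟨by simp, ?_, h.symm.contMDiff.contMDiffOn, h.contMDiff.contMDiffOn⟩, ?_⟩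
  · rw [image_univ, Equiv.toPartialEquiv_target]
    have : range T = univ := T.surjective.range_eq
    rw [this, preimage_univ]
  · intro x _
    change T (f (h (h.symm x))) = T (f x)
    rw [h.apply_symm_apply]

theorem HasRightCap.comp_diffeomorph {f : M → ℂ} {c : ℝ} (hf : HasRightCap f c) (τ : ℝ)
    (h : M' ≃ₘ^∞⟮𝓡 3, 𝓡 3⟯ M) : HasRightCap (fun x => f (h x) + τ) (c + τ) := by
  obtain ⟨⟨U, z, Ψ, hU, hm⟩, hmax⟩ := hf
  refine ⟨⟨_, _, _, ?_, (hm.transport (isFiberDiffeo_comp f (planeTranslation τ) h)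
    (subset_univ _)).congr ?_⟩, fun x => ⟨?_, fun hx => ?_⟩⟩
  · refine ⟨_, hU, ?_⟩
    rw [planeTranslation_apply]
    push_cast
    ring
  · intro w _
    simp only [planeTranslation_symm_apply]
    congr 3
    push_cast
    ring
  · have := (hmax (h x)).1
    simp only [Complex.add_re, Complex.ofReal_re]
    linarith
  · simp only [Complex.add_re, Complex.ofReal_re] at hx
    change f (h x) + τ = _
    rw [(hmax (h x)).2 (by linarith)]
    push_cast
    ring

theorem IsCappedWertherMap.comp_diffeomorph {f : M → ℂ} (hf : IsCappedWertherMap f) (τ : ℝ)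
    (h : M' ≃ₘ^∞⟮𝓡 3, 𝓡 3⟯ M) : IsCappedWertherMap (fun x => f (h x) + τ) where
  contMDiff := (planeTranslation τ).contMDiff.comp (hf.contMDiff.comp h.contMDiff)
  isWertherAt x := (hf.isWertherAt (h x)).transport (isFiberDiffeo_comp f (planeTranslation τ) h)
    (mem_univ _)
  rightCap := by
    obtain ⟨c, hc⟩ := hf.rightCap
    exact ⟨_, hc.comp_diffeomorph τ h⟩
  leftCap := by
    obtain ⟨c, hc⟩ := hf.leftCap
    have h1 := HasRightCap.comp_diffeomorph hc (-τ) h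
    refine ⟨c + -τ, ?_⟩
    have e : (fun x => planeReflection (f (h x) + τ)) =
        fun x => planeReflection (f (h x)) + ((-τ : ℝ) : ℂ) := by
      ext x
      simp only [planeReflection_apply, map_add, Complex.conj_ofReal]
      push_cast
      ring
    rw [HasLeftCap, e]
    exact h1

theorem IsCappedWertherMap.reflect {f : M → ℂ} (hf : IsCappedWertherMap f) :
    IsCappedWertherMap (fun x => planeReflection (f x)) where
  contMDiff := planeReflection.contMDiff.comp hf.contMDiff
  isWertherAt x := (hf.isWertherAt x).transport
    (isFiberDiffeo_comp f planeReflection (Diffeomorph.refl _ _ _)) (mem_univ _)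
  rightCap := hf.leftCap
  leftCap := by
    obtain ⟨c, hc⟩ := hf.rightCap
    refine ⟨c, ?_⟩
    simpa only [HasLeftCap, planeReflection_planeReflection] using hc

end

/-! ### Caps as embedded balls -/

theorem E3.norm_sq (x : E3) : ‖x‖ ^ 2 = x 0 ^ 2 + x 1 ^ 2 + x 2 ^ 2 := by
  rw [EuclideanSpace.real_norm_sq_eq, Fin.sum_univ_three]

theorem Complex.norm_sq_eq_re_add_im (w : ℂ) : ‖w‖ ^ 2 = w.re ^ 2 + w.im ^ 2 := by
  rw [Complex.sq_norm, Complex.normSq_apply]; ring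

theorem contDiff_complexMk {E : Type*} [NormedAddCommGroup E] [NormedSpace ℝ E] {s : Set E}
    {f g : E → ℝ} (hf : ContDiffOn ℝ ∞ f s) (hg : ContDiffOn ℝ ∞ g s) :
    ContDiffOn ℝ ∞ (fun x => (⟨f x, g x⟩ : ℂ)) s := by
  have h : ContDiffOn ℝ ∞ (fun x => (f x : ℂ) + g x * Complex.I) s :=
    (Complex.ofRealCLM.contDiff.comp_contDiffOn hf).add
      ((Complex.ofRealCLM.contDiff.comp_contDiffOn hg).mul contDiffOn_const)
  refine h.congr fun x _ => ?_
  apply Complex.ext <;> simp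

theorem contDiff_E3_apply (i : Fin 3) : ContDiff ℝ ∞ fun x : E3 => x i :=
  contDiff_euclidean.1 contDiff_id i

section
variable {M : Type*} [TopologicalSpace M] [ChartedSpace E3 M]

/-- Around the rightmost fibre of a map with a right cap there is an embedded ball on which the map
is the projection of a hemisphere, written as a graph, and which contains all points with value
far enough to the right. -/
theorem HasRightCap.exists_ball [CompactSpace M] {f : M → ℂ} {c : ℝ}
    (hf : ContMDiff (𝓡 3) 𝓘(ℝ, ℂ) ∞ f) (h : HasRightCap f c) :
    ∃ (s : PartialEquiv E3 M) (r : ℝ), 0 < r ∧ IsBallEmbedding s r ∧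
      (∀ x, ‖x‖ < r → f (s x) = ⟨c + √(1 - ‖x‖ ^ 2), x 0⟩) ∧
      ∀ l, 0 < l → l < r → ∀ y, c + √(1 - l ^ 2) < (f y).re → ∃ x, ‖x‖ < l ∧ s x = y := by
  obtain ⟨⟨U, z, Ψ, hU, hm⟩, hmax⟩ := h
  -- Points with value far to the right lie over `U`, by compactness.
  obtain ⟨η, hη0, hη1, hη⟩ : ∃ η : ℝ, 0 ≤ η ∧ η < 1 ∧ ∀ y, c + η < (f y).re → f y ∈ U := by
    have hK : IsCompact (f ⁻¹' Uᶜ) :=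
      (hm.isOpen.isClosed_compl.preimage hf.continuous).isCompact
    by_cases hne : (f ⁻¹' Uᶜ).Nonempty
    · obtain ⟨y₀, hy₀, hmx⟩ := hK.exists_isMaxOn hne
        (Complex.continuous_re.comp hf.continuous).continuousOn
      have hlt : (f y₀).re < c + 1 := by
        refine lt_of_le_of_ne (hmax y₀).1 fun he => hy₀ ?_
        rw [(hmax y₀).2 he]; exact hU
      refine ⟨max 0 ((f y₀).re - c), le_max_left _ _, max_lt one_pos (by linarith), ?_⟩
      intro y hy
      by_contra hyU
      have h1 : (f y).re ≤ (f y₀).re := hmx (show y ∈ f ⁻¹' Uᶜ from hyU)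
      have h2 := le_max_right 0 ((f y₀).re - c)
      linarith
    · refine ⟨0, le_rfl, one_pos, fun y _ => ?_⟩
      by_contra hyU
      exact hne ⟨y, hyU⟩
  let w : E3 → ℂ := fun x => ⟨c + √(1 - ‖x‖ ^ 2), x 0⟩
  have hpos : ∀ x ∈ ball (0 : E3) 1, 0 < 1 - ‖x‖ ^ 2 := fun x hx => by
    have : ‖x‖ < 1 := by simpa using hx
    nlinarith [norm_nonneg x]
  have hw : ContDiffOn ℝ ∞ w (ball 0 1) := by
    refine contDiff_complexMk (contDiffOn_const.add ?_) (contDiff_E3_apply 0).contDiffOn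
    exact (contDiffOn_const.sub (contDiff_norm_sq ℝ).contDiffOn).sqrt
      fun x hx => (hpos x hx).ne'
  have hw0 : w 0 = c + 1 := by
    apply Complex.ext <;> simp [w]
  obtain ⟨r₁, hr₁, hwU⟩ : ∃ r₁ > 0, ∀ x ∈ ball (0 : E3) r₁, w x ∈ U := by
    have hc : ContinuousAt w 0 :=
      hw.continuousOn.continuousAt (isOpen_ball.mem_nhds (by simp))
    exact Metric.eventually_nhds_iff_ball.1
      (hc.eventually (hm.isOpen.mem_nhds (by rw [hw0]; exact hU)))
  have hη2 : 0 < √(1 - η ^ 2) := Real.sqrt_pos.2 (by nlinarith)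
  have hη3 : √(1 - η ^ 2) ≤ 1 := by
    exact Real.sqrt_le_one.2 (by nlinarith [sq_nonneg η])
  obtain ⟨r, hr0, hrr, hrη⟩ : ∃ r : ℝ, 0 < r ∧ r ≤ r₁ ∧ r ≤ √(1 - η ^ 2) :=
    ⟨min r₁ √(1 - η ^ 2), lt_min hr₁ hη2, min_le_left _ _, min_le_right _ _⟩
  have hr1 : r ≤ 1 := hrη.trans hη3
  let ζ : E3 → ℂ := fun x => ⟨x 1, x 2⟩
  have hsub1 : ball (0 : E3) r ⊆ ball 0 1 := ball_subset_ball hr1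
  have hH : ∀ x ∈ ball (0 : E3) r, w x ∈ U ∧ ‖ζ x‖ ^ 2 = 1 - ‖w x - c‖ ^ 2 := by
    intro x hx
    refine ⟨hwU x (ball_subset_ball hrr hx), ?_⟩
    rw [Complex.norm_sq_eq_re_add_im, Complex.norm_sq_eq_re_add_im]
    simp only [w, ζ, Complex.sub_re, Complex.sub_im, Complex.ofReal_re, Complex.ofReal_im,
      add_sub_cancel_left, sub_zero]
    rw [Real.sq_sqrt (hpos x (hsub1 hx)).le, E3.norm_sq]
    ring
  have hfs : ∀ x ∈ ball (0 : E3) r, f (Ψ (w x, ζ x)) = w x := fun x hx =>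
    hm.apply_inv _ (hH x hx).1 _ (hH x hx).2
  have hzs : ∀ x ∈ ball (0 : E3) r, z (Ψ (w x, ζ x)) = ζ x := fun x hx =>
    hm.coord_inv _ (hH x hx).1 _ (hH x hx).2
  let inv : ℂ × ℂ → E3 := fun p => !₂[p.1.im, p.2.re, p.2.im]
  have hinv : ContDiff ℝ ∞ inv := by
    rw [contDiff_euclidean]
    intro i
    fin_cases i
    · exact Complex.imCLM.contDiff.comp contDiff_fst
    · exact Complex.reCLM.contDiff.comp contDiff_snd
    · exact Complex.imCLM.contDiff.comp contDiff_snd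
  have hinvn : ∀ p : ℂ × ℂ, ‖inv p‖ ^ 2 = p.1.im ^ 2 + ‖p.2‖ ^ 2 := by
    intro p
    rw [E3.norm_sq, Complex.norm_sq_eq_re_add_im]
    simp [inv]
    ring
  let tgt : Set M := {y | f y ∈ U ∧ c < (f y).re ∧ (f y).im ^ 2 + ‖z y‖ ^ 2 < r ^ 2}
  have hright : ∀ y, f y ∈ U → c < (f y).re → w (inv (f y, z y)) = f y := by
    intro y hyU hyc
    have h1 := hm.norm_sq y hyU
    rw [Complex.norm_sq_eq_re_add_im (f y - c)] at h1
    simp only [Complex.sub_re, Complex.sub_im, Complex.ofReal_re, Complex.ofReal_im,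
      sub_zero] at h1
    have h2 : 1 - ‖inv (f y, z y)‖ ^ 2 = ((f y).re - c) ^ 2 := by
      rw [hinvn]; simp only; linarith
    apply Complex.ext
    · change c + √(1 - ‖inv (f y, z y)‖ ^ 2) = _
      rw [h2, Real.sqrt_sq (by linarith)]
      ring
    · rfl
  let s : PartialEquiv E3 M :=
    { toFun := fun x => Ψ (w x, ζ x)
      invFun := fun y => inv (f y, z y)
      source := ball 0 r
      target := tgt
      map_source' := fun x hx => by
        refine ⟨by rw [hfs x hx]; exact (hH x hx).1, ?_, ?_⟩
        · rw [hfs x hx]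
          change c < c + √(1 - ‖x‖ ^ 2)
          linarith [Real.sqrt_pos.2 (hpos x (hsub1 hx))]
        · rw [hfs x hx, hzs x hx, Complex.norm_sq_eq_re_add_im]
          have h1 : ‖x‖ < r := by simpa using hx
          have h2 : ‖x‖ ^ 2 < r ^ 2 := by gcongr
          rw [E3.norm_sq] at h2
          simp only [w, ζ]
          linarith
      map_target' := fun y hy => by
        have := hinvn (f y, z y)
        rw [mem_ball_zero_iff]
        refine lt_of_pow_lt_pow_left₀ 2 hr0.le ?_
        rw [this]
        exact hy.2.2
      left_inv' := fun x hx => by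
        rw [hfs x hx, hzs x hx]
        ext i
        fin_cases i <;> rfl
      right_inv' := fun y hy => by
        have h1 : ζ (inv (f y, z y)) = z y := rfl
        rw [hright y hy.1 hy.2.1, h1, hm.left_inv y hy.1] }
  refine ⟨s, r, hr0, ⟨⟨rfl, rfl, ?_, ?_⟩, ?_⟩, fun x hx => hfs x (by simpa using hx), ?_⟩
  · refine hm.contMDiffOn_inv.comp (ContDiffOn.contMDiffOn ?_) hH
    exact (hw.mono hsub1).prodMk (contDiff_complexMk (contDiff_E3_apply 1).contDiffOn
      (contDiff_E3_apply 2).contDiffOn)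
  · refine ContMDiff.comp_contMDiffOn (I' := 𝓘(ℝ, ℂ × ℂ)) (g := inv) hinv.contMDiff ?_
    exact hf.contMDiffOn.prodMk_space (hm.contMDiffOn.mono fun y hy => hy.1)
  · have hcont : ContinuousOn (fun y => ((f y).re, (f y).im ^ 2 + ‖z y‖ ^ 2)) (f ⁻¹' U) := by
      have h1 := hf.continuous.continuousOn (s := f ⁻¹' U)
      have h2 := hm.contMDiffOn.continuousOn
      exact (Complex.continuous_re.comp_continuousOn h1).prodMk
        (((Complex.continuous_im.comp_continuousOn h1).pow 2).add (h2.norm.pow 2))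
    have := hcont.isOpen_inter_preimage (hm.isOpen.preimage hf.continuous)
      (isOpen_Ioi.prod isOpen_Iio : IsOpen (Ioi c ×ˢ Iio (r ^ 2)))
    exact this
  · intro l hl0 hlr y hy
    have hlη : η < √(1 - l ^ 2) := by
      apply Real.lt_sqrt_of_sq_lt
      have h1 : l ^ 2 < √(1 - η ^ 2) ^ 2 := by
        have : l < √(1 - η ^ 2) := lt_of_lt_of_le hlr hrη
        gcongr
      rw [Real.sq_sqrt (by nlinarith)] at h1
      linarith
    have hyU : f y ∈ U := hη y (by linarith)
    have hyc : c < (f y).re := by linarith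
    have hre : √(1 - ‖inv (f y, z y)‖ ^ 2) = (f y).re - c := by
      have := congrArg Complex.re (hright y hyU hyc)
      change c + √(1 - ‖inv (f y, z y)‖ ^ 2) = _ at this
      linarith
    refine ⟨inv (f y, z y), ?_, ?_⟩
    · have h1 : √(1 - l ^ 2) < √(1 - ‖inv (f y, z y)‖ ^ 2) := by rw [hre]; linarith
      have h2 := (Real.sqrt_lt_sqrt_iff_of_pos
        (Real.sqrt_pos.1 (lt_of_le_of_lt (Real.sqrt_nonneg _) h1))).1 h1
      exact lt_of_pow_lt_pow_left₀ 2 hl0.le (by linarith)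
    · change Ψ (w (inv (f y, z y)), ζ (inv (f y, z y))) = y
      have h1 : ζ (inv (f y, z y)) = z y := rfl
      rw [hright y hyU hyc, h1, hm.left_inv y hyU]

end

/-- The map `f` is standard on the unit ball embedded by `e`, which is the part of `M` over the
cap `{re > √(1 - l²) - 1}` of the disc of radius `1` about `-1`. -/
structure IsStandardOn {M : Type*} (f : M → ℂ) (e : E3 → M) (l : ℝ) : Prop where
  apply : ∀ x, ‖x‖ < 1 → f (e x) = ⟨√(1 - (l * ‖x‖) ^ 2) - 1, l * x 0⟩
  re_le : ∀ y, (∀ x, ‖x‖ < 1 → e x ≠ y) → (f y).re ≤ √(1 - l ^ 2) - 1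

/-- A capped Werther map can be made standard on a given embedded ball. -/
theorem exists_isStandardOn : ∃ μ : ℝ, 0 < μ ∧ μ < 1 ∧
    ∀ {M : Type u} [TopologicalSpace M] [ChartedSpace E3 M] [IsManifold (𝓡 3) ∞ M] [T2Space M]
      [PreconnectedSpace M] [CompactSpace M] {e : PartialEquiv E3 M} {f : M → ℂ},
      IsBallEmbedding e 2 → IsCappedWertherMap f →
      ∃ n₀ : ℕ, ∀ n ≥ n₀, ∃ f' : M → ℂ, IsCappedWertherMap f' ∧ IsStandardOn f' e (μ ^ n) := by
  obtain ⟨μ, hμ0, hμ1, H⟩ := exists_diffeomorph_ball_eq.{u}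
  refine ⟨μ, hμ0, hμ1, ?_⟩
  intro M _ _ _ _ _ _ e f he hf
  obtain ⟨c, hc⟩ := hf.rightCap
  obtain ⟨s, r, hr, hs, hfs, hrange⟩ := hc.exists_ball hf.contMDiff
  obtain ⟨n₁, hn₁⟩ := H he hs hr
  obtain ⟨n₂, hn₂⟩ := exists_pow_lt_of_lt_one hr hμ1
  refine ⟨max n₁ n₂, fun n hn => ?_⟩
  obtain ⟨h, hh⟩ := hn₁ n ((le_max_left _ _).trans hn)
  have hl0 : 0 < μ ^ n := pow_pos hμ0 n
  have hlr : μ ^ n < r :=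
    (pow_le_pow_of_le_one hμ0.le hμ1.le ((le_max_right _ _).trans hn)).trans_lt hn₂
  obtain ⟨T, hT, hTs, hT0, hTn⟩ : ∃ T : E3 → E3, (∀ x, ‖x‖ < 1 → h (e x) = s (μ ^ n • T x)) ∧
      (∀ x, T (T x) = x) ∧ (∀ x, T x 0 = x 0) ∧ (∀ x, ‖T x‖ = ‖x‖) := by
    rcases hh with hh | hh
    · exact ⟨id, hh, fun _ => rfl, fun _ => rfl, fun _ => rfl⟩
    · refine ⟨reflectLast, fun x hx => ?_, reflectLast_reflectLast, reflectLast_apply_zero,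
        reflectLast.norm_map⟩
      rw [hh x hx, map_smul]
  refine ⟨fun x => f (h x) + ((-(c + 1) : ℝ) : ℂ), hf.comp_diffeomorph _ h, ?_, ?_⟩
  · intro x hx
    have hn : ‖μ ^ n • T x‖ = μ ^ n * ‖x‖ := by
      rw [norm_smul, hTn, Real.norm_of_nonneg hl0.le]
    have hn' : ‖μ ^ n • T x‖ < r := by
      rw [hn]; nlinarith [norm_nonneg x]
    have hx0 : (μ ^ n • T x) 0 = μ ^ n * x 0 := by
      rw [PiLp.smul_apply, hT0, smul_eq_mul]
    simp only
    rw [hT x hx, hfs _ hn', hn, hx0]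
    apply Complex.ext
    · simp only [Complex.add_re, Complex.ofReal_re]; ring
    · simp only [Complex.add_im, Complex.ofReal_im, add_zero]
  · intro y hy
    by_contra hlt
    simp only [Complex.add_re, Complex.ofReal_re, not_le] at hlt
    obtain ⟨x, hx, hxy⟩ := hrange _ hl0 hlr (h y) (by linarith)
    refine hy (T ((μ ^ n)⁻¹ • x)) ?_ ?_
    · rw [hTn, norm_smul, norm_inv, Real.norm_of_nonneg hl0.le, inv_mul_lt_iff₀ hl0, mul_one]
      exact hx
    · apply h.injective
      change h (e _) = h y
      rw [hT, hTs, smul_inv_smul₀ hl0.ne', hxy]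
      rw [hTn, norm_smul, norm_inv, Real.norm_of_nonneg hl0.le, inv_mul_lt_iff₀ hl0, mul_one]
      exact hx

/-! ### The profile of the neck -/

/-- The real part of a standard map at distance `t` from the centre of its ball. -/
noncomputable def capProfile (l t : ℝ) : ℝ := √(1 - (l * t) ^ 2) - 1

/-- A smooth step from `0` to `1` on the interval from `1 / 3` to `2 / 3`. -/
noncomputable def step (t : ℝ) : ℝ := Real.smoothTransition (3 * t - 1)

/-- The real part of the map on the neck: near `t = 1` the cap profile, near `t = 0` its mirror
image. -/
noncomputable def neckHeight (l t : ℝ) : ℝ :=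
  capProfile l t * step t - capProfile l (1 - t) * (1 - step t)

/-- The radius of the spheres of the neck. -/
noncomputable def neckRadius (l t : ℝ) : ℝ := l * (t * step t + (1 - t) * (1 - step t))

theorem contDiff_step : ContDiff ℝ ∞ step :=
  Real.smoothTransition.contDiff.comp ((contDiff_const.mul contDiff_id).sub contDiff_const)

theorem step_one_sub (t : ℝ) : step (1 - t) = 1 - step t := by
  have h := (Real.smoothTransition.pos_denom (3 * t - 1)).ne'
  have e1 : 3 * (1 - t) - 1 = 1 - (3 * t - 1) := by ring
  have e2 : 1 - (1 - (3 * t - 1)) = 3 * t - 1 := by ring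
  simp only [step, e1, Real.smoothTransition, e2]
  rw [add_comm (expNegInvGlue (1 - (3 * t - 1)))]
  field_simp
  ring

theorem step_nonneg (t : ℝ) : 0 ≤ step t := Real.smoothTransition.nonneg _

theorem step_le_one (t : ℝ) : step t ≤ 1 := Real.smoothTransition.le_one _

theorem step_eq_one {t : ℝ} (ht : 2 / 3 ≤ t) : step t = 1 :=
  Real.smoothTransition.one_of_one_le (by linarith)

theorem monotone_step : Monotone step := fun _ _ h =>
  Real.smoothTransition.monotone (by linarith)

theorem neckHeight_one_sub (l t : ℝ) : neckHeight l (1 - t) = -neckHeight l t := by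
  simp only [neckHeight, step_one_sub, sub_sub_cancel]
  ring

theorem neckRadius_one_sub (l t : ℝ) : neckRadius l (1 - t) = neckRadius l t := by
  simp only [neckRadius, step_one_sub, sub_sub_cancel]
  ring

theorem neckHeight_of_le {l t : ℝ} (ht : 2 / 3 ≤ t) : neckHeight l t = capProfile l t := by
  rw [neckHeight, step_eq_one ht]; ring

theorem neckRadius_of_le {l t : ℝ} (ht : 2 / 3 ≤ t) : neckRadius l t = l * t := by
  rw [neckRadius, step_eq_one ht]; ring

theorem neckHeight_zero (l : ℝ) : neckHeight l 0 = -capProfile l 1 := by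
  have := neckHeight_one_sub l 1
  rwa [sub_self, neckHeight_of_le (t := 1) (by norm_num)] at this

theorem neckRadius_pos {l t : ℝ} (hl : 0 < l) (ht : t ∈ Ioo (0 : ℝ) 1) : 0 < neckRadius l t := by
  refine mul_pos hl ?_
  have h1 := step_nonneg t
  have h2 := step_le_one t
  rcases h1.eq_or_lt with h | h
  · rw [← h]; linarith [ht.2]
  · have := mul_pos ht.1 h
    have := mul_nonneg (sub_nonneg.2 ht.2.le) (sub_nonneg.2 h2)
    linarith

theorem contDiff_neckRadius (l : ℝ) : ContDiff ℝ ∞ (neckRadius l) :=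
  contDiff_const.mul ((contDiff_id.mul contDiff_step).add
    ((contDiff_const.sub contDiff_id).mul (contDiff_const.sub contDiff_step)))

theorem one_sub_mul_sq_pos {l t : ℝ} (hl : 0 < l) (hl1 : l < 1) (ht : t ∈ Icc (0 : ℝ) 1) :
    0 < 1 - (l * t) ^ 2 := by
  have h1 : l * t < 1 := by nlinarith [ht.1, ht.2]
  have h2 : 0 ≤ l * t := mul_nonneg hl.le ht.1
  nlinarith

theorem contDiffOn_capProfile {l : ℝ} (hl : 0 < l) (hl1 : l < 1) :
    ContDiffOn ℝ ∞ (capProfile l) (Icc 0 1) := by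
  refine ContDiffOn.sub (ContDiffOn.sqrt ?_ fun t ht => (one_sub_mul_sq_pos hl hl1 ht).ne')
    contDiffOn_const
  exact (contDiff_const.sub ((contDiff_const.mul contDiff_id).pow 2)).contDiffOn

theorem contDiffOn_neckHeight {l : ℝ} (hl : 0 < l) (hl1 : l < 1) :
    ContDiffOn ℝ ∞ (neckHeight l) (Icc 0 1) := by
  refine ((contDiffOn_capProfile hl hl1).mul contDiff_step.contDiffOn).sub (ContDiffOn.mul ?_
    (contDiff_const.sub contDiff_step).contDiffOn)
  refine (contDiffOn_capProfile hl hl1).comp (contDiff_const.sub contDiff_id).contDiffOn ?_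
  intro t ht
  exact ⟨by linarith [ht.2], by linarith [ht.1]⟩

theorem capProfile_nonpos (l t : ℝ) : capProfile l t ≤ 0 := by
  have : √(1 - (l * t) ^ 2) ≤ 1 := by
    exact Real.sqrt_le_one.2 (by nlinarith [sq_nonneg (l * t)])
  rw [capProfile]; linarith

theorem exists_hasDerivAt_capProfile {l t : ℝ} (hl : 0 < l) (hl1 : l < 1)
    (ht : t ∈ Ioo (0 : ℝ) 1) : ∃ d < 0, HasDerivAt (capProfile l) d t := by
  have hpos := one_sub_mul_sq_pos hl hl1 (Ioo_subset_Icc_self ht)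
  have h1 : HasDerivAt (fun t : ℝ => 1 - (l * t) ^ 2) (-(2 * (l * t) * l)) t := by
    have := (((hasDerivAt_id t).const_mul l).pow 2).const_sub 1
    convert! this using 1
    simp
  refine ⟨_, ?_, (h1.sqrt hpos.ne').sub_const 1⟩
  apply div_neg_of_neg_of_pos
  · have := mul_pos hl ht.1
    nlinarith
  · have := Real.sqrt_pos.2 hpos
    linarith

theorem exists_hasDerivAt_neckHeight {l t : ℝ} (hl : 0 < l) (hl1 : l < 1)
    (ht : t ∈ Ioo (0 : ℝ) 1) : ∃ d < 0, HasDerivAt (neckHeight l) d t := by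
  obtain ⟨a, ha, hda⟩ := exists_hasDerivAt_capProfile hl hl1 ht
  have ht' : 1 - t ∈ Ioo (0 : ℝ) 1 := ⟨by linarith [ht.2], by linarith [ht.1]⟩
  obtain ⟨b, hb, hdb⟩ := exists_hasDerivAt_capProfile hl hl1 ht'
  have hs : HasDerivAt step (deriv step t) t :=
    (contDiff_step.differentiable (by simp) t).hasDerivAt
  have hs0 : 0 ≤ deriv step t := monotone_step.deriv_nonneg
  have hdb' : HasDerivAt (fun t => capProfile l (1 - t)) (-b) t := by
    have := HasDerivAt.comp t hdb ((hasDerivAt_id t).const_sub 1)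
    rwa [mul_neg_one] at this
  refine ⟨_, ?_, (hda.mul hs).sub (hdb'.mul (hs.const_sub 1))⟩
  have h1 := step_nonneg t
  have h2 := step_le_one t
  have h3 := capProfile_nonpos l t
  have h4 := capProfile_nonpos l (1 - t)
  have h5 := mul_nonneg (neg_nonneg.2 h3) hs0
  have h6 := mul_nonneg (neg_nonneg.2 h4) hs0
  have h7 : a * step t + b * (1 - step t) < 0 := by
    rcases h1.eq_or_lt with h | h
    · rw [← h]; linarith
    · have := mul_neg_of_neg_of_pos ha h
      have := mul_nonneg (neg_nonneg.2 hb.le) (sub_nonneg.2 h2)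
      linarith
  linarith

theorem strictAntiOn_neckHeight {l : ℝ} (hl : 0 < l) (hl1 : l < 1) :
    StrictAntiOn (neckHeight l) (Icc 0 1) := by
  refine strictAntiOn_of_deriv_neg (convex_Icc 0 1) (contDiffOn_neckHeight hl hl1).continuousOn ?_
  intro t ht
  rw [interior_Icc] at ht
  obtain ⟨d, hd, h⟩ := exists_hasDerivAt_neckHeight hl hl1 ht
  rwa [h.deriv]

/-- A smooth injective function on an open interval without critical points has an open image and a
smooth inverse. -/
theorem contDiffOn_invFunOn {A : ℝ → ℝ} {s : Set ℝ} (hs : IsOpen s) (hA : ContDiffOn ℝ ∞ A s)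
    (hinj : InjOn A s) (hd : ∀ t ∈ s, ∃ d ≠ 0, HasDerivAt A d t) :
    IsOpen (A '' s) ∧ ContDiffOn ℝ ∞ (Function.invFunOn A s) (A '' s) := by
  have key : ∀ t ∈ s, ∃ φ : ℝ → ℝ, ContDiffAt ℝ ∞ φ (A t) ∧
      ∀ᶠ X in 𝓝 (A t), φ X ∈ s ∧ A (φ X) = X := by
    intro t ht
    obtain ⟨d, hd0, hdA⟩ := hd t ht
    have hc : ContDiffAt ℝ ∞ A t := hA.contDiffAt (hs.mem_nhds ht)
    have hd' := hdA.hasFDerivAt_equiv hd0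
    have hloc := hc.to_localInverse hd' (by simp)
    have happ := hc.localInverse_apply_image hd' (by simp)
    refine ⟨_, hloc, ?_⟩
    have hs' : ∀ᶠ X in 𝓝 (A t), hc.localInverse hd' (by simp) X ∈ s :=
      hloc.continuousAt.eventually (by rw [happ]; exact hs.mem_nhds ht)
    exact hs'.and ((hc.hasStrictFDerivAt' hd' (by simp)).eventually_right_inverse)
  constructor
  · rw [isOpen_iff_mem_nhds]
    rintro _ ⟨t, ht, rfl⟩
    obtain ⟨φ, -, h⟩ := key t ht
    filter_upwards [h] with X hX
    exact ⟨φ X, hX.1, hX.2⟩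
  · rintro _ ⟨t, ht, rfl⟩
    obtain ⟨φ, hφ, h⟩ := key t ht
    refine (hφ.congr_of_eventuallyEq ?_).contDiffWithinAt
    filter_upwards [h] with X hX
    have hX' : X ∈ A '' s := ⟨φ X, hX.1, hX.2⟩
    exact hinj (Function.invFunOn_mem hX') hX.1
      ((Function.invFunOn_eq hX').trans hX.2.symm)

/-! ### Opening a standard ball into a neck -/

/-- The neck in coordinates of the punctured ball: the sphere of radius `t` is mapped to a vertical
segment over `neckHeight l t`. -/
noncomputable def neckValue (l : ℝ) (x : E3) : ℂ :=
  ⟨neckHeight l ‖x‖, neckRadius l ‖x‖ * (x 0 / ‖x‖)⟩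

section
variable {M : Type*}

open Classical in
/-- The map `f` with its values on the embedded unit ball replaced by those of the neck. -/
noncomputable def neckMap (f : M → ℂ) (e : PartialEquiv E3 M) (l : ℝ) (y : M) : ℂ :=
  if ∃ x, ‖x‖ < 1 ∧ e x = y then neckValue l (e.symm y) else f y

variable {f : M → ℂ} {e : PartialEquiv E3 M} {l : ℝ}

theorem neckMap_of_forall_ne {y : M} (hy : ∀ x, ‖x‖ < 1 → e x ≠ y) : neckMap f e l y = f y := by
  rw [neckMap, if_neg]
  rintro ⟨x, hx, rfl⟩
  exact hy x hx rfl

theorem neckMap_re_le (hf : IsStandardOn f e l) {y : M} (hy : ∀ x, ‖x‖ < 1 → e x ≠ y) :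
    (neckMap f e l y).re ≤ capProfile l 1 := by
  rw [neckMap_of_forall_ne hy]
  have := hf.re_le y hy
  rwa [capProfile, mul_one]

variable [TopologicalSpace M] [ChartedSpace E3 M]

theorem neckMap_apply (he : IsBallEmbedding e 2) {x : E3} (hx : ‖x‖ < 1) :
    neckMap f e l (e x) = neckValue l x := by
  rw [neckMap, if_pos ⟨x, hx, rfl⟩, he.left_inv (by linarith)]

/-- Near the boundary of the ball nothing changes. -/
theorem neckMap_eq (he : IsBallEmbedding e 2) (hf : IsStandardOn f e l) {y : M}
    (hy : ∀ x, ‖x‖ ≤ 2 / 3 → e x ≠ y) : neckMap f e l y = f y := by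
  by_cases h : ∃ x, ‖x‖ < 1 ∧ e x = y
  · obtain ⟨x, hx, rfl⟩ := h
    have h23 : 2 / 3 ≤ ‖x‖ := by
      by_contra hlt
      exact hy x (not_le.1 hlt).le rfl
    have h0 : ‖x‖ ≠ 0 := by intro h0; rw [h0] at h23; norm_num at h23
    rw [neckMap_apply he hx, hf.apply x hx, neckValue, neckHeight_of_le h23, neckRadius_of_le h23,
      capProfile]
    congr 1
    field_simp
  · exact neckMap_of_forall_ne fun x hx hxy => h ⟨x, hx, hxy⟩

theorem neckHeight_mem_Ioo {t : ℝ} (hl : 0 < l) (hl1 : l < 1) (ht : t ∈ Ioo (0 : ℝ) 1) :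
    neckHeight l t ∈ Ioo (capProfile l 1) (-capProfile l 1) := by
  have h := strictAntiOn_neckHeight hl hl1
  constructor
  · rw [← neckHeight_of_le (l := l) (t := 1) (by norm_num)]
    exact h (Ioo_subset_Icc_self ht) (by simp) ht.2
  · rw [← neckHeight_zero]
    exact h (by simp) (Ioo_subset_Icc_self ht) ht.1

theorem capProfile_one_neg (hl : 0 < l) (hl1 : l < 1) : capProfile l 1 < 0 := by
  have h := neckHeight_mem_Ioo (t := 1 / 2) hl hl1 (by norm_num)
  linarith [h.1.trans h.2]

theorem neckMap_zero_re (he : IsBallEmbedding e 2) :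
    (neckMap f e l (e 0)).re = -capProfile l 1 := by
  rw [neckMap_apply he (by simp)]
  change neckHeight l ‖(0 : E3)‖ = _
  rw [norm_zero, neckHeight_zero]

theorem neckMap_re_lt_iff (he : IsBallEmbedding e 2) (hf : IsStandardOn f e l) (hl : 0 < l)
    (hl1 : l < 1) {y : M} : (neckMap f e l y).re < -capProfile l 1 ↔ y ≠ e 0 := by
  constructor
  · rintro h rfl
    rw [neckMap_zero_re he] at h
    exact lt_irrefl _ h
  · intro h
    by_cases hy : ∃ x, ‖x‖ < 1 ∧ e x = y
    · obtain ⟨x, hx, rfl⟩ := hy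
      have hx0 : x ≠ 0 := fun h0 => h (by rw [h0])
      rw [neckMap_apply he hx]
      exact (neckHeight_mem_Ioo hl hl1 ⟨norm_pos_iff.2 hx0, hx⟩).2
    · have h1 := neckMap_re_le hf (y := y) fun x hx hxy => hy ⟨x, hx, hxy⟩
      have h2 := capProfile_one_neg hl hl1
      linarith

theorem contDiffOn_neckValue (hl : 0 < l) (hl1 : l < 1) :
    ContDiffOn ℝ ∞ (neckValue l) (ball 0 1 \ {0}) := by
  have hn : ContDiffOn ℝ ∞ (fun x : E3 => ‖x‖) (ball 0 1 \ {0}) := fun x hx =>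
    (contDiffAt_norm ℝ hx.2).contDiffWithinAt
  refine contDiff_complexMk ?_ ?_
  · refine (contDiffOn_neckHeight hl hl1).comp hn fun x hx => ⟨norm_nonneg x, ?_⟩
    have : ‖x‖ < 1 := by simpa using hx.1
    exact this.le
  · exact ((contDiff_neckRadius l).comp_contDiffOn hn).mul
      ((contDiff_E3_apply 0).contDiffOn.div hn fun x hx => norm_ne_zero_iff.2 hx.2)

theorem contMDiffOn_neckMap [T2Space M] (he : IsBallEmbedding e 2) (hf : IsStandardOn f e l)
    (hfs : ContMDiff (𝓡 3) 𝓘(ℝ, ℂ) ∞ f) (hl : 0 < l) (hl1 : l < 1) :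
    ContMDiffOn (𝓡 3) 𝓘(ℝ, ℂ) ∞ (neckMap f e l) {e 0}ᶜ := by
  intro y hy
  refine ContMDiffAt.contMDiffWithinAt ?_
  by_cases h : ∃ x, ‖x‖ < 1 ∧ e x = y
  · obtain ⟨x, hx, rfl⟩ := h
    have hopen : IsOpen (e '' ball 0 1) :=
      he.isOpen_image isOpen_ball (ball_subset_ball (by norm_num))
    have hmem : e x ∈ e '' ball 0 1 := ⟨x, by simpa using hx, rfl⟩
    have hx0 : x ≠ 0 := fun h0 => hy (by rw [h0]; rfl)
    have hxt := he.map_mem (x := x) (by linarith)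
    have h1 : ContDiffAt ℝ ∞ (neckValue l) (e.symm (e x)) := by
      rw [he.left_inv (by linarith)]
      refine (contDiffOn_neckValue hl hl1).contDiffAt ?_
      exact (isOpen_ball.sdiff isClosed_singleton).mem_nhds ⟨by simpa using hx, hx0⟩
    refine (ContMDiffAt.comp (e x) h1.contMDiffAt
      (he.contMDiffAt_symm hxt)).congr_of_eventuallyEq ?_
    filter_upwards [hopen.mem_nhds hmem]
    rintro _ ⟨v, hv, rfl⟩
    have hv' : ‖v‖ < 1 := by simpa using hv
    rw [neckMap_apply he hv', Function.comp_apply, he.left_inv (by linarith)]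
  · have hclosed := he.isClosed_image_closedBall (r' := 2 / 3) (by norm_num)
    have hmem : y ∈ (e '' closedBall 0 (2 / 3))ᶜ := by
      rintro ⟨x, hx, rfl⟩
      have : ‖x‖ ≤ 2 / 3 := by simpa using hx
      exact h ⟨x, by linarith, rfl⟩
    refine hfs.contMDiffAt.congr_of_eventuallyEq ?_
    filter_upwards [hclosed.isOpen_compl.mem_nhds hmem] with v hv
    refine neckMap_eq he hf fun x hx hxv => hv ⟨x, by simpa using hx, hxv⟩

/-- To the left of the part that is changed, the fibres of `f` and of `neckMap f e l` agree. -/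
theorem isFiberDiffeo_neckMap (he : IsBallEmbedding e 2) (hf : IsStandardOn f e l)
    (hl : 0 < l) (hl1 : l < 1) :
    IsFiberDiffeo f (neckMap f e l) {w | w.re < capProfile l (2 / 3)} (Diffeomorph.refl _ _ _)
      (PartialEquiv.ofSet (f ⁻¹' {w | w.re < capProfile l (2 / 3)})) := by
  have hanti := strictAntiOn_neckHeight hl hl1
  have h23 : neckHeight l (2 / 3) = capProfile l (2 / 3) := neckHeight_of_le le_rfl
  have hcmp : ∀ x : E3, ‖x‖ ≤ 2 / 3 → capProfile l (2 / 3) ≤ neckHeight l ‖x‖ := by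
    intro x hx
    rw [← h23]
    exact hanti.antitoneOn ⟨norm_nonneg x, by linarith⟩ (by norm_num) hx
  have hcmp' : ∀ x : E3, ‖x‖ ≤ 2 / 3 → capProfile l (2 / 3) ≤ capProfile l ‖x‖ := by
    intro x hx
    rw [capProfile, capProfile]
    have : (l * ‖x‖) ^ 2 ≤ (l * (2 / 3)) ^ 2 := by gcongr
    gcongr
  have hA : ∀ y, (f y).re < capProfile l (2 / 3) → ∀ x, ‖x‖ ≤ 2 / 3 → e x ≠ y := by
    rintro y hy x hx rfl
    rw [hf.apply x (by linarith)] at hy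
    exact absurd hy (not_lt.2 (hcmp' x hx))
  have hB : ∀ y, (neckMap f e l y).re < capProfile l (2 / 3) → ∀ x, ‖x‖ ≤ 2 / 3 → e x ≠ y := by
    rintro y hy x hx rfl
    rw [neckMap_apply he (by linarith)] at hy
    exact absurd hy (not_lt.2 (hcmp x hx))
  have heq : f ⁻¹' {w | w.re < capProfile l (2 / 3)} =
      neckMap f e l ⁻¹' {w | w.re < capProfile l (2 / 3)} := by
    ext y
    constructor
    · intro hy
      change (neckMap f e l y).re < _
      rwa [neckMap_eq he hf (hA y hy)]
    · intro hy
      change (f y).re < _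
      rwa [← neckMap_eq he hf (hB y hy)]
  refine ⟨isOpen_lt Complex.continuous_re continuous_const, ?_, fun y hy => ?_⟩
  · convert! isDiffeoBetween_ofSet (f ⁻¹' {w | w.re < capProfile l (2 / 3)}) using 1
    rw [heq]
    congr 1
    exact image_id _
  · exact neckMap_eq he hf (hA y hy)

/-- The neck is a circle model: it is the hypersurface of revolution with profile
`neckRadius l`. -/
theorem isCircleModel_neckMap (he : IsBallEmbedding e 2) (hf : IsStandardOn f e l) (hl : 0 < l)
    (hl1 : l < 1) : ∃ ρ z Ψ, IsCircleModel (neckMap f e l)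
      {w | w.re ∈ neckHeight l '' Ioo 0 1} ρ z Ψ := by
  have hanti := strictAntiOn_neckHeight hl hl1
  obtain ⟨hopen, hinv⟩ := contDiffOn_invFunOn isOpen_Ioo
    ((contDiffOn_neckHeight hl hl1).mono Ioo_subset_Icc_self)
    (hanti.injOn.mono Ioo_subset_Icc_self) fun t ht => by
      obtain ⟨d, hd, h⟩ := exists_hasDerivAt_neckHeight hl hl1 ht
      exact ⟨d, hd.ne, h⟩
  set τ := Function.invFunOn (neckHeight l) (Ioo 0 1) with hτ
  set U : Set ℂ := {w | w.re ∈ neckHeight l '' Ioo 0 1} with hUdef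
  have hτmem : ∀ w ∈ U, τ w.re ∈ Ioo (0 : ℝ) 1 := fun w hw => Function.invFunOn_mem hw
  have hτeq : ∀ w ∈ U, neckHeight l (τ w.re) = w.re := fun w hw => Function.invFunOn_eq hw
  have hτapply : ∀ t ∈ Ioo (0 : ℝ) 1, τ (neckHeight l t) = t := fun t ht =>
    hanti.injOn (Ioo_subset_Icc_self (Function.invFunOn_mem ⟨t, ht, rfl⟩))
      (Ioo_subset_Icc_self ht) (Function.invFunOn_eq ⟨t, ht, rfl⟩)
  have hUopen : IsOpen U := hopen.preimage Complex.continuous_re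
  let R : ℂ → ℝ := fun w => neckRadius l (τ w.re)
  have hτs : ContDiffOn ℝ ∞ (fun w : ℂ => τ w.re) U :=
    hinv.comp Complex.reCLM.contDiff.contDiffOn fun w hw => hw
  have hRs : ContDiffOn ℝ ∞ R U := (contDiff_neckRadius l).comp_contDiffOn hτs
  have hRpos : ∀ w ∈ U, 0 < R w := fun w hw => neckRadius_pos hl (hτmem w hw)
  -- Points over `U` are the points of the punctured ball.
  have hball : ∀ y, neckMap f e l y ∈ U → ∃ x, ‖x‖ < 1 ∧ x ≠ 0 ∧ e x = y := by
    intro y hy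
    obtain ⟨t, ht, hty⟩ := hy
    have hI := neckHeight_mem_Ioo hl hl1 ht
    rw [hty] at hI
    by_cases h : ∃ x, ‖x‖ < 1 ∧ e x = y
    · obtain ⟨x, hx, rfl⟩ := h
      refine ⟨x, hx, ?_, rfl⟩
      rintro rfl
      rw [neckMap_zero_re he] at hI
      exact lt_irrefl _ hI.2
    · have := neckMap_re_le hf (y := y) fun x hx hxy => h ⟨x, hx, hxy⟩
      linarith [hI.1]
  let ρ : ℂ → ℝ := fun w => R w ^ 2 - w.im ^ 2
  let zc : E3 → ℂ := fun x => ((neckRadius l ‖x‖ / ‖x‖ : ℝ) : ℂ) * ⟨x 1, x 2⟩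
  let x' : ℂ × ℂ → E3 := fun p =>
    (τ p.1.re / R p.1) • (!₂[p.1.im, p.2.re, p.2.im] : E3)
  have hvec : ContDiff ℝ ∞ fun p : ℂ × ℂ => (!₂[p.1.im, p.2.re, p.2.im] : E3) := by
    rw [contDiff_euclidean]
    intro i
    fin_cases i
    · exact Complex.imCLM.contDiff.comp contDiff_fst
    · exact Complex.reCLM.contDiff.comp contDiff_snd
    · exact Complex.imCLM.contDiff.comp contDiff_snd
  have hx'n : ∀ w ∈ U, ∀ ζ : ℂ, ‖ζ‖ ^ 2 = ρ w → ‖x' (w, ζ)‖ = τ w.re := by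
    intro w hw ζ hζ
    have h1 : ‖(!₂[w.im, ζ.re, ζ.im] : E3)‖ = R w := by
      rw [← sq_eq_sq₀ (norm_nonneg _) (hRpos w hw).le, E3.norm_sq]
      rw [Complex.norm_sq_eq_re_add_im] at hζ
      simp [ρ] at hζ ⊢
      linarith
    rw [norm_smul, h1, Real.norm_of_nonneg (div_nonneg (hτmem w hw).1.le (hRpos w hw).le),
      div_mul_cancel₀ _ (hRpos w hw).ne']
  have hval : ∀ w ∈ U, ∀ ζ : ℂ, ‖ζ‖ ^ 2 = ρ w → neckMap f e l (e (x' (w, ζ))) = w := by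
    intro w hw ζ hζ
    have hn := hx'n w hw ζ hζ
    have ht := hτmem w hw
    rw [neckMap_apply he (by rw [hn]; exact ht.2), neckValue, hn, hτeq w hw]
    apply Complex.ext
    · rfl
    · change R w * ((τ w.re / R w * w.im) / τ w.re) = w.im
      have h1 := (hRpos w hw).ne'
      have h2 := ht.1.ne'
      field_simp
  refine ⟨ρ, fun y => zc (e.symm y), fun p => e (x' p), hUopen,
    (hRs.pow 2).sub (Complex.imCLM.contDiff.pow 2).contDiffOn, ?_, ?_, ?_, ?_, ?_, ?_, ?_⟩
  · -- On the boundary the imaginary part does not vanish, and `ρ` varies with it.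
    intro w hw h0 hd
    have hdiff : DifferentiableAt ℝ ρ w :=
      (((hRs.pow 2).sub (Complex.imCLM.contDiff.pow 2).contDiffOn).contDiffAt
        (hUopen.mem_nhds hw)).differentiableAt (by simp)
    have h1 := hdiff.hasFDerivAt
    rw [hd] at h1
    have hγ : HasDerivAt (fun s : ℝ => w + s * Complex.I) Complex.I 0 := by
      have := ((Complex.ofRealCLM.hasDerivAt (x := 0)).mul_const Complex.I).const_add w
      simpa using this
    have h1' : HasFDerivAt ρ (0 : ℂ →L[ℝ] ℝ) (w + ((0 : ℝ) : ℂ) * Complex.I) := by simpa using h1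
    have h2 := HasFDerivAt.comp_hasDerivAt (x := (0 : ℝ)) (l := ρ) h1' hγ
    have h3 : HasDerivAt (fun s : ℝ => R w ^ 2 - (w.im + s) ^ 2) (-(2 * w.im)) 0 := by
      have := (((hasDerivAt_id (0 : ℝ)).const_add w.im).pow 2).const_sub (R w ^ 2)
      simpa using this
    have h4 : (ρ ∘ fun s : ℝ => w + s * Complex.I) = fun s : ℝ => R w ^ 2 - (w.im + s) ^ 2 := by
      ext s
      simp [ρ, R]
    rw [h4] at h2
    have h5 := h3.unique h2
    have h6 : w.im = 0 := by
      simp only [zero_apply] at h5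
      linarith
    have h7 := hRpos w hw
    simp only [ρ, h6] at h0
    nlinarith
  · have hz : ContDiffOn ℝ ∞ zc (ball 0 1 \ {0}) := by
      have hn : ContDiffOn ℝ ∞ (fun x : E3 => ‖x‖) (ball 0 1 \ {0}) := fun x hx =>
        (contDiffAt_norm ℝ hx.2).contDiffWithinAt
      refine ContDiffOn.mul (Complex.ofRealCLM.contDiff.comp_contDiffOn
        (((contDiff_neckRadius l).comp_contDiffOn hn).div hn
          fun x hx => norm_ne_zero_iff.2 hx.2)) ?_
      exact contDiff_complexMk (contDiff_E3_apply 1).contDiffOn (contDiff_E3_apply 2).contDiffOn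
    refine hz.contMDiffOn.comp (he.isDiffeo.contMDiffOn_symm.mono ?_) ?_
    · intro y hy
      obtain ⟨x, hx, -, rfl⟩ := hball y hy
      exact he.map_mem (by linarith)
    · intro y hy
      obtain ⟨x, hx, hx0, rfl⟩ := hball y hy
      rw [mem_preimage, he.left_inv (by linarith)]
      exact ⟨by simpa using hx, hx0⟩
  · refine he.isDiffeo.contMDiffOn.comp (t := ball 0 2) (ContDiffOn.contMDiffOn ?_) ?_
    · have h1 : ContDiffOn ℝ ∞ (fun p : ℂ × ℂ => τ p.1.re / R p.1)
          {p : ℂ × ℂ | p.1 ∈ U ∧ ‖p.2‖ ^ 2 = ρ p.1} :=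
        ContDiffOn.div (hτs.comp contDiff_fst.contDiffOn fun p hp => hp.1)
          (hRs.comp contDiff_fst.contDiffOn fun p hp => hp.1) fun p hp => (hRpos _ hp.1).ne'
      exact h1.smul hvec.contDiffOn
    · intro p hp
      have h1 : ‖x' p‖ = τ p.1.re := hx'n p.1 hp.1 p.2 hp.2
      rw [mem_preimage, mem_ball_zero_iff, h1]
      linarith [(hτmem p.1 hp.1).2]
  · intro y hy
    obtain ⟨x, hx, hx0, rfl⟩ := hball y hy
    have hxn := norm_pos_iff.2 hx0
    have h1 : ρ (neckMap f e l (e x)) = neckRadius l ‖x‖ ^ 2 -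
        (neckRadius l ‖x‖ * (x 0 / ‖x‖)) ^ 2 := by
      rw [neckMap_apply he hx]
      simp only [ρ, R, neckValue, hτapply _ ⟨hxn, hx⟩]
    rw [h1]
    simp only [zc]
    rw [he.left_inv (by linarith), norm_mul, mul_pow, Complex.norm_real, Complex.norm_sq_eq_re_add_im,
      Real.norm_eq_abs, sq_abs]
    have h2 := E3.norm_sq x
    have h3 : x 1 ^ 2 + x 2 ^ 2 = ‖x‖ ^ 2 - x 0 ^ 2 := by linarith
    simp only [h3]
    field_simp
  · intro y hy
    obtain ⟨x, hx, hx0, rfl⟩ := hball y hy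
    have hxn := norm_pos_iff.2 hx0
    have hr : 0 < neckRadius l ‖x‖ := neckRadius_pos hl ⟨hxn, hx⟩
    congr 1
    rw [he.left_inv (by linarith), neckMap_apply he hx]
    simp only [x', R, neckValue, hτapply _ ⟨hxn, hx⟩, zc]
    ext i
    fin_cases i <;> simp <;> field_simp
  · exact hval
  · intro w hw ζ hζ
    have hn := hx'n w hw ζ hζ
    have ht := hτmem w hw
    have h1 := (hRpos w hw).ne'
    have h2 := ht.1.ne'
    rw [he.left_inv (by rw [hn]; linarith [ht.2])]
    simp only [zc, hn]
    change ((R w / τ w.re : ℝ) : ℂ) * ⟨τ w.re / R w * ζ.re, τ w.re / R w * ζ.im⟩ = ζ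
    apply Complex.ext
    · simp only [Complex.re_ofReal_mul]; field_simp
    · simp only [Complex.im_ofReal_mul]; field_simp

/-- Opening the cap into a neck keeps the local structure away from the centre of the ball, which
the connected sum removes. -/
theorem isWertherAt_neckMap (he : IsBallEmbedding e 2) (hf : IsStandardOn f e l)
    (hfw : IsCappedWertherMap f) (hl : 0 < l) (hl1 : l < 1) {y : M} (hy : y ≠ e 0) :
    IsWertherAt (neckMap f e l) (neckMap f e l y) := by
  by_cases h : ∃ x, ‖x‖ < 1 ∧ e x = y
  · obtain ⟨x, hx, rfl⟩ := h
    have hx0 : x ≠ 0 := fun h0 => hy (by rw [h0])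
    obtain ⟨ρ, z, Ψ, hm⟩ := isCircleModel_neckMap he hf hl hl1
    refine Or.inl ⟨_, ρ, z, Ψ, ?_, hm⟩
    rw [neckMap_apply he hx]
    exact ⟨‖x‖, ⟨norm_pos_iff.2 hx0, hx⟩, rfl⟩
  · have hne : ∀ x, ‖x‖ < 1 → e x ≠ y := fun x hx hxy => h ⟨x, hx, hxy⟩
    have h1 := neckMap_re_le hf hne
    rw [neckMap_of_forall_ne hne] at h1 ⊢
    refine (hfw.isWertherAt y).transport (isFiberDiffeo_neckMap he hf hl hl1) ?_
    refine lt_of_le_of_lt h1 ?_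
    have := strictAntiOn_neckHeight hl hl1 (a := 2 / 3) (b := 1) (by norm_num) (by norm_num)
      (by norm_num)
    rwa [neckHeight_of_le (by norm_num), neckHeight_of_le (by norm_num)] at this

theorem IsFiberDiffeo.reflect {M' : Type*} [TopologicalSpace M'] [ChartedSpace E3 M'] {f : M → ℂ}
    {f' : M' → ℂ} {V : Set ℂ} {j : PartialEquiv M M'}
    (h : IsFiberDiffeo f f' V (Diffeomorph.refl _ _ _) j) :
    IsFiberDiffeo (fun x => planeReflection (f x)) (fun x => planeReflection (f' x))
      (planeReflection '' V) (Diffeomorph.refl _ _ _) j := by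
  have hid : ∀ A : Set ℂ, (Diffeomorph.refl 𝓘(ℝ, ℂ) ℂ ∞) '' A = A := fun A => image_id A
  have hpre : (fun x => planeReflection (f x)) ⁻¹' (planeReflection '' V) = f ⁻¹' V := by
    ext x
    exact planeReflection.injective.mem_set_image
  have hpre' : (fun x => planeReflection (f' x)) ⁻¹' (planeReflection '' V) = f' ⁻¹' V := by
    ext x
    exact planeReflection.injective.mem_set_image
  refine ⟨planeReflection.toHomeomorph.isOpenMap _ h.isOpen, ?_, fun x hx => ?_⟩
  · rw [hid, hpre, hpre']
    have h2 := h.isDiffeo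
    rwa [hid] at h2
  · have hx' : f x ∈ V := planeReflection.injective.mem_set_image.1 hx
    exact congrArg planeReflection (h.comm x hx')

theorem hasLeftCap_neckMap (he : IsBallEmbedding e 2) (hf : IsStandardOn f e l)
    (hl : 0 < l) (hl1 : l < 1) {c : ℝ}
    (hc : HasLeftCap f c) : HasLeftCap (neckMap f e l) c ∧ 0 < c + 1 := by
  obtain ⟨⟨U, z, Ψ, hU, hm⟩, hmax⟩ := hc
  have hanti := strictAntiOn_neckHeight hl hl1
  have hle : ∀ t, 2 / 3 ≤ t → t < 1 → -neckHeight l t ≤ c + 1 := by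
    intro t ht ht1
    let x : E3 := EuclideanSpace.single 0 t
    have hx : ‖x‖ = t := by
      rw [PiLp.norm_single]
      exact Real.norm_of_nonneg (by linarith)
    have h1 := (hmax (e x)).1
    rw [planeReflection_re, hf.apply x (by rw [hx]; exact ht1), hx] at h1
    rwa [neckHeight_of_le ht, capProfile]
  have hlt : ∀ t, 0 ≤ t → t < 1 → -neckHeight l t < c + 1 := by
    intro t ht ht1
    obtain ⟨t', ht', h23, ht1'⟩ : ∃ t', t < t' ∧ 2 / 3 ≤ t' ∧ t' < 1 :=
      ⟨max ((1 + t) / 2) (2 / 3), lt_max_of_lt_left (by linarith), le_max_right _ _,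
        max_lt (by linarith) (by norm_num)⟩
    have h1 := hanti (a := t) (b := t') ⟨ht, ht1.le⟩ ⟨by linarith, ht1'.le⟩ ht'
    linarith [hle t' h23 ht1']
  have hcap : capProfile l (2 / 3) < 0 := by
    have h1 := hanti (a := 1 / 2) (b := 2 / 3) (by norm_num) (by norm_num) (by norm_num)
    have h2 := neckHeight_one_sub l (1 / 2)
    rw [show (1 : ℝ) - 1 / 2 = 1 / 2 by norm_num] at h2
    rw [neckHeight_of_le (t := 2 / 3) le_rfl] at h1
    linarith
  have h23 := hlt (2 / 3) (by norm_num) (by norm_num)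
  rw [neckHeight_of_le le_rfl] at h23
  refine ⟨⟨?_, fun y => ?_⟩, by linarith⟩
  · have hfd := (isFiberDiffeo_neckMap he hf hl hl1).reflect
    set V := planeReflection '' {w : ℂ | w.re < capProfile l (2 / 3)} with hV
    have hmV : (c + 1 : ℂ) ∈ V := by
      refine ⟨planeReflection (c + 1), ?_, planeReflection_planeReflection _⟩
      change (planeReflection (c + 1)).re < _
      rw [planeReflection_re]
      simp only [Complex.add_re, Complex.ofReal_re, Complex.one_re]
      linarith
    exact ⟨_, _, _, mem_image_of_mem (Diffeomorph.refl 𝓘(ℝ, ℂ) ℂ ∞)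
        (show (c + 1 : ℂ) ∈ U ∩ V from ⟨hU, hmV⟩),
      (hm.mono (hm.isOpen.inter hfd.isOpen) inter_subset_left).transport hfd inter_subset_right⟩
  · beta_reduce
    by_cases h : ∃ x, ‖x‖ < 1 ∧ e x = y
    · obtain ⟨x, hx, rfl⟩ := h
      rw [neckMap_apply he hx]
      have h1 : (planeReflection (neckValue l x)).re < c + 1 := by
        rw [planeReflection_re]
        exact hlt ‖x‖ (norm_nonneg x) hx
      exact ⟨h1.le, fun h2 => absurd h2 h1.ne⟩
    · rw [neckMap_of_forall_ne fun x hx hxy => h ⟨x, hx, hxy⟩]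
      exact hmax y

end

/-! ### Connected sums of manifolds with capped Werther maps -/

theorem one_lt_rank_E3 : 1 < Module.rank ℝ E3 := by
  rw [← Module.finrank_eq_rank, finrank_euclideanSpace_fin]
  norm_num

theorem isPreconnected_compl_singleton_of_isBallEmbedding {M : Type*} [TopologicalSpace M]
    [ChartedSpace E3 M] [T2Space M] [PreconnectedSpace M] {e : PartialEquiv E3 M}
    (he : IsBallEmbedding e 2) : IsPreconnected ({e 0}ᶜ : Set M) := by
  refine isPreconnected_of_forall_constant fun b hb => ?_
  -- A locally constant function on the complement is constant on the punctured ball.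
  have hP : IsPreconnected ((fun p : ℝ × E3 => e (p.1 • p.2)) '' Ioo 0 1 ×ˢ sphere 0 1) := by
    refine (isPreconnected_Ioo.prod (isPreconnected_sphere one_lt_rank_E3 0 1)).image _ ?_
    refine he.continuousOn.comp (by fun_prop) ?_
    rintro ⟨t, v⟩ ⟨ht, hv⟩
    simp only [mem_sphere_iff_norm, sub_zero] at hv
    rw [mem_ball_zero_iff, norm_smul, hv, mul_one, Real.norm_of_nonneg ht.1.le]
    linarith [ht.2]
  have hmem : ∀ x : E3, ‖x‖ < 1 → x ≠ 0 →
      e x ∈ (fun p : ℝ × E3 => e (p.1 • p.2)) '' Ioo 0 1 ×ˢ sphere 0 1 := by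
    intro x hx hx0
    have hn := norm_pos_iff.2 hx0
    refine ⟨(‖x‖, ‖x‖⁻¹ • x), ⟨⟨hn, hx⟩, ?_⟩, ?_⟩
    · simp [norm_smul, hn.ne']
    · simp only
      rw [smul_inv_smul₀ hn.ne']
  have hsub : (fun p : ℝ × E3 => e (p.1 • p.2)) '' Ioo 0 1 ×ˢ sphere 0 1 ⊆ {e 0}ᶜ := by
    rintro _ ⟨⟨t, v⟩, ⟨ht, hv⟩, rfl⟩ h0
    simp only [mem_sphere_iff_norm, sub_zero] at hv
    have hn : ‖t • v‖ = t := by rw [norm_smul, hv, mul_one, Real.norm_of_nonneg ht.1.le]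
    have h1 : t • v = 0 := by
      have h2 := congrArg e.symm h0
      rwa [he.left_inv (by rw [hn]; linarith [ht.2]), he.left_inv (by simp)] at h2
    rw [h1, norm_zero] at hn
    exact ht.1.ne hn
  obtain ⟨c, hc⟩ : ∃ c, ∀ x : E3, ‖x‖ < 1 → x ≠ 0 → b (e x) = c := by
    let v : E3 := EuclideanSpace.single 0 (1 / 2)
    have hv : ‖v‖ = 1 / 2 := by rw [PiLp.norm_single]; norm_num
    refine ⟨b (e v), fun x hx hx0 => ?_⟩
    refine hP.constant (hb.mono hsub) (hmem x hx hx0) (hmem v (by rw [hv]; norm_num) ?_)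
    rw [← norm_pos_iff, hv]; norm_num
  classical
  let b' : M → Bool := Function.update b (e 0) c
  have hcont : Continuous b' := by
    rw [continuous_iff_continuousAt]
    intro y
    by_cases hy : y = e 0
    · subst hy
      have hopen : IsOpen (e '' ball 0 1) :=
        he.isOpen_image isOpen_ball (ball_subset_ball (by norm_num))
      refine (continuousAt_const (y := c)).congr ?_
      filter_upwards [hopen.mem_nhds ⟨0, by simp, rfl⟩]
      rintro _ ⟨x, hx, rfl⟩
      by_cases hx0 : e x = e 0
      · rw [hx0]; simp [b']
      · rw [show b' (e x) = b (e x) from Function.update_of_ne hx0 _ _]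
        exact (hc x (by simpa using hx) fun h => hx0 (by rw [h])).symm
    · have hnhds : ({e 0}ᶜ : Set M) ∈ 𝓝 y := isClosed_singleton.isOpen_compl.mem_nhds hy
      refine (hb.continuousAt hnhds).congr ?_
      filter_upwards [hnhds] with z hz
      exact (Function.update_of_ne hz _ _).symm
  intro x hx y hy
  have := PreconnectedSpace.constant ‹_› hcont (x := x) (y := y)
  rwa [show b' x = b x from Function.update_of_ne hx _ _,
    show b' y = b y from Function.update_of_ne hy _ _] at this

section
variable {M M₁ M₂ : Type*} [TopologicalSpace M] [ChartedSpace E3 M] [TopologicalSpace M₁]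
  [ChartedSpace E3 M₁] [TopologicalSpace M₂] [ChartedSpace E3 M₂]

/-- `M` is a connected sum of `M₁` and `M₂`, with orientations disregarded. -/
structure IsGluing (e₁ : PartialEquiv E3 M₁) (e₂ : PartialEquiv E3 M₂) (j₁ : PartialEquiv M₁ M)
    (j₂ : PartialEquiv M₂ M) : Prop where
  ball₁ : IsBallEmbedding e₁ 2
  ball₂ : IsBallEmbedding e₂ 2
  isDiffeo₁ : IsDiffeoBetween (𝓡 3) (𝓡 3) j₁ {e₁ 0}ᶜ j₁.target
  isDiffeo₂ : IsDiffeoBetween (𝓡 3) (𝓡 3) j₂ {e₂ 0}ᶜ j₂.target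
  isOpen₁ : IsOpen j₁.target
  isOpen₂ : IsOpen j₂.target
  cover : j₁.target ∪ j₂.target = univ
  eq_iff : ∀ x ∈ ({e₁ 0}ᶜ : Set M₁), ∀ y ∈ ({e₂ 0}ᶜ : Set M₂),
    j₁ x = j₂ y ↔ ∃ t : ℝ, 0 < t ∧ t < 1 ∧ ∃ v : E3, ‖v‖ = 1 ∧
      x = e₁ (t • v) ∧ y = e₂ ((1 - t) • v)

namespace IsGluing
variable {e₁ : PartialEquiv E3 M₁} {e₂ : PartialEquiv E3 M₂} {j₁ : PartialEquiv M₁ M}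
  {j₂ : PartialEquiv M₂ M}

theorem symm (h : IsGluing e₁ e₂ j₁ j₂) : IsGluing e₂ e₁ j₂ j₁ where
  ball₁ := h.ball₂
  ball₂ := h.ball₁
  isDiffeo₁ := h.isDiffeo₂
  isDiffeo₂ := h.isDiffeo₁
  isOpen₁ := h.isOpen₂
  isOpen₂ := h.isOpen₁
  cover := by rw [union_comm, h.cover]
  eq_iff := by
    intro x hx y hy
    rw [eq_comm, h.eq_iff y hy x hx]
    constructor
    · rintro ⟨t, h0, h1, v, hv, rfl, rfl⟩
      exact ⟨1 - t, by linarith, by linarith, v, hv, rfl, by rw [sub_sub_cancel]⟩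
    · rintro ⟨t, h0, h1, v, hv, rfl, rfl⟩
      exact ⟨1 - t, by linarith, by linarith, v, hv, rfl, by rw [sub_sub_cancel]⟩

theorem mem_source (h : IsGluing e₁ e₂ j₁ j₂) {x : M₁} : x ∈ j₁.source ↔ x ≠ e₁ 0 := by
  rw [h.isDiffeo₁.source_eq]; rfl

/-- The points of the second embedded ball, other than its centre, lie in the first piece too. -/
theorem apply_eq (h : IsGluing e₁ e₂ j₁ j₂) {x : E3} (hx : ‖x‖ < 1) (hx0 : x ≠ 0) :
    ∃ t : ℝ, 0 < t ∧ t < 1 ∧ ∃ v : E3, ‖v‖ = 1 ∧ t • v ≠ 0 ∧ x = (1 - t) • v ∧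
      j₂ (e₂ x) = j₁ (e₁ (t • v)) := by
  have hn := norm_pos_iff.2 hx0
  have ht : 0 < 1 - ‖x‖ := by linarith
  have hv : ‖‖x‖⁻¹ • x‖ = 1 := by simp [norm_smul, hn.ne']
  have hx' : x = (1 - (1 - ‖x‖)) • ‖x‖⁻¹ • x := by rw [sub_sub_cancel, smul_inv_smul₀ hn.ne']
  have htv : ‖(1 - ‖x‖) • ‖x‖⁻¹ • x‖ = 1 - ‖x‖ := by
    rw [norm_smul, hv, mul_one, Real.norm_of_nonneg ht.le]
  have htv0 : (1 - ‖x‖) • ‖x‖⁻¹ • x ≠ 0 := by rw [← norm_pos_iff, htv]; exact ht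
  refine ⟨1 - ‖x‖, ht, by linarith, ‖x‖⁻¹ • x, hv, htv0, hx', ?_⟩
  refine ((h.eq_iff _ ?_ _ ?_).2 ⟨1 - ‖x‖, ht, by linarith, _, hv, rfl, ?_⟩).symm
  · intro h0
    have := congrArg e₁.symm h0
    rw [h.ball₁.left_inv (by rw [htv]; linarith), h.ball₁.left_inv (by simp)] at this
    exact htv0 this
  · intro h0
    have := congrArg e₂.symm h0
    rw [h.ball₂.left_inv (by linarith), h.ball₂.left_inv (by simp)] at this
    exact hx0 this
  · rw [← hx']

theorem isCompact_image_compl_ball [CompactSpace M₁] (h : IsGluing e₁ e₂ j₁ j₂) :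
    IsCompact (j₁ '' (e₁ '' ball 0 (1 / 2))ᶜ) := by
  have hopen : IsOpen (e₁ '' ball 0 (1 / 2)) :=
    h.ball₁.isOpen_image isOpen_ball (ball_subset_ball (by norm_num))
  refine hopen.isClosed_compl.isCompact.image_of_continuousOn
    (h.isDiffeo₁.contMDiffOn.continuousOn.mono ?_)
  intro y hy h0
  exact hy ⟨0, by simp, h0.symm⟩

theorem target_subset (h : IsGluing e₁ e₂ j₁ j₂) :
    j₁.target ⊆ j₁ '' (e₁ '' ball 0 (1 / 2))ᶜ ∪ j₂ '' (e₂ '' ball 0 (1 / 2))ᶜ := by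
  intro m hm
  have hy := h.mem_source.1 (j₁.map_target hm)
  by_cases hb : j₁.symm m ∈ e₁ '' ball 0 (1 / 2)
  · right
    obtain ⟨x, hx, hxy⟩ := hb
    rw [mem_ball_zero_iff] at hx
    have hx0 : x ≠ 0 := by rintro rfl; exact hy hxy.symm
    obtain ⟨t, h0, h1, v, hv, -, hxt, heq⟩ := h.symm.apply_eq (by linarith) hx0
    refine ⟨e₂ (t • v), ?_, by rw [← heq, hxy, j₁.right_inv hm]⟩
    rintro ⟨x', hx', hxx⟩
    rw [mem_ball_zero_iff] at hx'
    have hn : ‖t • v‖ = t := by rw [norm_smul, hv, mul_one, Real.norm_of_nonneg h0.le]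
    have hn' : ‖x‖ = 1 - t := by
      rw [hxt, norm_smul, hv, mul_one, Real.norm_of_nonneg (by linarith)]
    have h2 := congrArg e₂.symm hxx
    rw [h.ball₂.left_inv (by linarith), h.ball₂.left_inv (by linarith)] at h2
    rw [h2] at hx'
    linarith
  · exact Or.inl ⟨_, hb, j₁.right_inv hm⟩

theorem compactSpace [CompactSpace M₁] [CompactSpace M₂] (h : IsGluing e₁ e₂ j₁ j₂) :
    CompactSpace M := by
  refine ⟨(h.isCompact_image_compl_ball.union h.symm.isCompact_image_compl_ball).of_isClosed_subset
    isClosed_univ ?_⟩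
  rw [← h.cover]
  refine union_subset h.target_subset ?_
  rw [union_comm]
  exact h.symm.target_subset

theorem isPreconnected_target [T2Space M₁] [PreconnectedSpace M₁] (h : IsGluing e₁ e₂ j₁ j₂) :
    IsPreconnected j₁.target := by
  rw [← j₁.image_source_eq_target, h.isDiffeo₁.source_eq]
  exact (isPreconnected_compl_singleton_of_isBallEmbedding h.ball₁).image _
    h.isDiffeo₁.contMDiffOn.continuousOn

theorem connectedSpace [T2Space M₁] [PreconnectedSpace M₁] [T2Space M₂] [PreconnectedSpace M₂]
    (h : IsGluing e₁ e₂ j₁ j₂) : ConnectedSpace M := by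
  let v : E3 := EuclideanSpace.single 0 (1 / 2)
  have hv : ‖v‖ = 1 / 2 := by rw [PiLp.norm_single]; norm_num
  have hv0 : v ≠ 0 := by rw [← norm_pos_iff, hv]; norm_num
  have hne : ∀ w : E3, ‖w‖ < 1 → w ≠ 0 → e₁ w ≠ e₁ 0 := by
    intro w hw hw0 h0
    have := congrArg e₁.symm h0
    rw [h.ball₁.left_inv (by linarith), h.ball₁.left_inv (by simp)] at this
    exact hw0 this
  have hne₂ : ∀ w : E3, ‖w‖ < 1 → w ≠ 0 → e₂ w ≠ e₂ 0 := by
    intro w hw hw0 h0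
    have := congrArg e₂.symm h0
    rw [h.ball₂.left_inv (by linarith), h.ball₂.left_inv (by simp)] at this
    exact hw0 this
  obtain ⟨t, h0, h1, u, hu, htu, -, heq⟩ := h.apply_eq (x := v) (by rw [hv]; norm_num) hv0
  have hn : ‖t • u‖ = t := by rw [norm_smul, hu, mul_one, Real.norm_of_nonneg h0.le]
  have hm₁ : j₁ (e₁ (t • u)) ∈ j₁.target :=
    j₁.map_source (h.mem_source.2 (hne _ (by linarith) htu))
  have hm₂ : j₂ (e₂ v) ∈ j₂.target :=
    j₂.map_source (h.symm.mem_source.2 (hne₂ _ (by rw [hv]; norm_num) hv0))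
  have := IsPreconnected.union (j₁ (e₁ (t • u))) hm₁ (heq ▸ hm₂) h.isPreconnected_target
    h.symm.isPreconnected_target
  rw [h.cover] at this
  exact { isPreconnected_univ := this, toNonempty := ⟨j₂ (e₂ v)⟩ }

end IsGluing

/-- A map that is a neck on the piece `j`, and lies to the right of the neck elsewhere, inherits the
structure of a capped Werther map from that piece. -/
theorem isWertherAt_of_neck [T2Space M₁] {F : M → ℂ} {f : M₁ → ℂ} {e : PartialEquiv E3 M₁}
    {j : PartialEquiv M₁ M} {l : ℝ} (he : IsBallEmbedding e 2)
    (hj : IsDiffeoBetween (𝓡 3) (𝓡 3) j {e 0}ᶜ j.target) (hjo : IsOpen j.target)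
    (hf : IsStandardOn f e l) (hfw : IsCappedWertherMap f) (hl : 0 < l) (hl1 : l < 1)
    (hF : ∀ y, y ≠ e 0 → F (j y) = neckMap f e l y)
    (hoff : ∀ m ∉ j.target, -capProfile l 1 ≤ (F m).re) :
    (∀ m ∈ j.target, ContMDiffAt (𝓡 3) 𝓘(ℝ, ℂ) ∞ F m) ∧ (∀ m ∈ j.target, IsWertherAt F (F m)) ∧
      ∃ c, HasLeftCap F c := by
  have hsrc : ∀ m ∈ j.target, j.symm m ≠ e 0 := fun m hm => by
    have := j.map_target hm
    rwa [hj.source_eq] at this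
  have hFm : ∀ m ∈ j.target, F m = neckMap f e l (j.symm m) := fun m hm => by
    rw [← hF _ (hsrc m hm), j.right_inv hm]
  have hid : ∀ A : Set ℂ, (Diffeomorph.refl 𝓘(ℝ, ℂ) ℂ ∞) '' A = A := fun A => image_id A
  have hpre : neckMap f e l ⁻¹' {w | w.re < -capProfile l 1} = {e 0}ᶜ := by
    ext y
    exact neckMap_re_lt_iff he hf hl hl1
  have hpre' : F ⁻¹' {w | w.re < -capProfile l 1} = j.target := by
    ext m
    constructor
    · intro hm
      by_contra h
      exact absurd hm (not_lt.2 (hoff m h))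
    · intro hm
      change (F m).re < _
      rw [hFm m hm]
      exact (neckMap_re_lt_iff he hf hl hl1).2 (hsrc m hm)
  have hfd : IsFiberDiffeo (neckMap f e l) F {w | w.re < -capProfile l 1}
      (Diffeomorph.refl _ _ _) j := by
    refine ⟨isOpen_lt Complex.continuous_re continuous_const, ?_, fun y hy => ?_⟩
    · rw [hid, hpre, hpre']
      exact hj
    · exact hF y ((neckMap_re_lt_iff he hf hl hl1).1 hy)
  refine ⟨fun m hm => ?_, fun m hm => ?_, ?_⟩
  · have h1 : ContMDiffOn (𝓡 3) 𝓘(ℝ, ℂ) ∞ (fun m => neckMap f e l (j.symm m)) j.target :=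
      (contMDiffOn_neckMap he hf hfw.contMDiff hl hl1).comp hj.contMDiffOn_symm hsrc
    refine (h1.contMDiffAt (hjo.mem_nhds hm)).congr_of_eventuallyEq ?_
    filter_upwards [hjo.mem_nhds hm] with m' hm' using hFm m' hm'
  · rw [hFm m hm]
    exact (isWertherAt_neckMap he hf hfw hl hl1 (hsrc m hm)).transport hfd
      ((neckMap_re_lt_iff he hf hl hl1).2 (hsrc m hm))
  · obtain ⟨c, hc⟩ := hfw.leftCap
    obtain ⟨⟨⟨U, z, Ψ, hU, hm⟩, hmax⟩, hc0⟩ := hasLeftCap_neckMap he hf hl hl1 hc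
    have hneg := capProfile_one_neg hl hl1
    have hfd' := hfd.reflect
    refine ⟨c, ?_, fun m => ?_⟩
    · set V := planeReflection '' {w : ℂ | w.re < -capProfile l 1} with hV
      have hmV : (c + 1 : ℂ) ∈ V := by
        refine ⟨planeReflection (c + 1), ?_, planeReflection_planeReflection _⟩
        change (planeReflection (c + 1)).re < _
        rw [planeReflection_re]
        simp only [Complex.add_re, Complex.ofReal_re, Complex.one_re]
        linarith
      exact ⟨_, _, _, mem_image_of_mem (Diffeomorph.refl 𝓘(ℝ, ℂ) ℂ ∞)
          (show (c + 1 : ℂ) ∈ U ∩ V from ⟨hU, hmV⟩),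
        (hm.mono (hm.isOpen.inter hfd'.isOpen) inter_subset_left).transport hfd' inter_subset_right⟩
    · beta_reduce
      by_cases hmt : m ∈ j.target
      · rw [hFm m hmt]
        exact hmax _
      · have h1 := hoff m hmt
        rw [planeReflection_re]
        exact ⟨by linarith, fun h2 => absurd h2 (by linarith)⟩

end

/-- Connected sums of manifolds with capped Werther maps have capped Werther maps: the two maps,
one of them reflected, are opened into necks and glued. -/
theorem IsGluing.exists_isCappedWertherMap {M M₁ M₂ : Type u}
    [TopologicalSpace M] [ChartedSpace E3 M]
    [TopologicalSpace M₁] [ChartedSpace E3 M₁] [IsManifold (𝓡 3) ∞ M₁] [T2Space M₁]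
    [PreconnectedSpace M₁] [CompactSpace M₁]
    [TopologicalSpace M₂] [ChartedSpace E3 M₂] [IsManifold (𝓡 3) ∞ M₂] [T2Space M₂]
    [PreconnectedSpace M₂] [CompactSpace M₂]
    {e₁ : PartialEquiv E3 M₁} {e₂ : PartialEquiv E3 M₂} {j₁ : PartialEquiv M₁ M}
    {j₂ : PartialEquiv M₂ M} (h : IsGluing e₁ e₂ j₁ j₂) {f₁ : M₁ → ℂ} {f₂ : M₂ → ℂ}
    (hf₁ : IsCappedWertherMap f₁) (hf₂ : IsCappedWertherMap f₂) :
    ∃ f : M → ℂ, IsCappedWertherMap f := by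
  classical
  obtain ⟨μ, hμ0, hμ1, H⟩ := exists_isStandardOn.{u}
  obtain ⟨n₁, hn₁⟩ := H h.ball₁ hf₁
  obtain ⟨n₂, hn₂⟩ := H h.ball₂ hf₂
  obtain ⟨g₁, hg₁, hs₁⟩ := hn₁ (max (max n₁ n₂) 1) ((le_max_left _ _).trans (le_max_left _ _))
  obtain ⟨g₂, hg₂, hs₂⟩ := hn₂ (max (max n₁ n₂) 1) ((le_max_right _ _).trans (le_max_left _ _))
  have hl : 0 < μ ^ max (max n₁ n₂) 1 := pow_pos hμ0 _
  have hl1 : μ ^ max (max n₁ n₂) 1 < 1 :=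
    pow_lt_one₀ hμ0.le hμ1 (by have := le_max_right (max n₁ n₂) 1; omega)
  generalize μ ^ max (max n₁ n₂) 1 = l at hs₁ hs₂ hl hl1
  let F : M → ℂ := fun m => if m ∈ j₁.target then neckMap g₁ e₁ l (j₁.symm m) else
    planeReflection (neckMap g₂ e₂ l (j₂.symm m))
  have hF₁ : ∀ y, y ≠ e₁ 0 → F (j₁ y) = neckMap g₁ e₁ l y := by
    intro y hy
    have hys := h.mem_source.2 hy
    simp only [F, if_pos (j₁.map_source hys), j₁.left_inv hys]
  have hF₂ : ∀ y, y ≠ e₂ 0 → F (j₂ y) = planeReflection (neckMap g₂ e₂ l y) := by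
    intro y hy
    have hys := h.symm.mem_source.2 hy
    by_cases hm : j₂ y ∈ j₁.target
    · have hy' := h.mem_source.1 (j₁.map_target hm)
      have heq := j₁.right_inv hm
      obtain ⟨t, h0, h1, v, hv, hx, rfl⟩ := (h.eq_iff _ hy' _ hy).1 heq
      have hn : ‖t • v‖ = t := by rw [norm_smul, hv, mul_one, Real.norm_of_nonneg h0.le]
      have hn' : ‖(1 - t) • v‖ = 1 - t := by
        rw [norm_smul, hv, mul_one, Real.norm_of_nonneg (by linarith)]
      simp only [F, if_pos hm, hx]
      rw [neckMap_apply h.ball₁ (by linarith), neckMap_apply h.ball₂ (by linarith)]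
      apply Complex.ext
      · rw [planeReflection_re]
        simp only [neckValue, hn, hn', neckHeight_one_sub, neg_neg]
      · rw [planeReflection_im]
        have h1' : 1 - t ≠ 0 := by linarith
        simp only [neckValue, hn, hn', neckRadius_one_sub, PiLp.smul_apply, smul_eq_mul]
        rw [mul_div_cancel_left₀ _ h0.ne', mul_div_cancel_left₀ _ h1']
    · simp only [F, if_neg hm, j₂.left_inv hys]
  -- A point off the first piece lies in the second piece, off the embedded ball, where the map is
  -- to the right of the neck after the reflection.
  have hoff₁ : ∀ m ∉ j₁.target, -capProfile l 1 ≤ (F m).re := by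
    intro m hm
    have hm₂ : m ∈ j₂.target := ((h.cover ▸ mem_univ m : m ∈ j₁.target ∪ j₂.target)).resolve_left hm
    have hy := h.symm.mem_source.1 (j₂.map_target hm₂)
    have hFm : F m = planeReflection (neckMap g₂ e₂ l (j₂.symm m)) := by
      simp only [F, if_neg hm]
    rw [hFm, planeReflection_re, neg_le_neg_iff]
    refine neckMap_re_le hs₂ fun x hx hxy => hm ?_
    have hx0 : x ≠ 0 := by rintro rfl; exact hy hxy.symm
    obtain ⟨t, h0, h1, v, hv, htv, hxt, heq⟩ := h.apply_eq hx hx0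
    rw [← j₂.right_inv hm₂, ← hxy, heq]
    refine j₁.map_source (h.mem_source.2 fun h00 => htv ?_)
    have hn : ‖t • v‖ = t := by rw [norm_smul, hv, mul_one, Real.norm_of_nonneg h0.le]
    have := congrArg e₁.symm h00
    rwa [h.ball₁.left_inv (by linarith), h.ball₁.left_inv (by simp)] at this
  have hoff₂ : ∀ m ∉ j₂.target, -capProfile l 1 ≤ (planeReflection (F m)).re := by
    intro m hm
    have hm₁ : m ∈ j₁.target := ((h.cover ▸ mem_univ m : m ∈ j₁.target ∪ j₂.target)).resolve_right hm
    have hy := h.mem_source.1 (j₁.map_target hm₁)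
    have hFm : F m = neckMap g₁ e₁ l (j₁.symm m) := by
      simp only [F, if_pos hm₁]
    rw [hFm, planeReflection_re, neg_le_neg_iff]
    refine neckMap_re_le hs₁ fun x hx hxy => hm ?_
    have hx0 : x ≠ 0 := by rintro rfl; exact hy hxy.symm
    obtain ⟨t, h0, h1, v, hv, htv, hxt, heq⟩ := h.symm.apply_eq hx hx0
    rw [← j₁.right_inv hm₁, ← hxy, heq]
    refine j₂.map_source (h.symm.mem_source.2 fun h00 => htv ?_)
    have hn : ‖t • v‖ = t := by rw [norm_smul, hv, mul_one, Real.norm_of_nonneg h0.le]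
    have := congrArg e₂.symm h00
    rwa [h.ball₂.left_inv (by linarith), h.ball₂.left_inv (by simp)] at this
  obtain ⟨hd₁, hw₁, hc₁⟩ := isWertherAt_of_neck h.ball₁ h.isDiffeo₁ h.isOpen₁ hs₁ hg₁ hl hl1 hF₁
    hoff₁
  obtain ⟨hd₂, hw₂, c₂, hc₂⟩ := isWertherAt_of_neck (F := fun m => planeReflection (F m)) h.ball₂
    h.isDiffeo₂ h.isOpen₂ hs₂ hg₂ hl hl1
    (fun y hy => by rw [hF₂ y hy, planeReflection_planeReflection]) hoff₂
  have hFF : (fun m => planeReflection (planeReflection (F m))) = F := by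
    ext m
    rw [planeReflection_planeReflection]
  have hcover : ∀ m, m ∈ j₁.target ∨ m ∈ j₂.target := fun m => by
    rw [← mem_union, h.cover]; trivial
  refine ⟨F, fun m => ?_, fun m => ?_, ⟨c₂, ?_⟩, hc₁⟩
  · rcases hcover m with hm | hm
    · exact hd₁ m hm
    · rw [← hFF]
      exact planeReflection.contMDiff.contMDiffAt.comp m (hd₂ m hm)
  · rcases hcover m with hm | hm
    · exact hw₁ m hm
    · have := (hw₂ m hm).transport (isFiberDiffeo_comp _ planeReflection (Diffeomorph.refl _ _ _))
        (mem_univ _)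
      simp only [planeReflection_planeReflection, Diffeomorph.refl] at this
      exact this
  · have h1 : HasRightCap (fun m => planeReflection (planeReflection (F m))) c₂ := hc₂
    rwa [hFF] at h1

/-- `M` is compact and connected and has a capped Werther map. -/
structure HasCappedWertherMap (M : Type*) [TopologicalSpace M] [ChartedSpace E3 M] : Prop where
  compactSpace : CompactSpace M
  connectedSpace : ConnectedSpace M
  exists_map : ∃ f : M → ℂ, IsCappedWertherMap f

theorem HasCappedWertherMap.of_diffeomorph {M M' : Type*} [TopologicalSpace M] [ChartedSpace E3 M]
    [TopologicalSpace M'] [ChartedSpace E3 M'] (h : HasCappedWertherMap M)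
    (g : M' ≃ₘ^∞⟮𝓡 3, 𝓡 3⟯ M) : HasCappedWertherMap M' := by
  obtain ⟨h1, h2, f, hf⟩ := h
  exact ⟨g.symm.toHomeomorph.compactSpace,
    g.symm.surjective.connectedSpace g.symm.continuous, _, hf.comp_diffeomorph 0 g⟩

theorem HasCappedWertherMap.of_isOrientedConnectedSum {M M₁ M₂ : OrientedThreeManifold.{u}}
    (h₁ : HasCappedWertherMap M₁.carrier) (h₂ : HasCappedWertherMap M₂.carrier)
    (h : IsOrientedConnectedSum M M₁ M₂) : HasCappedWertherMap M.carrier := by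
  obtain ⟨e₁, e₂, j₁, j₂, he₁, ho₁, he₂, ho₂, -, -, hj₁, hjo₁, hj₂, hjo₂, -, -, hcover, heq⟩ := h
  have hg : IsGluing e₁ e₂ j₁ j₂ := ⟨⟨he₁, ho₁⟩, ⟨he₂, ho₂⟩, hj₁, hj₂, hjo₁, hjo₂, hcover, heq⟩
  obtain ⟨hc₁, hn₁, f₁, hf₁⟩ := h₁
  obtain ⟨hc₂, hn₂, f₂, hf₂⟩ := h₂
  exact ⟨hg.compactSpace, hg.connectedSpace, hg.exists_isCappedWertherMap hf₁ hf₂⟩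

/-! ### Smooth maps into spheres -/

section
variable {E : Type*} [NormedAddCommGroup E] [InnerProductSpace ℝ E] {n : ℕ}
  [Fact (Module.finrank ℝ E = n + 1)] {F : Type*} [NormedAddCommGroup F] [NormedSpace ℝ F]
  {H : Type*} [TopologicalSpace H] {I : ModelWithCorners ℝ F H} {N : Type*} [TopologicalSpace N]
  [ChartedSpace H N]

theorem contMDiffWithinAt_sphere_of_coe {f : N → sphere (0 : E) 1} {s : Set N} {x : N}
    (hf : ContMDiffWithinAt I 𝓘(ℝ, E) ∞ (fun y => (f y : E)) s x) :
    ContMDiffWithinAt I (𝓡 n) ∞ f s x := by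
  rw [contMDiffWithinAt_iff_target]
  refine ⟨(IsInducing.subtypeVal.continuousWithinAt_iff).2 hf.continuousWithinAt, ?_⟩
  set v := f x with hv
  have hopen : IsOpen {y : E | innerSL ℝ (-(v : E)) y ≠ (1 : ℝ)} :=
    isOpen_ne_fun (innerSL ℝ (-(v : E))).continuous continuous_const
  have hmem : (v : E) ∈ {y : E | innerSL ℝ (-(v : E)) y ≠ (1 : ℝ)} := by
    have h1 : ‖(v : E)‖ = 1 := norm_eq_of_mem_sphere v
    simp only [mem_ofPred_eq, innerSL_apply_apply, inner_neg_left, real_inner_self_eq_norm_sq, h1]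
    norm_num
  have h1 : ContDiffAt ℝ ∞ (stereoToFun (-(v : E))) v :=
    contDiffOn_stereoToFun.contDiffAt (hopen.mem_nhds hmem)
  let U : _ ≃ₗᵢ[ℝ] _ :=
    (OrthonormalBasis.fromOrthogonalSpanSingleton (𝕜 := ℝ)
      n (ne_zero_of_mem_unit_sphere (-v))).repr
  have h2 : ContDiffAt ℝ ∞ (fun y => U (stereoToFun (-(v : E)) y)) v :=
    U.contDiff.contDiffAt.comp _ h1
  exact ContMDiffAt.comp_contMDiffWithinAt x (g := fun y => U (stereoToFun (-(v : E)) y))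
    (f := fun y => (f y : E)) h2.contMDiffAt hf

theorem contMDiffOn_sphere_of_coe {f : N → sphere (0 : E) 1} {s : Set N}
    (hf : ContMDiffOn I 𝓘(ℝ, E) ∞ (fun y => (f y : E)) s) : ContMDiffOn I (𝓡 n) ∞ f s :=
  fun x hx => contMDiffWithinAt_sphere_of_coe (hf x hx)

end

theorem contMDiff_circle_coe : ContMDiff (𝓡 1) 𝓘(ℝ, ℂ) ∞ (fun u : Circle => (u : ℂ)) := by
  have := finrank_real_complex_fact'
  exact contMDiff_coe_sphere

theorem contMDiffOn_circle_of_coe {F : Type*} [NormedAddCommGroup F] [NormedSpace ℝ F]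
    {H : Type*} [TopologicalSpace H] {I : ModelWithCorners ℝ F H} {N : Type*} [TopologicalSpace N]
    [ChartedSpace H N] {f : N → Circle} {s : Set N}
    (hf : ContMDiffOn I 𝓘(ℝ, ℂ) ∞ (fun y => (f y : ℂ)) s) : ContMDiffOn I (𝓡 1) ∞ f s := by
  have := finrank_real_complex_fact'
  exact contMDiffOn_sphere_of_coe (E := ℂ) (f := f) hf

/-! ### Quotients of the sphere -/

namespace Sphere3

/-- The point of the sphere with the given coordinates. -/
def mk (w z : ℂ) (h : ‖w‖ ^ 2 + ‖z‖ ^ 2 = 1) : Sphere3 := ⟨!₂[w, z], by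
  rw [mem_sphere_zero_iff_norm, EuclideanSpace.norm_eq, Fin.sum_univ_two]
  simpa using h⟩

theorem norm_sq_add_norm_sq (x : Sphere3) : ‖x.1 0‖ ^ 2 + ‖x.1 1‖ ^ 2 = 1 := by
  have h := x.2
  rw [mem_sphere_zero_iff_norm, EuclideanSpace.norm_eq, Fin.sum_univ_two] at h
  simpa using h

theorem mk_zero_apply {w z : ℂ} (h : ‖w‖ ^ 2 + ‖z‖ ^ 2 = 1) : (mk w z h).1 0 = w := rfl

theorem mk_one_apply {w z : ℂ} (h : ‖w‖ ^ 2 + ‖z‖ ^ 2 = 1) : (mk w z h).1 1 = z := rfl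

theorem contMDiff_apply (i : Fin 2) : ContMDiff (𝓡 3) 𝓘(ℝ, ℂ) ∞ fun x : Sphere3 => x.1 i := by
  have h : ContDiff ℝ ∞ fun x : EuclideanSpace ℂ (Fin 2) => x i :=
    ((EuclideanSpace.proj i : EuclideanSpace ℂ (Fin 2) →L[ℂ] ℂ).restrictScalars ℝ).contDiff
  exact h.contMDiff.comp contMDiff_coe_sphere

theorem contMDiffOn_of_apply {F : Type*} [NormedAddCommGroup F] [NormedSpace ℝ F]
    {H : Type*} [TopologicalSpace H] {I : ModelWithCorners ℝ F H} {N : Type*} [TopologicalSpace N]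
    [ChartedSpace H N] {f : N → Sphere3} {s : Set N}
    (h0 : ContMDiffOn I 𝓘(ℝ, ℂ) ∞ (fun y => (f y).1 0) s)
    (h1 : ContMDiffOn I 𝓘(ℝ, ℂ) ∞ (fun y => (f y).1 1) s) :
    ContMDiffOn I (𝓡 3) ∞ f s := by
  refine contMDiffOn_sphere_of_coe ?_
  have h : ContDiff ℝ ∞ fun p : ℂ × ℂ => (!₂[p.1, p.2] : EuclideanSpace ℂ (Fin 2)) := by
    refine (PiLp.contDiff_toLp (𝕜 := ℝ) (p := 2)).comp (contDiff_pi.2 fun i => ?_)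
    fin_cases i
    · exact contDiff_fst
    · exact contDiff_snd
  refine (h.contMDiff.comp_contMDiffOn (h0.prodMk_space h1)).congr fun y _ => ?_
  ext i
  fin_cases i <;> rfl

end Sphere3

/-- `π` exhibits `M` as the smooth quotient of the `3`-sphere by the action of `μ_p` given by
`q`. -/
structure IsSphereQuotient {M : Type*} [TopologicalSpace M] [ChartedSpace E3 M] (p q : ℕ)
    (π : Sphere3 → M) : Prop where
  pos : p ≠ 0
  coprime : p.Coprime q
  contMDiff : ContMDiff (𝓡 3) (𝓡 3) ∞ π
  surjective : Function.Surjective π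
  exists_section : ∀ m, ∃ σ : M → Sphere3, ContMDiffAt (𝓡 3) (𝓡 3) ∞ σ m ∧
    ∀ᶠ m' in 𝓝 m, π (σ m') = m'
  eq_iff : ∀ x y, π x = π y ↔ ∃ ξ : ℂ, ξ ^ p = 1 ∧ y.1 0 = ξ * x.1 0 ∧ y.1 1 = ξ ^ q * x.1 1

theorem isSphereQuotient_id : IsSphereQuotient 1 0 (id : Sphere3 → Sphere3) where
  pos := one_ne_zero
  coprime := Nat.coprime_one_left 0
  contMDiff := contMDiff_id
  surjective := Function.surjective_id
  exists_section m := ⟨id, contMDiffAt_id, Filter.Eventually.of_forall fun _ => rfl⟩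
  eq_iff x y := by
    constructor
    · rintro rfl
      exact ⟨1, by simp⟩
    · rintro ⟨ξ, h, h0, h1⟩
      rw [pow_one] at h
      subst h
      apply Subtype.ext
      ext i
      fin_cases i
      · simpa using h0.symm
      · simpa using h1.symm

theorem IsSphereQuotient.comp_diffeomorph {M M' : Type*} [TopologicalSpace M] [ChartedSpace E3 M]
    [TopologicalSpace M'] [ChartedSpace E3 M'] {p q : ℕ} {π : Sphere3 → M}
    (h : IsSphereQuotient p q π) (g : M' ≃ₘ^∞⟮𝓡 3, 𝓡 3⟯ M) :
    IsSphereQuotient p q (fun x => g.symm (π x)) where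
  pos := h.pos
  coprime := h.coprime
  contMDiff := g.symm.contMDiff.comp h.contMDiff
  surjective := g.symm.surjective.comp h.surjective
  exists_section m := by
    obtain ⟨σ, hσ, hπ⟩ := h.exists_section (g m)
    refine ⟨fun m' => σ (g m'), hσ.comp m g.contMDiff.contMDiffAt, ?_⟩
    filter_upwards [g.continuous.continuousAt.eventually hπ] with m' hm'
    rw [hm', g.symm_apply_apply]
  eq_iff x y := by
    have h1 : g.symm (π x) = g.symm (π y) ↔ π x = π y := g.symm.injective.eq_iff
    rw [h1]
    exact h.eq_iff x y

theorem contMDiff_smul_sphere {p q : ℕ} [NeZero p] (ξ : Mu p q) :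
    ContMDiff (𝓡 3) (𝓡 3) ∞ fun x : Sphere3 => ξ • x := by
  rw [← contMDiffOn_univ]
  refine Sphere3.contMDiffOn_of_apply ?_ ?_
  · have h : ContDiff ℝ ∞ fun w : ℂ => ξ.val * w := contDiff_const.mul contDiff_id
    exact (h.contMDiff.comp (Sphere3.contMDiff_apply 0)).contMDiffOn
  · have h : ContDiff ℝ ∞ fun w : ℂ => ξ.val ^ q * w := contDiff_const.mul contDiff_id
    exact (h.contMDiff.comp (Sphere3.contMDiff_apply 1)).contMDiffOn

/-- The local sections required by `IsSphereQuotient` are the local inverses of the projection that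
define the charts of the lens space. -/
theorem isSphereQuotient_lensSpace (p q : ℕ) [NeZero p] [hpq : Fact (p.Coprime q)] :
    IsSphereQuotient p q (Quotient.mk _ : Sphere3 → LensSpace p q) := by
  have hloc : IsLocalHomeomorph (Quotient.mk _ : Sphere3 → LensSpace p q) :=
    (isQuotientCoveringMap_quotientMk_of_properlyDiscontinuousSMul (G := Mu p q)
      (E := Sphere3)).isCoveringMap.isLocalHomeomorph
  have hsurj : Function.Surjective (Quotient.mk _ : Sphere3 → LensSpace p q) :=
    Quotient.mk_surjective
  set π : Sphere3 → LensSpace p q := Quotient.mk _ with hπ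
  obtain ⟨g, hg, hchart⟩ : ∃ g : LensSpace p q → Sphere3, (∀ m, π (g m) = m) ∧
      ∀ m, chartAt E3 m = (hloc.localInverseAt (g m)).trans (chartAt E3 (g m)) :=
    ⟨_, hsurj.hasRightInverse.choose_spec, fun m => rfl⟩
  have hrel : ∀ x y : Sphere3, π x = π y ↔ ∃ ξ : Mu p q, ξ • y = x := fun x y => Quotient.eq
  have hinv : ∀ (ξ : Mu p q) (x : Sphere3), π (ξ • x) = π x := fun ξ x => (hrel _ _).2 ⟨ξ, rfl⟩
  -- The local inverse at `y` inverts the projection near `y`.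
  have hleft : ∀ y : Sphere3, ∀ᶠ x in 𝓝 y, hloc.localInverseAt y (π x) = x := by
    intro y
    filter_upwards [(hloc.localInverseAt y).open_target.mem_nhds hloc.self_mem_localInverseAt_target]
      with x hx
    have := (hloc.localInverseAt y).right_inv hx
    rwa [hloc.localInverseAt_symm] at this
  refine ⟨NeZero.ne p, hpq.out, fun x => ?_, hsurj, fun m => ?_, fun x y => ?_⟩
  · rw [contMDiffAt_iff_target]
    refine ⟨hloc.continuous.continuousAt, ?_⟩
    obtain ⟨ξ, hξ⟩ := (hrel _ _).1 (hg (π x))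
    have h1 : ContMDiffAt (𝓡 3) 𝓘(ℝ, E3) ∞ (fun x' => extChartAt (𝓡 3) (g (π x)) (ξ • x')) x := by
      have h2 : ContMDiffAt (𝓡 3) 𝓘(ℝ, E3) ∞ (extChartAt (𝓡 3) (g (π x))) (ξ • x) := by
        rw [hξ]
        exact contMDiffAt_extChartAt
      exact h2.comp x (contMDiff_smul_sphere ξ).contMDiffAt
    refine h1.congr_of_eventuallyEq ?_
    have h3 := ((contMDiff_smul_sphere ξ).continuous.tendsto x).eventually (hξ ▸ hleft (g (π x)))
    filter_upwards [h3] with x' hx'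
    rw [hinv] at hx'
    rw [Function.comp_apply]
    change chartAt E3 (π x) (π x') = chartAt E3 (g (π x)) (ξ • x')
    rw [hchart, OpenPartialHomeomorph.trans_apply]
    rw [← hx', hξ]
  · refine ⟨hloc.localInverseAt (g m), ?_, ?_⟩
    · rw [contMDiffAt_iff_source]
      have hT : ContMDiffWithinAt 𝓘(ℝ, E3) (𝓡 3) ∞ (extChartAt (𝓡 3) (g m)).symm (range (𝓡 3))
          (extChartAt (𝓡 3) (g m) (g m)) :=
        contMDiffWithinAt_extChartAt_symm_range (g m) (mem_extChartAt_target (g m))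
      have hpt : extChartAt (𝓡 3) m m = extChartAt (𝓡 3) (g m) (g m) := by
        change chartAt E3 m m = chartAt E3 (g m) (g m)
        rw [hchart, OpenPartialHomeomorph.trans_apply]
        congr 1
        exact (congrArg _ (hg m)).symm.trans (hloc.localInverseAt_apply_self)
      rw [hpt]
      refine hT.congr_of_eventuallyEq_of_mem ?_ ?_
      · have hc : Filter.Tendsto (extChartAt (𝓡 3) (g m)).symm
            (𝓝[range (𝓡 3)] (extChartAt (𝓡 3) (g m) (g m))) (𝓝 (g m)) := by
          have := (continuousAt_extChartAt_symm (I := 𝓡 3) (g m)).tendsto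
          rw [extChartAt_to_inv] at this
          exact this.mono_left nhdsWithin_le_nhds
        filter_upwards [hc.eventually (hleft (g m))] with y hy
        rw [Function.comp_apply]
        refine Eq.trans (congrArg _ ?_) hy
        change (chartAt E3 m).symm y = π ((chartAt E3 (g m)).symm y)
        rw [hchart, OpenPartialHomeomorph.coe_trans_symm, hloc.localInverseAt_symm]
        rfl
      · exact mem_range_self _
    · have h := hloc.apply_self_mem_localInverseAt_source (x := g m)
      rw [hg] at h
      filter_upwards [(hloc.localInverseAt (g m)).open_source.mem_nhds h] with m' hm'
      exact hloc.apply_localInverseAt_of_mem hm'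
  · rw [eq_comm, hrel]
    constructor
    · rintro ⟨ξ, rfl⟩
      exact ⟨ξ.val, ξ.val_pow, rfl, rfl⟩
    · rintro ⟨ξ, hξ, h0, h1⟩
      let ζ : Mu p q := rootsOfUnity.mkOfPowEq (M := ℂ) (n := p) ξ hξ
      have hζ : ζ.val = ξ := rfl
      refine ⟨ζ, ?_⟩
      apply Subtype.ext
      ext i
      fin_cases i
      · exact h0.symm
      · exact h1.symm

/-! ### Capped Werther maps on lens spaces -/

theorem fderiv_one_sub_norm_sq_ne_zero {w : ℂ} (hw : w ≠ 0) :
    fderiv ℝ (fun w : ℂ => 1 - ‖w‖ ^ 2) w ≠ 0 := by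
  intro hd
  have hdiff : DifferentiableAt ℝ (fun w : ℂ => 1 - ‖w‖ ^ 2) w :=
    (contDiff_const.sub (contDiff_norm_sq ℝ)).contDiffAt.differentiableAt (n := 1) (by simp)
  have h1 := hdiff.hasFDerivAt
  rw [hd] at h1
  have hγ : HasDerivAt (fun s : ℝ => (s : ℂ) * w) w 1 := by
    simpa using (Complex.ofRealCLM.hasDerivAt (x := 1)).mul_const w
  have h1' : HasFDerivAt (fun w : ℂ => 1 - ‖w‖ ^ 2) (0 : ℂ →L[ℝ] ℝ) (((1 : ℝ) : ℂ) * w) := by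
    simpa using h1
  have h2 := HasFDerivAt.comp_hasDerivAt (x := (1 : ℝ)) (l := fun w : ℂ => 1 - ‖w‖ ^ 2) h1' hγ
  have h3 : HasDerivAt (fun s : ℝ => 1 - s ^ 2 * ‖w‖ ^ 2) (-(2 * ‖w‖ ^ 2)) 1 := by
    simpa using (((hasDerivAt_id (1 : ℝ)).pow 2).mul_const (‖w‖ ^ 2)).const_sub 1
  have h4 : ((fun w : ℂ => 1 - ‖w‖ ^ 2) ∘ fun s : ℝ => (s : ℂ) * w) =
      fun s : ℝ => 1 - s ^ 2 * ‖w‖ ^ 2 := by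
    ext s
    simp [mul_pow]
  rw [h4] at h2
  have h5 := h3.unique h2
  have h6 := norm_pos_iff.2 hw
  simp at h5
  exact hw h5

theorem fderiv_ne_zero_of_mul {κ ρ σ : ℂ → ℝ} {w : ℂ} (hκ : DifferentiableAt ℝ κ w)
    (hρ : DifferentiableAt ℝ ρ w) (h0 : ρ w = 0) (he : (fun v => κ v * ρ v) =ᶠ[𝓝 w] σ)
    (hσ : fderiv ℝ σ w ≠ 0) : fderiv ℝ ρ w ≠ 0 := by
  intro hd
  apply hσ
  rw [← he.fderiv_eq, fderiv_fun_mul hκ hρ, h0, hd, smul_zero, zero_smul, add_zero]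

/-- A map to the unit disc that looks like the projection of the sphere near `1` and `-1` is
capped. -/
theorem hasCap_of_norm_le_one {M : Type*} [TopologicalSpace M] [ChartedSpace E3 M] {f : M → ℂ}
    (hle : ∀ x, ‖f x‖ ≤ 1)
    (h1 : ∃ U z Ψ, (1 : ℂ) ∈ U ∧ IsCircleModel f U (fun w => 1 - ‖w‖ ^ 2) z Ψ)
    (h2 : ∃ U z Ψ, (-1 : ℂ) ∈ U ∧ IsCircleModel f U (fun w => 1 - ‖w‖ ^ 2) z Ψ) :
    HasRightCap f 0 ∧ HasLeftCap f 0 := by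
  have hmax : ∀ w : ℂ, ‖w‖ ≤ 1 → w.re ≤ 0 + 1 ∧ (w.re = 0 + 1 → w = ((0 : ℝ) : ℂ) + 1) := by
    intro w hw
    refine ⟨by linarith [Complex.re_le_norm w], fun h => ?_⟩
    have h3 := Complex.norm_sq_eq_re_add_im w
    have h4 : ‖w‖ ^ 2 ≤ 1 := pow_le_one₀ (norm_nonneg _) hw
    have h5 : w.im = 0 := by
      rw [h] at h3
      nlinarith [sq_nonneg w.im]
    apply Complex.ext <;> simp [h, h5]
  obtain ⟨U₁, z₁, Ψ₁, hU₁, hm₁⟩ := h1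
  obtain ⟨U₂, z₂, Ψ₂, hU₂, hm₂⟩ := h2
  refine ⟨⟨⟨U₁, z₁, Ψ₁, by simpa using hU₁, hm₁.congr fun w _ => by simp⟩,
    fun x => hmax _ (hle x)⟩, ⟨⟨_, _, _, ?_, (hm₂.transport (isFiberDiffeo_comp f planeReflection
      (Diffeomorph.refl _ _ _)) (subset_univ _)).congr fun w _ => ?_⟩, fun x => hmax _ ?_⟩⟩
  · exact ⟨-1, hU₂, by simp [planeReflection_apply]⟩
  · change 1 - ‖w - ((0 : ℝ) : ℂ)‖ ^ 2 = 1 - ‖planeReflection w‖ ^ 2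
    simp [planeReflection_apply]
  · change ‖planeReflection (f x)‖ ≤ 1
    rw [planeReflection_apply, norm_neg, Complex.norm_conj]
    exact hle x

/-- Near a nonzero complex number there is a smooth `p`-th root. -/
theorem exists_smooth_root {p : ℕ} (hp : p ≠ 0) {P : ℂ} (hP : P ≠ 0) :
    ∃ (U : Set ℂ) (r : ℂ → ℂ), IsOpen U ∧ P ∈ U ∧ (0 : ℂ) ∉ U ∧ ContDiffOn ℝ ∞ r U ∧
      ∀ y ∈ U, r y ^ p = y := by
  obtain ⟨a, ha⟩ := IsAlgClosed.exists_pow_nat_eq P (Nat.pos_of_ne_zero hp)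
  have hpC : (p : ℂ) ≠ 0 := by exact_mod_cast hp
  refine ⟨{y | y / P ∈ Complex.slitPlane}, fun y => a * Complex.exp (Complex.log (y / P) / p),
    Complex.isOpen_slitPlane.preimage (continuous_id.div_const P), ?_, ?_, ?_, ?_⟩
  · simp [div_self hP]
  · simp
  · have h1 : ContDiffOn ℂ ∞ (fun y : ℂ => a * Complex.exp (Complex.log (y / P) / p))
        {y | y / P ∈ Complex.slitPlane} := by
      intro y hy
      have h2 : ContDiffAt ℂ ∞ Complex.log (y / P) := Complex.contDiffAt_log hy
      have h3 : ContDiffAt ℂ ∞ (fun y : ℂ => Complex.log (y / P)) y :=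
        h2.comp y (contDiffAt_id.div_const P)
      exact (contDiffAt_const.mul ((h3.div_const (p : ℂ)).cexp)).contDiffWithinAt
    exact h1.restrict_scalars ℝ
  · intro y hy
    have hy0 : y / P ≠ 0 := Complex.slitPlane_ne_zero hy
    rw [mul_pow, ha, ← Complex.exp_nat_mul, mul_div_cancel₀ _ hpC, Complex.exp_log hy0,
      mul_div_cancel₀ _ hP]

namespace Sphere3

open Classical in
/-- The point of the sphere with the given coordinates, and a junk value if there is none. -/
noncomputable def ofCoords (w z : ℂ) : Sphere3 :=
  if h : ‖w‖ ^ 2 + ‖z‖ ^ 2 = 1 then mk w z h else mk 1 0 (by simp)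

theorem ofCoords_zero_apply {w z : ℂ} (h : ‖w‖ ^ 2 + ‖z‖ ^ 2 = 1) : (ofCoords w z).1 0 = w := by
  rw [ofCoords, dif_pos h, mk_zero_apply]

theorem ofCoords_one_apply {w z : ℂ} (h : ‖w‖ ^ 2 + ‖z‖ ^ 2 = 1) : (ofCoords w z).1 1 = z := by
  rw [ofCoords, dif_pos h, mk_one_apply]

theorem contMDiffOn_ofCoords {F : Type*} [NormedAddCommGroup F] [NormedSpace ℝ F]
    {H : Type*} [TopologicalSpace H] {I : ModelWithCorners ℝ F H} {N : Type*} [TopologicalSpace N]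
    [ChartedSpace H N] {g h : N → ℂ} {s : Set N} (hg : ContMDiffOn I 𝓘(ℝ, ℂ) ∞ g s)
    (hh : ContMDiffOn I 𝓘(ℝ, ℂ) ∞ h s) (hs : ∀ y ∈ s, ‖g y‖ ^ 2 + ‖h y‖ ^ 2 = 1) :
    ContMDiffOn I (𝓡 3) ∞ (fun y => ofCoords (g y) (h y)) s :=
  contMDiffOn_of_apply (hg.congr fun y hy => ofCoords_zero_apply (hs y hy))
    (hh.congr fun y hy => ofCoords_one_apply (hs y hy))

end Sphere3

/-- The direction of a nonzero complex number. -/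
noncomputable def circlePart (w : ℂ) : Circle := Circle.exp w.arg

theorem norm_mul_circlePart (w : ℂ) : (‖w‖ : ℂ) * circlePart w = w := by
  rw [circlePart, Circle.coe_exp, Complex.norm_mul_exp_arg_mul_I]

theorem circlePart_coe {w : ℂ} (hw : w ≠ 0) : (circlePart w : ℂ) = w / ‖w‖ := by
  have h : (‖w‖ : ℂ) ≠ 0 := by exact_mod_cast norm_ne_zero_iff.2 hw
  rw [eq_div_iff h, mul_comm, norm_mul_circlePart]

theorem circlePart_mul {ξ w : ℂ} (hξ : ‖ξ‖ = 1) (hw : w ≠ 0) :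
    (circlePart (ξ * w) : ℂ) = ξ * circlePart w := by
  have hξ0 : ξ ≠ 0 := by rw [← norm_pos_iff, hξ]; norm_num
  rw [circlePart_coe (mul_ne_zero hξ0 hw), circlePart_coe hw, norm_mul, hξ, one_mul, mul_div_assoc]

theorem contDiffOn_circlePart : ContDiffOn ℝ ∞ (fun w : ℂ => (circlePart w : ℂ)) {0}ᶜ := by
  have h : ContDiffOn ℝ ∞ (fun w : ℂ => w / (‖w‖ : ℂ)) {0}ᶜ := by
    have hn : ContDiffOn ℝ ∞ (fun w : ℂ => ‖w‖) {0}ᶜ := fun w hw =>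
      (contDiffAt_norm ℝ hw).contDiffWithinAt
    have hn' : ContDiffOn ℝ ∞ (fun w : ℂ => (‖w‖ : ℂ)) {0}ᶜ :=
      Complex.ofRealCLM.contDiff.comp_contDiffOn hn
    simp only [div_eq_mul_inv]
    refine contDiffOn_id.mul (hn'.inv fun w hw => ?_)
    simpa using hw
  exact h.congr fun w hw => circlePart_coe hw

theorem circle_mul_conj (u : Circle) : (u : ℂ) * (starRingEnd ℂ) u = 1 := by
  rw [Complex.mul_conj, Circle.normSq_coe, Complex.ofReal_one]

theorem mul_conj_of_norm_eq_one {ξ : ℂ} (hξ : ‖ξ‖ = 1) : ξ * (starRingEnd ℂ) ξ = 1 := by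
  rw [Complex.mul_conj, Complex.normSq_eq_norm_sq, hξ]; simp

namespace IsSphereQuotient

variable {M : Type*} [TopologicalSpace M] [ChartedSpace E3 M] {p q : ℕ} {π : Sphere3 → M}

theorem norm_root (h : IsSphereQuotient p q π) {ξ : ℂ} (hξ : ξ ^ p = 1) : ‖ξ‖ = 1 :=
  Complex.norm_eq_one_of_pow_eq_one hξ h.pos

/-- The function on the quotient induced by an invariant function on the sphere. -/
noncomputable def lift {Y : Type*} (h : IsSphereQuotient p q π) (F : Sphere3 → Y) (m : M) : Y :=
  F (Function.surjInv h.surjective m)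

theorem lift_apply {Y : Type*} (h : IsSphereQuotient p q π) {F : Sphere3 → Y} {x : Sphere3}
    (hF : ∀ y, π x = π y → F y = F x) : h.lift F (π x) = F x :=
  hF _ (Function.surjInv_eq h.surjective (π x)).symm

theorem contMDiffAt_lift (h : IsSphereQuotient p q π) {F : Sphere3 → ℂ} {x : Sphere3}
    (hF : ∀ᶠ m in 𝓝 (π x), ∀ x y, π x = m → π y = m → F y = F x)
    (hs : ∀ y, π x = π y → ContMDiffAt (𝓡 3) 𝓘(ℝ, ℂ) ∞ F y) :
    ContMDiffAt (𝓡 3) 𝓘(ℝ, ℂ) ∞ (h.lift F) (π x) := by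
  obtain ⟨σ, hσ, hπ⟩ := h.exists_section (π x)
  refine ((hs (σ (π x)) hπ.self_of_nhds.symm).comp _ hσ).congr_of_eventuallyEq ?_
  filter_upwards [hF, hπ] with m hm hm'
  exact hm _ _ hm' (Function.surjInv_eq h.surjective m)

/-- The map `(w, z) ↦ w ^ p`. -/
noncomputable def powMap (h : IsSphereQuotient p q π) : M → ℂ := h.lift fun x => x.1 0 ^ p

theorem powMap_apply (h : IsSphereQuotient p q π) (x : Sphere3) : h.powMap (π x) = x.1 0 ^ p := by
  refine h.lift_apply fun y hy => ?_
  obtain ⟨ξ, hξ, h0, -⟩ := (h.eq_iff _ _).1 hy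
  rw [h0, mul_pow, hξ, one_mul]

theorem contMDiff_powMap (h : IsSphereQuotient p q π) :
    ContMDiff (𝓡 3) 𝓘(ℝ, ℂ) ∞ h.powMap := by
  intro m
  obtain ⟨x, rfl⟩ := h.surjective m
  refine h.contMDiffAt_lift (Filter.Eventually.of_forall fun m x y hx hy => ?_) fun y _ => ?_
  · rw [← h.powMap_apply, ← h.powMap_apply, hx, hy]
  · have h1 : ContDiff ℝ ∞ fun w : ℂ => w ^ p := contDiff_id.pow p
    exact (h1.contMDiff.comp (Sphere3.contMDiff_apply 0)).contMDiffAt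

/-- Away from the circle `w = 0`, the quotient is the circle model with fibre coordinate
`z (w / |w|) ^ (-q)`. -/
theorem isCircleModel (h : IsSphereQuotient p q π) {U : Set ℂ} {r : ℂ → ℂ} (hU : IsOpen U)
    (hU0 : (0 : ℂ) ∉ U) (hr : ContDiffOn ℝ ∞ r U) (hrp : ∀ y ∈ U, r y ^ p = y) :
    ∃ z Ψ, IsCircleModel h.powMap U (fun P => 1 - ‖P‖ ^ 2) z Ψ := by
  have hr0 : ∀ y ∈ U, r y ≠ 0 := by
    intro y hy h0
    have := hrp y hy
    rw [h0, zero_pow h.pos] at this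
    exact hU0 (this ▸ hy)
  let κ : ℂ → ℝ := fun P => ∑ i ∈ Finset.range p, (‖r P‖ ^ 2) ^ i
  have hrsq : ContDiffOn ℝ ∞ (fun P => ‖r P‖ ^ 2) U := (contDiff_norm_sq ℝ).comp_contDiffOn hr
  have hκ : ContDiffOn ℝ ∞ κ U := ContDiffOn.sum fun i _ => hrsq.pow i
  have hκpos : ∀ P ∈ U, 0 < κ P := fun P hP =>
    Finset.sum_pos (fun i _ => pow_pos (pow_pos (norm_pos_iff.2 (hr0 P hP)) 2) i)
      ⟨0, Finset.mem_range.2 (Nat.pos_of_ne_zero h.pos)⟩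
  have hκρ : ∀ P ∈ U, κ P * (1 - ‖r P‖ ^ 2) = 1 - ‖P‖ ^ 2 := by
    intro P hP
    have h1 := geom_sum_mul (‖r P‖ ^ 2) p
    have h2 : (‖r P‖ ^ 2) ^ p = ‖P‖ ^ 2 := by
      rw [← pow_mul, mul_comm, pow_mul, ← norm_pow, hrp P hP]
    rw [h2] at h1
    linarith
  let Z : Sphere3 → ℂ := fun x => x.1 1 * (starRingEnd ℂ) (circlePart (x.1 0)) ^ q
  have hZinv : ∀ x y : Sphere3, x.1 0 ≠ 0 → π x = π y → Z y = Z x := by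
    intro x y hx hxy
    obtain ⟨ξ, hξ, h0, h1⟩ := (h.eq_iff _ _).1 hxy
    have hn := h.norm_root hξ
    have h2 : ξ ^ q * (starRingEnd ℂ) ξ ^ q = 1 := by
      rw [← mul_pow, mul_conj_of_norm_eq_one hn, one_pow]
    simp only [Z, h0, h1]
    rw [circlePart_mul hn hx, map_mul, mul_pow]
    linear_combination (x.1 1 * (starRingEnd ℂ) (circlePart (x.1 0)) ^ q) * h2
  have hw0 : ∀ x, h.powMap (π x) ∈ U → x.1 0 ≠ 0 := by
    intro x hx h0
    rw [h.powMap_apply, h0, zero_pow h.pos] at hx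
    exact hU0 hx
  have hZapply : ∀ x, x.1 0 ≠ 0 → h.lift Z (π x) = Z x := fun x hx =>
    h.lift_apply fun y hy => hZinv x y hx hy
  have hZnorm : ∀ x, ‖Z x‖ = ‖x.1 1‖ := fun x => by
    simp [Z, Circle.norm_coe]
  have hrnorm : ∀ x, h.powMap (π x) ∈ U → ‖r (h.powMap (π x))‖ = ‖x.1 0‖ := by
    intro x hx
    have h1 := congrArg norm (hrp _ hx)
    nth_rewrite 2 [h.powMap_apply] at h1
    rw [norm_pow, norm_pow] at h1
    exact (pow_left_inj₀ (norm_nonneg _) (norm_nonneg _) h.pos).1 h1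
  let g : ℂ × ℂ → ℂ := fun x => x.2 * circlePart (r x.1) ^ q
  have hg : ∀ x : ℂ × ℂ, ‖x.2‖ ^ 2 = 1 - ‖r x.1‖ ^ 2 → ‖r x.1‖ ^ 2 + ‖g x‖ ^ 2 = 1 := by
    intro x hx
    simp [g, Circle.norm_coe, hx]
  have hmodel : IsCircleModel h.powMap U (fun P => 1 - ‖r P‖ ^ 2) (h.lift Z)
      (fun x => π (Sphere3.ofCoords (r x.1) (g x))) := by
    refine ⟨hU, contDiffOn_const.sub hrsq, ?_, ?_, ?_, ?_, ?_, ?_, ?_⟩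
    · intro P hP h0
      have hnhds := hU.mem_nhds hP
      refine fderiv_ne_zero_of_mul ((hκ.contDiffAt hnhds).differentiableAt (by simp))
        (((contDiffOn_const.sub hrsq).contDiffAt hnhds).differentiableAt (by simp)) h0 ?_
        (fderiv_one_sub_norm_sq_ne_zero fun hP0 => hU0 (hP0 ▸ hP))
      filter_upwards [hnhds] with v hv using hκρ v hv
    · intro m hm
      obtain ⟨x, rfl⟩ := h.surjective m
      have hx := hw0 x hm
      refine (h.contMDiffAt_lift ?_ fun y hy => ?_).contMDiffWithinAt
      · have : h.powMap ⁻¹' U ∈ 𝓝 (π x) :=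
          (hU.preimage h.contMDiff_powMap.continuous).mem_nhds hm
        filter_upwards [this] with m hm
        rintro x y rfl hxy
        exact hZinv x y (hw0 x hm) hxy.symm
      · have hy0 : y.1 0 ≠ 0 := hw0 y (hy ▸ hm)
        have h1 : ContDiffAt ℝ ∞ (fun w : ℂ => (starRingEnd ℂ) (circlePart w) ^ q) (y.1 0) :=
          (Complex.conjCLE.contDiff.contDiffAt.comp _
            (contDiffOn_circlePart.contDiffAt (isOpen_compl_singleton.mem_nhds hy0))).pow q
        have h2 : ContMDiffAt (𝓡 3) 𝓘(ℝ, ℂ) ∞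
            (fun y : Sphere3 => (starRingEnd ℂ) (circlePart (y.1 0)) ^ q) y :=
          ContMDiffAt.comp y (g := fun w : ℂ => (starRingEnd ℂ) (circlePart w) ^ q)
            h1.contMDiffAt (Sphere3.contMDiff_apply 0).contMDiffAt
        have h3 : ContDiff ℝ ∞ fun x : ℂ × ℂ => x.1 * x.2 := contDiff_fst.mul contDiff_snd
        exact h3.contMDiff.contMDiffAt.comp y
          ((Sphere3.contMDiff_apply 1).contMDiffAt.prodMk_space h2)
    · refine h.contMDiff.comp_contMDiffOn (Sphere3.contMDiffOn_ofCoords ?_ ?_ ?_)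
      · exact (hr.comp contDiff_fst.contDiffOn fun x hx => hx.1).contMDiffOn
      · refine ContDiffOn.contMDiffOn (contDiffOn_snd.mul (ContDiffOn.pow ?_ q))
        exact contDiffOn_circlePart.comp (hr.comp contDiff_fst.contDiffOn fun x hx => hx.1)
          fun x hx => hr0 _ hx.1
      · exact fun x hx => hg x hx.2
    · intro m hm
      obtain ⟨x, rfl⟩ := h.surjective m
      have := x.norm_sq_add_norm_sq
      rw [hZapply x (hw0 x hm), hZnorm, hrnorm x hm]
      linarith
    · intro m hm
      obtain ⟨x, rfl⟩ := h.surjective m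
      have hx := hw0 x hm
      have hsq := x.norm_sq_add_norm_sq
      have hn := hrnorm x hm
      have hsum : ‖r (h.powMap (π x))‖ ^ 2 + ‖g (h.powMap (π x), h.lift Z (π x))‖ ^ 2 = 1 := by
        refine hg (h.powMap (π x), h.lift Z (π x)) ?_
        simp only
        rw [hZapply x hx, hZnorm, hn]
        linarith
      -- The chosen root differs from `w` by a root of unity.
      set ξ := r (h.powMap (π x)) / x.1 0 with hξdef
      have hξ : ξ ^ p = 1 := by
        rw [hξdef, div_pow, hrp _ hm, h.powMap_apply, div_self (pow_ne_zero _ hx)]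
      have hrξ : r (h.powMap (π x)) = ξ * x.1 0 := by rw [hξdef, div_mul_cancel₀ _ hx]
      refine ((h.eq_iff _ _).2 ⟨ξ, hξ, ?_, ?_⟩).symm
      · rw [Sphere3.ofCoords_zero_apply hsum, hrξ]
      · rw [Sphere3.ofCoords_one_apply hsum]
        simp only [g]
        rw [hZapply x hx, hrξ, circlePart_mul (h.norm_root hξ) hx]
        have h2 : (circlePart (x.1 0) : ℂ) ^ q * (starRingEnd ℂ) (circlePart (x.1 0)) ^ q = 1 := by
          rw [← mul_pow, circle_mul_conj, one_pow]
        simp only [Z, mul_pow]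
        linear_combination (x.1 1 * ξ ^ q) * h2
    · intro P hP ζ hζ
      rw [h.powMap_apply, Sphere3.ofCoords_zero_apply (hg (P, ζ) hζ), hrp P hP]
    · intro P hP ζ hζ
      have hsum := hg (P, ζ) hζ
      have h0 := Sphere3.ofCoords_zero_apply hsum
      have h1 := Sphere3.ofCoords_one_apply hsum
      rw [hZapply _ (by rw [h0]; exact hr0 P hP)]
      simp only [Z]
      rw [h0, h1]
      have h2 : (circlePart (r P) : ℂ) ^ q * (starRingEnd ℂ) (circlePart (r P)) ^ q = 1 := by
        rw [← mul_pow, circle_mul_conj, one_pow]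
      simp only [g]
      linear_combination ζ * h2
  exact ⟨_, _, (hmodel.rescale h.contMDiff_powMap hκ hκpos).congr fun P hP => (hκρ P hP).symm⟩

set_option maxHeartbeats 400000 in
/-- Over the centre of the disc there is a multiple fibre. -/
theorem isSeifertAt_zero (h : IsSphereQuotient p q π) : IsSeifertAt h.powMap 0 := by
  intro V hV
  obtain ⟨δ₀, hδ₀, hball⟩ := Metric.nhds_basis_closedBall.mem_iff.1 hV
  obtain ⟨δ, hδ, hδ1, hδV⟩ : ∃ δ : ℝ, 0 < δ ∧ δ < 1 ∧ closedBall (0 : ℂ) (δ ^ p) ⊆ V := by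
    refine ⟨min δ₀ (1 / 2), lt_min hδ₀ (by norm_num), (min_le_right _ _).trans_lt (by norm_num),
      (closedBall_subset_closedBall ?_).trans hball⟩
    refine (pow_le_of_le_one (by positivity) ?_ h.pos).trans (min_le_left _ _)
    exact (min_le_right _ _).trans (by norm_num)
  obtain ⟨b, hb⟩ : ∃ b : ℕ, q * b ≡ 1 [MOD p] := by
    rcases Nat.lt_or_ge 1 p with hp | hp
    · obtain ⟨b, -, hb⟩ := Nat.exists_mul_mod_eq_one_of_coprime h.coprime.symm hp
      exact ⟨b, hb.trans (Nat.mod_eq_of_lt hp).symm⟩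
    · have hp1 : p = 1 := le_antisymm hp (Nat.pos_of_ne_zero h.pos)
      exact ⟨0, hp1 ▸ Nat.modEq_one⟩
  have hbp : p.Coprime b := by
    have h1 : p.Coprime (q * b) := by
      have := hb.gcd_eq
      rw [Nat.gcd_one_left] at this
      exact Nat.coprime_comm.1 this
    exact h1.coprime_mul_left_right
  have hroot : ∀ ξ : ℂ, ξ ^ p = 1 → ξ ^ (q * b) = ξ := by
    intro ξ hξ
    have h1 : ξ ^ (q * b) = ξ ^ 1 := pow_eq_pow_of_modEq hb hξ
    rwa [pow_one] at h1
  have hδp : 0 < δ ^ p := pow_pos hδ p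
  have hδC : (δ : ℂ) ≠ 0 := by exact_mod_cast hδ.ne'
  let u : Sphere3 → Circle := fun x => circlePart (x.1 1) ^ p
  let Z : Sphere3 → ℂ := fun x => (δ : ℂ)⁻¹ * (x.1 0 * (starRingEnd ℂ) (circlePart (x.1 1)) ^ b)
  have hinv : ∀ x y : Sphere3, x.1 1 ≠ 0 → π x = π y → u y = u x ∧ Z y = Z x := by
    intro x y hx hxy
    obtain ⟨ξ, hξ, h0, h1⟩ := (h.eq_iff _ _).1 hxy
    have hn : ‖ξ ^ q‖ = 1 := by rw [norm_pow, h.norm_root hξ, one_pow]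
    constructor
    · apply Circle.ext
      simp only [u, Circle.coe_pow, h1]
      rw [circlePart_mul hn hx, mul_pow, ← pow_mul, mul_comm q p, pow_mul, hξ, one_pow, one_mul]
    · have h2 := mul_conj_of_norm_eq_one hn
      have h3 : (ξ ^ q) ^ b * (starRingEnd ℂ) (ξ ^ q) ^ b = 1 := by rw [← mul_pow, h2, one_pow]
      rw [← pow_mul, hroot ξ hξ] at h3
      simp only [Z, h0, h1]
      rw [circlePart_mul hn hx, map_mul, mul_pow]
      linear_combination ((δ : ℂ)⁻¹ * x.1 0 * (starRingEnd ℂ) (circlePart (x.1 1)) ^ b) * h3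
  have hmem : ∀ x, h.powMap (π x) ∈ closedBall (0 : ℂ) (δ ^ p) ↔ ‖x.1 0‖ ≤ δ := by
    intro x
    rw [mem_closedBall_zero_iff, h.powMap_apply, norm_pow,
      pow_le_pow_iff_left₀ (norm_nonneg _) hδ.le h.pos]
  have hz0 : ∀ x : Sphere3, ‖x.1 0‖ ≤ δ → x.1 1 ≠ 0 := by
    intro x hx h0
    have h1 := x.norm_sq_add_norm_sq
    rw [h0, norm_zero] at h1
    nlinarith [norm_nonneg (x.1 0)]
  have hu : ∀ x, ‖x.1 0‖ ≤ δ → h.lift u (π x) = u x := fun x hx =>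
    h.lift_apply fun y hy => (hinv x y (hz0 x hx) hy).1
  have hZ : ∀ x, ‖x.1 0‖ ≤ δ → h.lift Z (π x) = Z x := fun x hx =>
    h.lift_apply fun y hy => (hinv x y (hz0 x hx) hy).2
  have hZn : ∀ x, ‖Z x‖ = δ⁻¹ * ‖x.1 0‖ := fun x => by
    simp [Z, Circle.norm_coe, abs_of_pos hδ]
  -- The inverse, in terms of a `p`-th root `v` of the first coordinate.
  let s : ℂ → ℝ := fun y => √(1 - δ ^ 2 * ‖y‖ ^ 2)
  let G : ℂ → ℂ → Sphere3 := fun v y => Sphere3.ofCoords (δ * y * v ^ b) (s y * v)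
  have hspos : ∀ y : ℂ, ‖y‖ ≤ 1 → 0 < 1 - δ ^ 2 * ‖y‖ ^ 2 := by
    intro y hy
    have h1 : ‖y‖ ^ 2 ≤ 1 := pow_le_one₀ (norm_nonneg _) hy
    have h2 : δ ^ 2 < 1 := pow_lt_one₀ hδ.le hδ1 two_ne_zero
    nlinarith [sq_nonneg δ]
  have hsn : ∀ y : ℂ, ‖(s y : ℂ)‖ = s y := fun y => by
    rw [Complex.norm_real, Real.norm_of_nonneg (Real.sqrt_nonneg _)]
  have hsum : ∀ v y : ℂ, ‖v‖ = 1 → ‖y‖ ≤ 1 →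
      ‖(δ : ℂ) * y * v ^ b‖ ^ 2 + ‖(s y : ℂ) * v‖ ^ 2 = 1 := by
    intro v y hv hy
    rw [norm_mul, norm_mul, norm_mul, norm_pow, hv, hsn, Complex.norm_real,
      Real.norm_of_nonneg hδ.le, mul_one, one_pow, mul_one, Real.sq_sqrt (hspos y hy).le]
    ring
  have hG0 : ∀ v y : ℂ, ‖v‖ = 1 → ‖y‖ ≤ 1 → (G v y).1 0 = δ * y * v ^ b := fun v y hv hy =>
    Sphere3.ofCoords_zero_apply (hsum v y hv hy)
  have hG1 : ∀ v y : ℂ, ‖v‖ = 1 → ‖y‖ ≤ 1 → (G v y).1 1 = s y * v := fun v y hv hy =>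
    Sphere3.ofCoords_one_apply (hsum v y hv hy)
  have hnorm : ∀ (a : Circle) (v : ℂ), v ^ p = a → ‖v‖ = 1 := by
    intro a v hv
    have h1 := congrArg norm hv
    rw [norm_pow, Circle.norm_coe] at h1
    exact (pow_eq_one_iff_of_nonneg (norm_nonneg v) h.pos).1 h1
  have hGeq : ∀ (a : Circle) (v v' y : ℂ), v ^ p = a → v' ^ p = a → ‖y‖ ≤ 1 →
      π (G v y) = π (G v' y) := by
    intro a v v' y hv hv' hy
    have hn := hnorm a v hv
    have hn' := hnorm a v' hv'
    have hv0 : v ≠ 0 := by rw [← norm_pos_iff, hn]; norm_num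
    have hη : (v' / v) ^ p = 1 := by
      rw [div_pow, hv, hv', div_self a.coe_ne_zero]
    have hηv : v' = v' / v * v := by rw [div_mul_cancel₀ _ hv0]
    refine (h.eq_iff _ _).2 ⟨(v' / v) ^ b, ?_, ?_, ?_⟩
    · rw [← pow_mul, mul_comm b p, pow_mul, hη, one_pow]
    · rw [hG0 _ _ hn hy, hG0 _ _ hn' hy]
      nth_rewrite 1 [hηv]
      rw [mul_pow]
      ring
    · rw [hG1 _ _ hn hy, hG1 _ _ hn' hy, ← pow_mul, mul_comm b q, hroot _ hη]
      nth_rewrite 1 [hηv]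
      ring
  choose v hv using fun a : Circle => IsAlgClosed.exists_pow_nat_eq (a : ℂ) (Nat.pos_of_ne_zero h.pos)
  have hGu : ∀ (a : Circle) (y : ℂ), ‖y‖ ≤ 1 → ‖(G (v a) y).1 0‖ ≤ δ := by
    intro a y hy
    rw [hG0 _ _ (hnorm a _ (hv a)) hy, norm_mul, norm_mul, norm_pow, hnorm a _ (hv a), one_pow,
      mul_one, Complex.norm_real, Real.norm_of_nonneg hδ.le]
    exact mul_le_of_le_one_right hδ.le hy
  let Φ : PartialEquiv M (Circle × ℂ) :=
    { toFun := fun m => (h.lift u m, h.lift Z m)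
      invFun := fun x => π (G (v x.1) x.2)
      source := h.powMap ⁻¹' closedBall (0 : ℂ) (δ ^ p)
      target := {x : Circle × ℂ | x.2 ∈ closedBall (0 : ℂ) 1}
      map_source' := by
        intro m hm
        obtain ⟨x, rfl⟩ := h.surjective m
        have hx := (hmem x).1 hm
        change h.lift Z (π x) ∈ closedBall (0 : ℂ) 1
        rw [hZ x hx, mem_closedBall_zero_iff, hZn, inv_mul_le_one₀ hδ]
        exact hx
      map_target' := by
        intro x hx
        exact (hmem _).2 (hGu _ _ (mem_closedBall_zero_iff.1 hx))
      left_inv' := by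
        intro m hm
        obtain ⟨x, rfl⟩ := h.surjective m
        have hx := (hmem x).1 hm
        have hy : ‖Z x‖ ≤ 1 := by
          rw [hZn, inv_mul_le_one₀ hδ]
          exact hx
        simp only
        rw [hu x hx, hZ x hx, hGeq (u x) _ (circlePart (x.1 1)) _ (hv _) (by simp [u]) hy]
        congr 1
        have hc := circle_mul_conj (circlePart (x.1 1))
        apply Subtype.ext
        ext i
        fin_cases i
        · refine (hG0 _ _ (Circle.norm_coe _) hy).trans ?_
          have h2 : (starRingEnd ℂ) (circlePart (x.1 1)) ^ b * (circlePart (x.1 1) : ℂ) ^ b = 1 := by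
            rw [← mul_pow, mul_comm, hc, one_pow]
          simp only [Z]
          rw [← mul_assoc, mul_inv_cancel₀ hδC, one_mul, mul_assoc, h2, mul_one]
          rfl
        · refine (hG1 _ _ (Circle.norm_coe _) hy).trans ?_
          have h2 : s (Z x) = ‖x.1 1‖ := by
            have h3 := x.norm_sq_add_norm_sq
            have h4 : 1 - δ ^ 2 * ‖Z x‖ ^ 2 = ‖x.1 1‖ ^ 2 := by
              rw [hZn, mul_pow, ← mul_assoc, ← mul_pow, mul_inv_cancel₀ hδ.ne']
              linarith
            simp only [s]
            rw [h4, Real.sqrt_sq (norm_nonneg _)]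
          rw [h2]
          exact norm_mul_circlePart _
      right_inv' := by
        rintro ⟨a, y⟩ hy
        have hy : ‖y‖ ≤ 1 := mem_closedBall_zero_iff.1 hy
        have hn := hnorm a _ (hv a)
        have hs : 0 < s y := Real.sqrt_pos.2 (hspos y hy)
        have hsC : (s y : ℂ) ≠ 0 := by exact_mod_cast hs.ne'
        have hvn : v a ≠ 0 := by rw [← norm_pos_iff, hn]; norm_num
        have hc : (circlePart ((G (v a) y).1 1) : ℂ) = v a := by
          rw [hG1 _ _ hn hy, circlePart_coe (mul_ne_zero hsC hvn), norm_mul, hsn, hn, mul_one,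
            mul_div_cancel_left₀ _ hsC]
        simp only
        rw [hu _ (hGu a y hy), hZ _ (hGu a y hy)]
        refine Prod.ext (Circle.ext ?_) ?_
        · simp only [u, Circle.coe_pow, hc, hv a]
        · have h2 : v a ^ b * (starRingEnd ℂ) (v a) ^ b = 1 := by
            rw [← mul_pow, mul_conj_of_norm_eq_one hn, one_pow]
          simp only [Z, hc, hG0 _ _ hn hy]
          rw [mul_assoc, h2, mul_one, inv_mul_cancel_left₀ hδC] }
  let φ : PartialEquiv ℂ ℂ :=
    { toFun := fun w => ((δ ^ p : ℝ) : ℂ)⁻¹ * w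
      invFun := fun w => ((δ ^ p : ℝ) : ℂ) * w
      source := closedBall 0 (δ ^ p)
      target := closedBall 0 1
      map_source' := by
        intro w hw
        rw [mem_closedBall_zero_iff] at hw ⊢
        rwa [norm_mul, norm_inv, Complex.norm_real, Real.norm_of_nonneg hδp.le, inv_mul_le_one₀ hδp]
      map_target' := by
        intro w hw
        rw [mem_closedBall_zero_iff] at hw ⊢
        rw [norm_mul, Complex.norm_real, Real.norm_of_nonneg hδp.le]
        exact mul_le_of_le_one_right hδp.le hw
      left_inv' := fun w _ => mul_inv_cancel_left₀ (by exact_mod_cast hδp.ne') w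
      right_inv' := fun w _ => inv_mul_cancel_left₀ (by exact_mod_cast hδp.ne') w }
  have hcs : ∀ (F : Sphere3 → ℂ), (∀ x y : Sphere3, x.1 1 ≠ 0 → π x = π y → F y = F x) →
      (∀ x : Sphere3, x.1 1 ≠ 0 → ContMDiffAt (𝓡 3) 𝓘(ℝ, ℂ) ∞ F x) →
      ContMDiffOn (𝓡 3) 𝓘(ℝ, ℂ) ∞ (h.lift F) (h.powMap ⁻¹' closedBall (0 : ℂ) (δ ^ p)) := by
    intro F hF hFs m hm
    obtain ⟨x, rfl⟩ := h.surjective m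
    have hlt : ∀ y, ‖h.powMap (π y)‖ < 1 → y.1 1 ≠ 0 := by
      intro y hy h0
      have h1 := y.norm_sq_add_norm_sq
      rw [h0, norm_zero] at h1
      rw [h.powMap_apply, norm_pow] at hy
      have h2 : ‖y.1 0‖ = 1 := by nlinarith [norm_nonneg (y.1 0)]
      rw [h2, one_pow] at hy
      exact lt_irrefl _ hy
    have hm1 : ‖h.powMap (π x)‖ < 1 :=
      (mem_closedBall_zero_iff.1 hm).trans_lt (pow_lt_one₀ hδ.le hδ1 h.pos)
    refine (h.contMDiffAt_lift ?_ fun y hy => hFs y ?_).contMDiffWithinAt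
    · filter_upwards [(isOpen_lt h.contMDiff_powMap.continuous.norm continuous_const).mem_nhds hm1]
        with m hm
      rintro x y rfl hxy
      exact hF x y (hlt x hm) hxy.symm
    · exact hlt y (hy ▸ hm1)
  have hzs : ∀ x : Sphere3, x.1 1 ≠ 0 →
      ContMDiffAt (𝓡 3) 𝓘(ℝ, ℂ) ∞ (fun x : Sphere3 => (circlePart (x.1 1) : ℂ)) x := fun x hx =>
    ContMDiffAt.comp x (g := fun w : ℂ => (circlePart w : ℂ))
      (contDiffOn_circlePart.contDiffAt (isOpen_compl_singleton.mem_nhds hx)).contMDiffAt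
      (Sphere3.contMDiff_apply 1).contMDiffAt
  refine ⟨closedBall 0 (δ ^ p), hδV, closedBall_mem_nhds 0 hδp, isClosed_closedBall, p, b, h.pos, hbp,
    Φ, φ, ⟨rfl, rfl, ?_, ?_⟩, ⟨rfl, rfl, ?_, ?_⟩, ?_⟩
  · have h1 : ContMDiffOn (𝓡 3) 𝓘(ℝ, ℂ) ∞ (h.lift fun x => (u x : ℂ))
        (h.powMap ⁻¹' closedBall (0 : ℂ) (δ ^ p)) := by
      refine hcs _ (fun x y hx hxy => by rw [(hinv x y hx hxy).1]) fun x hx => ?_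
      have h2 : ContDiff ℝ ∞ fun w : ℂ => w ^ p := contDiff_id.pow p
      exact h2.contMDiff.contMDiffAt.comp x (hzs x hx)
    have h2 : ContMDiffOn (𝓡 3) 𝓘(ℝ, ℂ) ∞ (h.lift Z)
        (h.powMap ⁻¹' closedBall (0 : ℂ) (δ ^ p)) := by
      refine hcs _ (fun x y hx hxy => (hinv x y hx hxy).2) fun x hx => ?_
      have h3 : ContDiff ℝ ∞ fun x : ℂ × ℂ => (δ : ℂ)⁻¹ * (x.1 * (starRingEnd ℂ) x.2 ^ b) :=
        contDiff_const.mul (contDiff_fst.mul ((Complex.conjCLE.contDiff.comp contDiff_snd).pow b))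
      exact h3.contMDiff.contMDiffAt.comp x
        ((Sphere3.contMDiff_apply 0).contMDiffAt.prodMk_space (hzs x hx))
    exact (contMDiffOn_circle_of_coe h1).prodMk h2
  · rintro ⟨a, y⟩ hay
    obtain ⟨W, r, hW, haW, -, hr, hrp⟩ := exists_smooth_root h.pos a.coe_ne_zero
    have hopen : IsOpen {x : Circle × ℂ | (x.1 : ℂ) ∈ W} :=
      hW.preimage (contMDiff_circle_coe.continuous.comp continuous_fst)
    let A : Set (Circle × ℂ) := {x | x.2 ∈ closedBall (0 : ℂ) 1} ∩ {x | (x.1 : ℂ) ∈ W}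
    have hs : ContMDiffOn ((𝓡 1).prod 𝓘(ℝ, ℂ)) (𝓡 3) ∞ (fun x : Circle × ℂ => π (G (r x.1) x.2))
        A := by
      have hfst : ContMDiffOn ((𝓡 1).prod 𝓘(ℝ, ℂ)) 𝓘(ℝ, ℂ) ∞ (fun x : Circle × ℂ => r x.1) A :=
        hr.contMDiffOn.comp (contMDiff_circle_coe.comp contMDiff_fst).contMDiffOn fun x hx => hx.2
      have hsnd : ContMDiffOn ((𝓡 1).prod 𝓘(ℝ, ℂ)) 𝓘(ℝ, ℂ) ∞ (fun x : Circle × ℂ => x.2) A :=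
        contMDiff_snd.contMDiffOn
      have hpair := hfst.prodMk_space hsnd
      have hms : MapsTo (fun x : Circle × ℂ => (r x.1, x.2)) A {x : ℂ × ℂ | ‖x.2‖ ≤ 1} :=
        fun x hx => mem_closedBall_zero_iff.1 hx.1
      refine h.contMDiff.comp_contMDiffOn (Sphere3.contMDiffOn_ofCoords ?_ ?_ ?_)
      · have h1 : ContDiff ℝ ∞ fun x : ℂ × ℂ => (δ : ℂ) * x.2 * x.1 ^ b :=
          (contDiff_const.mul contDiff_snd).mul (contDiff_fst.pow b)
        exact h1.contMDiff.comp_contMDiffOn hpair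
      · have h1 : ContDiffOn ℝ ∞ (fun x : ℂ × ℂ => (s x.2 : ℂ) * x.1) {x : ℂ × ℂ | ‖x.2‖ ≤ 1} := by
          have h2 : ContDiffOn ℝ ∞ (fun x : ℂ × ℂ => s x.2) {x : ℂ × ℂ | ‖x.2‖ ≤ 1} :=
            (contDiff_const.sub (contDiff_const.mul
              ((contDiff_norm_sq ℝ).comp contDiff_snd))).contDiffOn.sqrt fun x hx =>
                (hspos x.2 hx).ne'
          exact (Complex.ofRealCLM.contDiff.comp_contDiffOn h2).mul contDiffOn_fst
        have h3 : ContMDiffOn ((𝓡 1).prod 𝓘(ℝ, ℂ)) 𝓘(ℝ, ℂ) ∞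
            ((fun x : ℂ × ℂ => (s x.2 : ℂ) * x.1) ∘ fun x : Circle × ℂ => (r x.1, x.2)) A :=
          ContMDiffOn.comp h1.contMDiffOn hpair fun x hx => hms hx
        exact h3
      · exact fun x hx => hsum _ _ (hnorm x.1 _ (hrp _ hx.2)) (mem_closedBall_zero_iff.1 hx.1)
    have hA : ContMDiffWithinAt ((𝓡 1).prod 𝓘(ℝ, ℂ)) (𝓡 3) ∞ Φ.symm A (a, y) := by
      refine (hs (a, y) ⟨hay, haW⟩).congr (fun x hx => ?_) ?_
      · exact hGeq x.1 _ _ _ (hv _) (hrp _ hx.2) (mem_closedBall_zero_iff.1 hx.1)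
      · exact hGeq a _ _ _ (hv _) (hrp _ haW) (mem_closedBall_zero_iff.1 hay)
    exact (contMDiffWithinAt_inter (hopen.mem_nhds haW)).1 hA
  · exact (contDiff_const.mul contDiff_id).contMDiff.contMDiffOn
  · exact (contDiff_const.mul contDiff_id).contMDiff.contMDiffOn
  · intro m hm
    obtain ⟨x, rfl⟩ := h.surjective m
    have hx := (hmem x).1 hm
    change ((δ ^ p : ℝ) : ℂ)⁻¹ * h.powMap (π x) =
      ((h.lift u (π x) : Circle) : ℂ) ^ b * h.lift Z (π x) ^ p
    rw [hu x hx, hZ x hx, h.powMap_apply]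
    simp only [u, Z, Circle.coe_pow]
    have h2 : ((circlePart (x.1 1) : ℂ) ^ p) ^ b * ((starRingEnd ℂ) (circlePart (x.1 1)) ^ b) ^ p =
        1 := by
      rw [← pow_mul, ← pow_mul, mul_comm b p, ← mul_pow, circle_mul_conj, one_pow]
    rw [mul_pow, mul_pow, inv_pow, Complex.ofReal_pow]
    linear_combination (-((δ : ℂ) ^ p)⁻¹ * x.1 0 ^ p) * h2

/-- The map `(w, z) ↦ w ^ p` has a multiple fibre over `0` and is a circle model elsewhere, with
the unit circle as the image of the fold. -/
theorem isCappedWertherMap_powMap (h : IsSphereQuotient p q π) : IsCappedWertherMap h.powMap := by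
  have hmodel : ∀ P : ℂ, P ≠ 0 → ∃ U z Ψ, P ∈ U ∧
      IsCircleModel h.powMap U (fun w => 1 - ‖w‖ ^ 2) z Ψ := by
    intro P hP
    obtain ⟨U, r, hU, hPU, hU0, hr, hrp⟩ := exists_smooth_root h.pos hP
    obtain ⟨z, Ψ, hm⟩ := h.isCircleModel hU hU0 hr hrp
    exact ⟨U, z, Ψ, hPU, hm⟩
  have hcap := hasCap_of_norm_le_one (f := h.powMap) (fun m => by
    obtain ⟨x, rfl⟩ := h.surjective m
    have h1 := x.norm_sq_add_norm_sq
    rw [h.powMap_apply, norm_pow]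
    refine pow_le_one₀ (norm_nonneg _) ?_
    nlinarith [norm_nonneg (x.1 0), sq_nonneg ‖x.1 1‖]) (hmodel 1 one_ne_zero)
    (hmodel (-1) (neg_ne_zero.2 one_ne_zero))
  refine ⟨h.contMDiff_powMap, fun m => ?_, ⟨0, hcap.1⟩, ⟨0, hcap.2⟩⟩
  by_cases hm : h.powMap m = 0
  · rw [hm]
    exact Or.inr h.isSeifertAt_zero
  · obtain ⟨U, z, Ψ, hP, hm⟩ := hmodel _ hm
    exact Or.inl ⟨U, _, z, Ψ, hP, hm⟩

theorem hasCappedWertherMap (h : IsSphereQuotient p q π) : HasCappedWertherMap M := by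
  have hrank : 1 < Module.rank ℝ (EuclideanSpace ℂ (Fin 2)) := by
    rw [← Module.finrank_eq_rank, (finrank_real_complexPlane).out]
    norm_num
  have : ConnectedSpace Sphere3 :=
    isConnected_iff_connectedSpace.1 (isConnected_sphere hrank 0 zero_le_one)
  refine ⟨⟨?_⟩, h.surjective.connectedSpace h.contMDiff.continuous, _, h.isCappedWertherMap_powMap⟩
  rw [← h.surjective.range_eq]
  exact isCompact_range h.contMDiff.continuous

end IsSphereQuotient

theorem IsLensSpace.hasCappedWertherMap {M : OrientedThreeManifold.{u}} (h : IsLensSpace M) :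
    HasCappedWertherMap M.carrier := by
  obtain ⟨p, q, _, _, -, -, ⟨g⟩⟩ := h
  exact ((isSphereQuotient_lensSpace p q).comp_diffeomorph g).hasCappedWertherMap

theorem hasCappedWertherMap_of_diffeomorph_sphere {M : Type*} [TopologicalSpace M]
    [ChartedSpace E3 M] (g : M ≃ₘ^∞⟮𝓡 3, 𝓡 3⟯ Sphere3) : HasCappedWertherMap M :=
  isSphereQuotient_id.hasCappedWertherMap.of_diffeomorph g

/-! ### A capped Werther map on the product of the circle and the sphere -/

namespace Sphere2

theorem sum_sq (x : Sphere2) : x.1 0 ^ 2 + x.1 1 ^ 2 + x.1 2 ^ 2 = 1 := by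
  have h := E3.norm_sq x.1
  rw [norm_eq_of_mem_sphere x] at h
  linarith

open Classical in
/-- The point of the `2`-sphere with first coordinate `s` and remaining coordinates `ζ`, and a junk
value if there is none. -/
noncomputable def ofCoords (s : ℝ) (ζ : ℂ) : Sphere2 :=
  if h : s ^ 2 + ‖ζ‖ ^ 2 = 1 then ⟨!₂[s, ζ.re, ζ.im], by
    rw [mem_sphere_zero_iff_norm, ← sq_eq_sq₀ (norm_nonneg _) zero_le_one, E3.norm_sq]
    rw [Complex.norm_sq_eq_re_add_im] at h
    simp
    linarith⟩
  else ⟨EuclideanSpace.single 0 1, by simp⟩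

theorem ofCoords_coe {s : ℝ} {ζ : ℂ} (h : s ^ 2 + ‖ζ‖ ^ 2 = 1) :
    ((ofCoords s ζ : Sphere2) : E3) = !₂[s, ζ.re, ζ.im] := by
  rw [ofCoords, dif_pos h]

end Sphere2

theorem hasCappedWertherMap_of_diffeomorph_circle_prod_sphere {M : Type*} [TopologicalSpace M]
    [ChartedSpace E3 M] (g : M ≃ₘ^∞⟮𝓡 3, (𝓡 1).prod (𝓡 2)⟯ Circle × Sphere2) :
    HasCappedWertherMap M := by
  have : Fact (Module.finrank ℝ E3 = 2 + 1) := ⟨finrank_euclideanSpace_fin⟩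
  let c : ℝ → ℝ := fun s => (2 + s) / 3
  let f : M → ℂ := fun m => (c ((g m).2.1 0) : ℂ) * (g m).1
  let z : M → ℂ := fun m => ⟨(g m).2.1 1, (g m).2.1 2⟩
  have hbound : ∀ m, -1 ≤ (g m).2.1 0 ∧ (g m).2.1 0 ≤ 1 := by
    intro m
    have h := Sphere2.sum_sq (g m).2
    constructor <;> nlinarith [sq_nonneg ((g m).2.1 1), sq_nonneg ((g m).2.1 2)]
  have hcpos : ∀ m, 0 < c ((g m).2.1 0) := fun m => by
    simp only [c]
    linarith [(hbound m).1]
  have hnorm : ∀ m, ‖f m‖ = c ((g m).2.1 0) := fun m => by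
    simp only [f]
    rw [norm_mul, Circle.norm_coe, mul_one, Complex.norm_real, Real.norm_of_nonneg (hcpos m).le]
  have hf0 : ∀ m, f m ≠ 0 := fun m => by
    rw [← norm_pos_iff, hnorm]
    exact hcpos m
  have hcoord : ∀ m, 3 * ‖f m‖ - 2 = (g m).2.1 0 := fun m => by
    rw [hnorm]
    simp only [c]
    ring
  have hpart : ∀ m, circlePart (f m) = (g m).1 := by
    intro m
    apply Circle.ext
    have h0 : (c ((g m).2.1 0) : ℂ) ≠ 0 := by exact_mod_cast (hcpos m).ne'
    rw [circlePart_coe (hf0 m), hnorm]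
    simp only [f]
    rw [mul_div_cancel_left₀ _ h0]
  have hv : ContMDiff (𝓡 3) 𝓘(ℝ, E3) ∞ fun m => ((g m).2 : E3) :=
    contMDiff_coe_sphere.comp (contMDiff_snd.comp g.contMDiff)
  have hfs : ContMDiff (𝓡 3) 𝓘(ℝ, ℂ) ∞ f := by
    have h1 : ContDiff ℝ ∞ fun x : E3 × ℂ => (c (x.1 0) : ℂ) * x.2 := by
      refine (Complex.ofRealCLM.contDiff.comp ?_).mul contDiff_snd
      exact (contDiff_const.add ((contDiff_E3_apply 0).comp contDiff_fst)).div_const 3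
    exact h1.contMDiff.comp
      (hv.prodMk_space (contMDiff_circle_coe.comp (contMDiff_fst.comp g.contMDiff)))
  have hzs : ContMDiff (𝓡 3) 𝓘(ℝ, ℂ) ∞ z := by
    have h1 : ContDiff ℝ ∞ fun x : E3 => (⟨x 1, x 2⟩ : ℂ) :=
      contDiffOn_univ.1 (contDiff_complexMk (contDiff_E3_apply 1).contDiffOn
        (contDiff_E3_apply 2).contDiffOn)
    exact h1.contMDiff.comp hv
  let ρ : ℂ → ℝ := fun w => 1 - (3 * ‖w‖ - 2) ^ 2
  let Ψ : ℂ × ℂ → M := fun x => g.symm (circlePart x.1, Sphere2.ofCoords (3 * ‖x.1‖ - 2) x.2)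
  have hns : ContDiffOn ℝ ∞ (fun w : ℂ => ‖w‖) {0}ᶜ := fun w hw =>
    (contDiffAt_norm ℝ hw).contDiffWithinAt
  have hts : ContDiffOn ℝ ∞ (fun w : ℂ => 3 * ‖w‖ - 2) {0}ᶜ :=
    (contDiffOn_const.mul hns).sub contDiffOn_const
  have hsum : ∀ x : ℂ × ℂ, ‖x.2‖ ^ 2 = ρ x.1 → (3 * ‖x.1‖ - 2) ^ 2 + ‖x.2‖ ^ 2 = 1 := by
    intro x hx
    rw [hx]
    simp only [ρ]
    ring
  have hmodel : IsCircleModel f {0}ᶜ ρ z Ψ := by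
    refine ⟨isOpen_compl_singleton, contDiffOn_const.sub (hts.pow 2), ?_, hzs.contMDiffOn, ?_,
      ?_, ?_, ?_, ?_⟩
    · -- The derivative in the radial direction does not vanish.
      intro w hw h0 hd
      have hdiff : DifferentiableAt ℝ ρ w :=
        ((contDiffOn_const.sub (hts.pow 2)).contDiffAt
          (isOpen_compl_singleton.mem_nhds hw)).differentiableAt (n := ∞) (by simp)
      have h1 := hdiff.hasFDerivAt
      rw [hd] at h1
      have hγ : HasDerivAt (fun s : ℝ => (s : ℂ) * w) w 1 := by
        simpa using (Complex.ofRealCLM.hasDerivAt (x := 1)).mul_const w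
      have h1' : HasFDerivAt ρ (0 : ℂ →L[ℝ] ℝ) (((1 : ℝ) : ℂ) * w) := by simpa using h1
      have h2 := HasFDerivAt.comp_hasDerivAt (x := (1 : ℝ)) (l := ρ) h1' hγ
      have h3 : HasDerivAt (fun s : ℝ => 1 - (3 * (s * ‖w‖) - 2) ^ 2)
          (-(2 * (3 * ‖w‖ - 2) * (3 * ‖w‖))) 1 := by
        simpa using (((((hasDerivAt_id (1 : ℝ)).mul_const ‖w‖).const_mul 3).sub_const 2).pow
          2).const_sub 1
      have h4 : (ρ ∘ fun s : ℝ => (s : ℂ) * w) =ᶠ[𝓝 1]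
          fun s : ℝ => 1 - (3 * (s * ‖w‖) - 2) ^ 2 := by
        filter_upwards [lt_mem_nhds zero_lt_one] with s hs
        simp [ρ, abs_of_pos hs]
      have h5 := h3.unique (h2.congr_of_eventuallyEq h4.symm)
      have h6 : 0 < ‖w‖ := norm_pos_iff.2 hw
      rw [zero_apply, neg_eq_zero, mul_eq_zero, mul_eq_zero] at h5
      simp only [ρ] at h0
      rcases h5 with (h5 | h5) | h5
      · norm_num at h5
      · rw [h5] at h0; norm_num at h0
      · linarith
    · refine g.symm.contMDiff.comp_contMDiffOn (ContMDiffOn.prodMk ?_ ?_)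
      · refine contMDiffOn_circle_of_coe (ContDiffOn.contMDiffOn ?_)
        exact contDiffOn_circlePart.comp contDiffOn_fst fun x hx => hx.1
      · refine contMDiffOn_sphere_of_coe ?_
        have h1 : ContDiffOn ℝ ∞ (fun x : ℂ × ℂ => (!₂[3 * ‖x.1‖ - 2, x.2.re, x.2.im] : E3))
            {x : ℂ × ℂ | x.1 ∈ ({0}ᶜ : Set ℂ) ∧ ‖x.2‖ ^ 2 = ρ x.1} := by
          rw [contDiffOn_euclidean]
          intro i
          fin_cases i
          · exact hts.comp contDiffOn_fst fun x hx => hx.1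
          · exact (Complex.reCLM.contDiff.comp contDiff_snd).contDiffOn
          · exact (Complex.imCLM.contDiff.comp contDiff_snd).contDiffOn
        exact h1.contMDiffOn.congr fun x hx => Sphere2.ofCoords_coe (hsum x hx.2)
    · intro m _
      have h1 := Sphere2.sum_sq (g m).2
      simp only [ρ, z]
      rw [hcoord, Complex.norm_sq_eq_re_add_im]
      linarith
    · intro m _
      have h1 := Sphere2.sum_sq (g m).2
      have h2 : (g m).2.1 0 ^ 2 + ‖z m‖ ^ 2 = 1 := by
        simp only [z]
        rw [Complex.norm_sq_eq_re_add_im]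
        linarith
      have h3 : (circlePart (f m), Sphere2.ofCoords (3 * ‖f m‖ - 2) (z m)) = g m := by
        refine Prod.ext (hpart m) (Subtype.ext ?_)
        rw [hcoord, Sphere2.ofCoords_coe h2]
        ext i
        fin_cases i <;> rfl
      simp only [Ψ]
      rw [h3]
      exact g.symm_apply_apply m
    · intro w hw ζ hζ
      have h1 : g (Ψ (w, ζ)) = (circlePart w, Sphere2.ofCoords (3 * ‖w‖ - 2) ζ) :=
        g.apply_symm_apply _
      simp only [f]
      rw [h1, Sphere2.ofCoords_coe (hsum (w, ζ) hζ)]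
      have h2 : c (3 * ‖w‖ - 2) = ‖w‖ := by simp only [c]; ring
      change (c (3 * ‖w‖ - 2) : ℂ) * circlePart w = w
      rw [h2, norm_mul_circlePart]
    · intro w hw ζ hζ
      have h1 : g (Ψ (w, ζ)) = (circlePart w, Sphere2.ofCoords (3 * ‖w‖ - 2) ζ) :=
        g.apply_symm_apply _
      simp only [z]
      rw [h1, Sphere2.ofCoords_coe (hsum (w, ζ) hζ)]
      rfl
  have hcaps : ∃ z Ψ, IsCircleModel f {w | 1 / 3 < ‖w‖} (fun w => 1 - ‖w‖ ^ 2) z Ψ := by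
    have hopen : IsOpen {w : ℂ | 1 / 3 < ‖w‖} := isOpen_lt continuous_const continuous_norm
    have hsub : {w : ℂ | 1 / 3 < ‖w‖} ⊆ {0}ᶜ := by
      rintro w hw rfl
      rw [mem_ofPred_eq, norm_zero] at hw
      norm_num at hw
    have hpos : ∀ w ∈ {w : ℂ | 1 / 3 < ‖w‖}, 0 < 3 * (3 * ‖w‖ - 1) := by
      intro w hw
      rw [mem_ofPred_eq] at hw
      linarith
    have hκ : ContDiffOn ℝ ∞ (fun w : ℂ => (1 + ‖w‖) / (3 * (3 * ‖w‖ - 1)))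
        {w | 1 / 3 < ‖w‖} := by
      have h1 := hns.mono hsub
      exact (contDiffOn_const.add h1).div
        (contDiffOn_const.mul ((contDiffOn_const.mul h1).sub contDiffOn_const))
        fun w hw => (hpos w hw).ne'
    refine ⟨_, _, ((hmodel.mono hopen hsub).rescale hfs hκ fun w hw => ?_).congr fun w hw => ?_⟩
    · exact div_pos (by positivity) (hpos w hw)
    · have h1 := (hpos w hw).ne'
      simp only [ρ]
      rw [div_mul_eq_mul_div, eq_div_iff h1]
      ring
  obtain ⟨z', Ψ', hm'⟩ := hcaps
  have hcap := hasCap_of_norm_le_one (f := f) (fun m => by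
    rw [hnorm]
    simp only [c]
    linarith [(hbound m).2]) ⟨_, z', Ψ', by norm_num, hm'⟩ ⟨_, z', Ψ', by norm_num, hm'⟩
  have : ConnectedSpace Circle := by
    have h := isConnected_sphere (E := ℂ) (by rw [Complex.rank_real_complex]; norm_num) 0
      zero_le_one
    exact isConnected_iff_connectedSpace.1 h
  have : ConnectedSpace Sphere2 :=
    isConnected_iff_connectedSpace.1 (isConnected_sphere one_lt_rank_E3 0 zero_le_one)
  exact ⟨g.symm.toHomeomorph.compactSpace, g.symm.surjective.connectedSpace g.symm.continuous, f,
    hfs, fun m => Or.inl ⟨_, ρ, z, Ψ, hf0 m, hmodel⟩, ⟨0, hcap.1⟩, ⟨0, hcap.2⟩⟩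

theorem IsFiniteConnectedSum.hasCappedWertherMap {P : OrientedThreeManifold.{u} → Prop}
    (hP : ∀ M, P M → HasCappedWertherMap M.carrier) {M : OrientedThreeManifold.{u}}
    (h : IsFiniteConnectedSum P M) : HasCappedWertherMap M.carrier := by
  induction h with
  | empty M h =>
    obtain ⟨g⟩ := h
    exact hasCappedWertherMap_of_diffeomorph_sphere g
  | piece M h => exact hP M h
  | sum M M₁ M₂ _ _ h ih₁ ih₂ => exact ih₁.of_isOrientedConnectedSum ih₂ h

/-! ### Plane regions with smooth boundary -/

/-- A smooth chart `e` of the plane that carries the region `K` to the right half-plane. -/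
structure IsRegionChart (K : Set ℂ) (e : OpenPartialHomeomorph ℂ ℂ) : Prop where
  contDiffOn : ContDiffOn ℝ ∞ e e.source
  contDiffOn_symm : ContDiffOn ℝ ∞ e.symm e.target
  mem_iff : ∀ w ∈ e.source, w ∈ K ↔ 0 ≤ (e w).re

theorem IsRegionChart.mem_interior_iff {K : Set ℂ} {e : OpenPartialHomeomorph ℂ ℂ}
    (h : IsRegionChart K e) {w : ℂ} (hw : w ∈ e.source) : w ∈ interior K ↔ 0 < (e w).re := by
  constructor
  · intro hK
    -- Moving to the left in the chart, one leaves the region.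
    have hcont : ContinuousAt e.symm (e w) := e.continuousAt_symm (e.map_source hw)
    have h1 : ∀ᶠ y in 𝓝 (e w), e.symm y ∈ interior K ∧ y ∈ e.target := by
      refine Filter.Eventually.and (hcont ?_) (e.open_target.mem_nhds (e.map_source hw))
      rw [e.left_inv hw]
      exact isOpen_interior.mem_nhds hK
    obtain ⟨ε, hε, hball⟩ := Metric.eventually_nhds_iff.1 h1
    obtain ⟨h2, h3⟩ := hball (y := e w - ((ε / 2 : ℝ) : ℂ)) (by
      rw [dist_eq_norm, sub_sub_cancel_left, norm_neg, Complex.norm_real,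
        Real.norm_of_nonneg (by linarith)]
      linarith)
    have h4 := (h.mem_iff _ (e.map_target h3)).1 (interior_subset h2)
    rw [e.right_inv h3, Complex.sub_re, Complex.ofReal_re] at h4
    linarith
  · intro h0
    have hopen : IsOpen (e.source ∩ e ⁻¹' {y | 0 < y.re}) :=
      e.isOpen_inter_preimage (isOpen_lt continuous_const Complex.continuous_re)
    exact mem_interior.2 ⟨_, fun y hy => (h.mem_iff y hy.1).2 (le_of_lt hy.2), hopen, hw, h0⟩

/-- A region in the plane with smooth boundary. -/
structure PlaneRegion where
  /-- The underlying set. -/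
  carrier : Set ℂ
  nonempty : carrier.Nonempty
  exists_chart : ∀ P ∈ carrier, ∃ e, IsRegionChart carrier e ∧ P ∈ e.source

/-- The point of the half-space with the coordinates of `w`, the first one made nonnegative. -/
noncomputable def toHalfSpace (w : ℂ) : EuclideanHalfSpace 2 :=
  ⟨!₂[max w.re 0, w.im], le_max_right _ _⟩

/-- The complex number with the given coordinates. -/
def ofPlaneCoords (v : EuclideanSpace ℝ (Fin 2)) : ℂ := ⟨v 0, v 1⟩

theorem contDiff_ofPlaneCoords : ContDiff ℝ ∞ ofPlaneCoords := by
  have h : ∀ i, ContDiff ℝ ∞ fun v : EuclideanSpace ℝ (Fin 2) => v i := fun i =>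
    (EuclideanSpace.proj i : EuclideanSpace ℝ (Fin 2) →L[ℝ] ℝ).contDiff
  exact contDiffOn_univ.1 (contDiff_complexMk (h 0).contDiffOn (h 1).contDiffOn)

theorem contDiff_toPlaneCoords :
    ContDiff ℝ ∞ fun w : ℂ => (!₂[w.re, w.im] : EuclideanSpace ℝ (Fin 2)) := by
  rw [contDiff_euclidean]
  intro i
  fin_cases i
  · exact Complex.reCLM.contDiff
  · exact Complex.imCLM.contDiff

theorem continuous_toHalfSpace : Continuous toHalfSpace := by
  refine Continuous.subtype_mk ?_ _
  refine (PiLp.continuous_toLp 2 _).comp (continuous_pi fun i => ?_)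
  fin_cases i
  · exact Complex.continuous_re.max continuous_const
  · exact Complex.continuous_im

theorem toHalfSpace_ofPlaneCoords (y : EuclideanHalfSpace 2) :
    toHalfSpace (ofPlaneCoords y.1) = y := by
  apply Subtype.ext
  ext i
  fin_cases i
  · exact max_eq_left y.2
  · rfl

theorem toHalfSpace_coe {w : ℂ} (hw : 0 ≤ w.re) :
    ((toHalfSpace w).1 : EuclideanSpace ℝ (Fin 2)) = !₂[w.re, w.im] := by
  simp [toHalfSpace, max_eq_left hw]

theorem ofPlaneCoords_toHalfSpace {w : ℂ} (hw : 0 ≤ w.re) : ofPlaneCoords (toHalfSpace w).1 = w := by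
  rw [toHalfSpace_coe hw]
  rfl

namespace PlaneRegion
variable (R : PlaneRegion)

open Classical in
/-- A retraction of the plane to the region, with junk values outside of the region. -/
noncomputable def retract (w : ℂ) : R.carrier :=
  if h : w ∈ R.carrier then ⟨w, h⟩ else ⟨_, R.nonempty.choose_spec⟩

variable {R} in
theorem retract_coe {w : ℂ} (hw : w ∈ R.carrier) : (R.retract w : ℂ) = w := by
  rw [retract, dif_pos hw]

variable {R} in
theorem retract_self (x : R.carrier) : R.retract x = x := Subtype.ext (retract_coe x.2)

/-- A chart of the plane at a point of the region. -/
noncomputable def planeChart (P : R.carrier) : OpenPartialHomeomorph ℂ ℂ :=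
  (R.exists_chart P P.2).choose

theorem isRegionChart (P : R.carrier) : IsRegionChart R.carrier (R.planeChart P) :=
  (R.exists_chart P P.2).choose_spec.1

theorem mem_planeChart_source (P : R.carrier) : (P : ℂ) ∈ (R.planeChart P).source :=
  (R.exists_chart P P.2).choose_spec.2

variable {R} in
theorem symm_mem {P : R.carrier} {y : EuclideanHalfSpace 2}
    (hy : ofPlaneCoords y.1 ∈ (R.planeChart P).target) :
    (R.planeChart P).symm (ofPlaneCoords y.1) ∈ R.carrier := by
  rw [(R.isRegionChart P).mem_iff _ ((R.planeChart P).map_target hy), (R.planeChart P).right_inv hy]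
  exact y.2

/-- The chart of the region at a point. -/
noncomputable def chart (P : R.carrier) : OpenPartialHomeomorph R.carrier (EuclideanHalfSpace 2) where
  toFun x := toHalfSpace (R.planeChart P x)
  invFun y := R.retract ((R.planeChart P).symm (ofPlaneCoords y.1))
  source := (↑) ⁻¹' (R.planeChart P).source
  target := {y | ofPlaneCoords y.1 ∈ (R.planeChart P).target}
  map_source' x hx := by
    have h0 := ((R.isRegionChart P).mem_iff _ hx).1 x.2
    rw [mem_ofPred_eq, ofPlaneCoords_toHalfSpace h0]
    exact (R.planeChart P).map_source hx
  map_target' y hy := by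
    rw [mem_preimage, retract_coe (symm_mem hy)]
    exact (R.planeChart P).map_target hy
  left_inv' x hx := by
    have h0 := ((R.isRegionChart P).mem_iff _ hx).1 x.2
    rw [ofPlaneCoords_toHalfSpace h0, (R.planeChart P).left_inv hx, retract_self]
  right_inv' y hy := by
    rw [retract_coe (symm_mem hy), (R.planeChart P).right_inv hy, toHalfSpace_ofPlaneCoords]
  open_source := (R.planeChart P).open_source.preimage continuous_subtype_val
  open_target := (R.planeChart P).open_target.preimage
    (contDiff_ofPlaneCoords.continuous.comp continuous_subtype_val)
  continuousOn_toFun := by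
    have h : ContinuousOn (fun x : R.carrier => R.planeChart P x)
        ((↑) ⁻¹' (R.planeChart P).source) :=
      (R.planeChart P).continuousOn.comp continuous_subtype_val.continuousOn fun _ hx => hx
    exact continuous_toHalfSpace.comp_continuousOn h
  continuousOn_invFun := by
    rw [IsInducing.subtypeVal.continuousOn_iff]
    refine ContinuousOn.congr (f := fun y : EuclideanHalfSpace 2 =>
      (R.planeChart P).symm (ofPlaneCoords y.1)) ?_ fun y hy => retract_coe (symm_mem hy)
    exact (R.planeChart P).continuousOn_symm.comp
      (contDiff_ofPlaneCoords.continuous.comp continuous_subtype_val).continuousOn fun _ hy => hy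

noncomputable instance : ChartedSpace (EuclideanHalfSpace 2) R.carrier where
  atlas := range R.chart
  chartAt := R.chart
  mem_chart_source := R.mem_planeChart_source
  chart_mem_atlas := mem_range_self

theorem coe_symm_of_mem_range {v : EuclideanSpace ℝ (Fin 2)} (hv : v ∈ range (𝓡∂ 2)) :
    ((𝓡∂ 2).symm v : EuclideanHalfSpace 2).1 = v := (𝓡∂ 2).right_inv hv

instance : IsManifold (𝓡∂ 2) ∞ R.carrier := by
  refine isManifold_of_contDiffOn _ _ _ ?_
  rintro _ _ ⟨P, rfl⟩ ⟨Q, rfl⟩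
  have hsub : ∀ v ∈ (𝓡∂ 2).symm ⁻¹' ((R.chart P).symm.trans (R.chart Q)).source ∩ range (𝓡∂ 2),
      ofPlaneCoords v ∈ (R.planeChart P).target ∧
      (R.planeChart P).symm (ofPlaneCoords v) ∈ (R.planeChart Q).source ∩ R.carrier := by
    rintro v ⟨⟨h1, h2⟩, hv⟩
    change ofPlaneCoords ((𝓡∂ 2).symm v).1 ∈ (R.planeChart P).target at h1
    have h3 := symm_mem h1
    change (R.retract ((R.planeChart P).symm (ofPlaneCoords ((𝓡∂ 2).symm v).1)) : ℂ) ∈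
      (R.planeChart Q).source at h2
    rw [retract_coe h3] at h2
    rw [coe_symm_of_mem_range hv] at h1 h2 h3
    exact ⟨h1, h2, h3⟩
  have h1 : ContDiffOn ℝ ∞ (fun v => R.planeChart Q ((R.planeChart P).symm (ofPlaneCoords v)))
      ((𝓡∂ 2).symm ⁻¹' ((R.chart P).symm.trans (R.chart Q)).source ∩ range (𝓡∂ 2)) :=
    (R.isRegionChart Q).contDiffOn.comp ((R.isRegionChart P).contDiffOn_symm.comp
      contDiff_ofPlaneCoords.contDiffOn fun v hv => (hsub v hv).1) fun v hv => (hsub v hv).2.1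
  refine (contDiff_toPlaneCoords.comp_contDiffOn h1).congr fun v hv => ?_
  obtain ⟨-, h3, h4⟩ := hsub v hv
  change (toHalfSpace (R.planeChart Q
    (R.retract ((R.planeChart P).symm (ofPlaneCoords ((𝓡∂ 2).symm v).1))))).1 = _
  rw [coe_symm_of_mem_range hv.2, retract_coe h4,
    toHalfSpace_coe (((R.isRegionChart Q).mem_iff _ h3).1 h4)]
  rfl

theorem contMDiff_coe : ContMDiff (𝓡∂ 2) 𝓘(ℝ, ℂ) ∞ (fun x : R.carrier => (x : ℂ)) := by
  intro P
  rw [contMDiffAt_iff_source]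
  have hP := R.mem_planeChart_source P
  have h0 := ((R.isRegionChart P).mem_iff _ hP).1 P.2
  have hpt : ofPlaneCoords (extChartAt (𝓡∂ 2) P P) = R.planeChart P P :=
    ofPlaneCoords_toHalfSpace h0
  have hmem : ofPlaneCoords (extChartAt (𝓡∂ 2) P P) ∈ (R.planeChart P).target := by
    rw [hpt]
    exact (R.planeChart P).map_source hP
  have h1 : ContDiffAt ℝ ∞ (fun v => (R.planeChart P).symm (ofPlaneCoords v))
      (extChartAt (𝓡∂ 2) P P) :=
    ((R.isRegionChart P).contDiffOn_symm.contDiffAt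
      ((R.planeChart P).open_target.mem_nhds hmem)).comp _ contDiff_ofPlaneCoords.contDiffAt
  refine h1.contMDiffAt.contMDiffWithinAt.congr_of_eventuallyEq_of_mem ?_ (mem_range_self _)
  have hopen : IsOpen (ofPlaneCoords ⁻¹' (R.planeChart P).target) :=
    (R.planeChart P).open_target.preimage contDiff_ofPlaneCoords.continuous
  filter_upwards [self_mem_nhdsWithin, mem_nhdsWithin_of_mem_nhds (hopen.mem_nhds hmem)]
    with v hv hvt
  change (R.retract ((R.planeChart P).symm (ofPlaneCoords ((𝓡∂ 2).symm v).1)) : ℂ) = _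
  have h2 : ofPlaneCoords ((𝓡∂ 2).symm v).1 ∈ (R.planeChart P).target := by
    rw [coe_symm_of_mem_range hv]
    exact hvt
  rw [retract_coe (symm_mem h2), coe_symm_of_mem_range hv]

section
variable {R} {F : Type*} [NormedAddCommGroup F] [NormedSpace ℝ F] {H : Type*} [TopologicalSpace H]
  {I : ModelWithCorners ℝ F H} {N : Type*} [TopologicalSpace N] [ChartedSpace H N]

/-- Smoothness of a map to the region can be checked in the plane. -/
theorem contMDiffOn_of_coe {g : N → R.carrier} {s : Set N}
    (hg : ContMDiffOn I 𝓘(ℝ, ℂ) ∞ (fun y => (g y : ℂ)) s) : ContMDiffOn I (𝓡∂ 2) ∞ g s := by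
  intro x hx
  rw [contMDiffWithinAt_iff_target]
  have hcont : ContinuousWithinAt g s x :=
    (IsInducing.subtypeVal.continuousWithinAt_iff).2 (hg x hx).continuousWithinAt
  refine ⟨hcont, ?_⟩
  set P := g x with hP
  have hsrc := R.mem_planeChart_source P
  have h1 : ContDiffAt ℝ ∞ (fun w => (!₂[(R.planeChart P w).re, (R.planeChart P w).im] :
      EuclideanSpace ℝ (Fin 2))) P :=
    contDiff_toPlaneCoords.contDiffAt.comp _ ((R.isRegionChart P).contDiffOn.contDiffAt
      ((R.planeChart P).open_source.mem_nhds hsrc))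
  have h2 := ContMDiffAt.comp_contMDiffWithinAt x (f := fun y => (g y : ℂ)) h1.contMDiffAt (hg x hx)
  refine h2.congr_of_eventuallyEq ?_ ?_
  · have hopen : (R.chart P).source ∈ 𝓝 (g x) := (R.chart P).open_source.mem_nhds hsrc
    filter_upwards [hcont hopen] with y hy
    exact toHalfSpace_coe (((R.isRegionChart P).mem_iff _ hy).1 (g y).2)
  · exact toHalfSpace_coe (((R.isRegionChart P).mem_iff _ hsrc).1 P.2)

end

theorem mem_interior_iff {P : R.carrier} :
    P ∈ (𝓡∂ 2).interior R.carrier ↔ (P : ℂ) ∈ interior R.carrier := by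
  have hP := R.mem_planeChart_source P
  have h0 := ((R.isRegionChart P).mem_iff _ hP).1 P.2
  rw [(R.isRegionChart P).mem_interior_iff hP]
  change extChartAt (𝓡∂ 2) P P ∈ interior (range (𝓡∂ 2)) ↔ _
  rw [interior_range_modelWithCornersEuclideanHalfSpace]
  change 0 < (toHalfSpace (R.planeChart P P)).1 0 ↔ _
  rw [toHalfSpace_coe h0]
  rfl

theorem mem_boundary_iff {P : R.carrier} :
    P ∈ (𝓡∂ 2).boundary R.carrier ↔ (P : ℂ) ∉ interior R.carrier := by
  rw [← R.mem_interior_iff, ← (𝓡∂ 2).compl_interior]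
  rfl

end PlaneRegion

/-! ### Charts adapted to a regular function -/

theorem isRegionChart_ball {K : Set ℂ} {P : ℂ} (hP : P ∈ interior K) :
    ∃ e, IsRegionChart K e ∧ P ∈ e.source := by
  obtain ⟨r, hr, hball⟩ := Metric.isOpen_iff.1 isOpen_interior P hP
  have hopen : IsOpen (ball P (min r 1)) := isOpen_ball
  let e : OpenPartialHomeomorph ℂ ℂ :=
    (Homeomorph.addRight (1 - P)).toOpenPartialHomeomorph.restrOpen (ball P (min r 1)) hopen
  have hsrc : e.source = ball P (min r 1) := univ_inter _
  have h1 : ∀ w, e w = w + (1 - P) := fun w => rfl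
  have h2 : ∀ w, e.symm w = w + -(1 - P) := fun w => rfl
  refine ⟨e, ⟨?_, ?_, fun w hw => ?_⟩, ?_⟩
  · exact (contDiff_id.add contDiff_const).contDiffOn
  · exact (contDiff_id.add contDiff_const).contDiffOn
  · rw [hsrc, mem_ball_iff_norm, lt_min_iff] at hw
    refine ⟨fun _ => ?_, fun _ => interior_subset (hball (mem_ball_iff_norm.2 hw.1))⟩
    rw [h1]
    have h3 := (abs_lt.1 ((Complex.abs_re_le_norm (w - P)).trans_lt hw.2)).1
    simp only [Complex.add_re, Complex.sub_re, Complex.one_re] at h3 ⊢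
    linarith
  · rw [hsrc]
    exact mem_ball_self (lt_min hr one_pos)

/-- A function with nonvanishing derivative is the real part of a chart of the plane. -/
theorem exists_chart_re_eq {U : Set ℂ} (hU : IsOpen U) {ρ : ℂ → ℝ} (hρ : ContDiffOn ℝ ∞ ρ U) {P : ℂ}
    (hP : P ∈ U) (hd : fderiv ℝ ρ P ≠ 0) :
    ∃ e : OpenPartialHomeomorph ℂ ℂ, P ∈ e.source ∧ e.source ⊆ U ∧ ContDiffOn ℝ ∞ e e.source ∧
      ContDiffOn ℝ ∞ e.symm e.target ∧ ∀ w ∈ e.source, (e w).re = ρ w := by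
  -- The imaginary part is a linear function whose kernel is spanned by `c`, which is transverse
  -- to the kernel of the derivative of `ρ`.
  obtain ⟨c, hc⟩ : ∃ c, fderiv ℝ ρ P c ≠ 0 := by
    by_contra! h
    exact hd (ContinuousLinearMap.ext h)
  have hc0 : c ≠ 0 := by rintro rfl; exact hc (map_zero _)
  let ℓ : ℂ →L[ℝ] ℝ := Complex.imCLM.comp (ContinuousLinearMap.mul ℝ ℂ ((starRingEnd ℂ) c))
  have hℓ : ∀ h, ℓ h = ((starRingEnd ℂ) c * h).im := fun h => rfl
  have hker : ∀ h, ℓ h = 0 → ∃ t : ℝ, h = t * c := by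
    intro h hh
    rw [hℓ] at hh
    have hn : (Complex.normSq c : ℂ) ≠ 0 := by
      exact_mod_cast (Complex.normSq_pos.2 hc0).ne'
    have h1 : (starRingEnd ℂ) c * h = (((starRingEnd ℂ) c * h).re : ℂ) := by
      apply Complex.ext
      · simp
      · rw [hh, Complex.ofReal_im]
    refine ⟨((starRingEnd ℂ) c * h).re / Complex.normSq c, ?_⟩
    rw [Complex.ofReal_div, ← h1, div_mul_eq_mul_div, eq_div_iff hn, ← Complex.mul_conj]
    ring
  let G : ℂ → ℂ := fun w => ρ w + ℓ w * Complex.I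
  have hG : ContDiffOn ℝ ∞ G U :=
    (Complex.ofRealCLM.contDiff.comp_contDiffOn hρ).add
      (((Complex.ofRealCLM.contDiff.comp ℓ.contDiff).mul contDiff_const).contDiffOn)
  have hGre : ∀ w, (G w).re = ρ w := fun w => by simp [G]
  have hderiv : ∀ w ∈ U, fderiv ℝ ρ w c ≠ 0 → ∃ L : ℂ ≃L[ℝ] ℂ, HasFDerivAt G (L : ℂ →L[ℝ] ℂ) w := by
    intro w hw hwc
    have h1 : HasFDerivAt ρ (fderiv ℝ ρ w) w :=
      ((hρ.contDiffAt (hU.mem_nhds hw)).differentiableAt (by simp)).hasFDerivAt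
    have h2 : HasFDerivAt G (Complex.ofRealCLM.comp (fderiv ℝ ρ w) +
        (ContinuousLinearMap.mul ℝ ℂ).flip Complex.I ∘L Complex.ofRealCLM.comp ℓ) w := by
      refine (Complex.ofRealCLM.hasFDerivAt.comp w h1).add ?_
      exact ((ContinuousLinearMap.mul ℝ ℂ).flip Complex.I ∘L Complex.ofRealCLM.comp ℓ).hasFDerivAt
    set A := Complex.ofRealCLM.comp (fderiv ℝ ρ w) +
        (ContinuousLinearMap.mul ℝ ℂ).flip Complex.I ∘L Complex.ofRealCLM.comp ℓ with hA
    have hAh : ∀ h, A h = (fderiv ℝ ρ w h : ℂ) + ℓ h * Complex.I := fun h => rfl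
    have hinj : Function.Injective (A : ℂ →ₗ[ℝ] ℂ) := by
      rw [injective_iff_map_eq_zero]
      intro h hh
      have hh' : (fderiv ℝ ρ w h : ℂ) + ℓ h * Complex.I = 0 := hh
      have him : ℓ h = 0 := by simpa using congrArg Complex.im hh'
      have hre : fderiv ℝ ρ w h = 0 := by simpa using congrArg Complex.re hh'
      obtain ⟨t, rfl⟩ := hker h him
      rw [← Complex.real_smul, map_smul, smul_eq_mul] at hre
      rw [(mul_eq_zero.1 hre).resolve_right hwc, Complex.ofReal_zero, zero_mul]
    refine ⟨(LinearEquiv.ofInjectiveEndo _ hinj).toContinuousLinearEquiv, ?_⟩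
    convert! h2 using 1
  obtain ⟨L, hL⟩ := hderiv P hP hc
  have hGP : ContDiffAt ℝ ∞ G P := hG.contDiffAt (hU.mem_nhds hP)
  let e₀ := hGP.toOpenPartialHomeomorph G hL (by simp)
  have he₀ : ∀ w, e₀ w = G w := fun w => rfl
  have hPe₀ : P ∈ e₀.source := hGP.mem_toOpenPartialHomeomorph_source hL (by simp)
  have hW : IsOpen (U ∩ {w | fderiv ℝ ρ w c ≠ 0}) := by
    have h1 : ContinuousOn (fun w => fderiv ℝ ρ w c) U :=
      (hρ.continuousOn_fderiv_of_isOpen hU (by simp)).clm_apply continuousOn_const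
    exact h1.isOpen_inter_preimage hU isOpen_ne
  let e := e₀.restrOpen _ hW
  have hsrc : e.source = e₀.source ∩ (U ∩ {w | fderiv ℝ ρ w c ≠ 0}) := rfl
  have hsub : ∀ w ∈ e.source, w ∈ U ∧ fderiv ℝ ρ w c ≠ 0 := fun w hw => (hsrc ▸ hw).2
  refine ⟨e, ⟨hPe₀, hP, hc⟩, fun w hw => (hsub w hw).1, hG.mono fun w hw => (hsub w hw).1, ?_,
    fun w _ => hGre w⟩
  intro y hy
  have hw := e.map_target hy
  obtain ⟨L', hL'⟩ := hderiv _ (hsub _ hw).1 (hsub _ hw).2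
  exact (e.contDiffAt_symm hy hL' (hG.contDiffAt (hU.mem_nhds (hsub _ hw).1))).contDiffWithinAt

/-! ### The surface is the image of a capped Werther map -/

section
variable {M : Type*} [TopologicalSpace M] [ChartedSpace E3 M] {f : M → ℂ}

namespace IsCircleModel
variable {U : Set ℂ} {ρ : ℂ → ℝ} {z : M → ℂ} {Ψ : ℂ × ℂ → M}

/-- At a boundary point, the image of `f` is a region with smooth boundary. -/
theorem exists_isRegionChart (h : IsCircleModel f U ρ z Ψ) {P : ℂ} (hP : P ∈ U) (h0 : ρ P = 0) :
    ∃ e, IsRegionChart (range f) e ∧ P ∈ e.source ∧ e.source ⊆ U ∧ ∀ w ∈ e.source, (e w).re = ρ w := by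
  obtain ⟨e, hPe, hsub, hs, hs', hre⟩ := exists_chart_re_eq h.isOpen h.contDiffOn hP
    (h.regular P hP h0)
  refine ⟨e, ⟨hs, hs', fun w hw => ?_⟩, hPe, hsub, hre⟩
  rw [hre w hw, h.mem_range_iff (hsub hw)]

theorem mem_interior_range_iff (h : IsCircleModel f U ρ z Ψ) {P : ℂ} (hP : P ∈ U) :
    P ∈ interior (range f) ↔ 0 < ρ P := by
  constructor
  · intro hi
    have h1 := (h.mem_range_iff hP).1 (interior_subset hi)
    refine h1.lt_of_ne fun h0 => ?_
    obtain ⟨e, he, hPe, -, hre⟩ := h.exists_isRegionChart hP h0.symm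
    have h2 := (he.mem_interior_iff hPe).1 hi
    rw [hre P hPe, ← h0] at h2
    exact lt_irrefl _ h2
  · intro h0
    have hopen : IsOpen (U ∩ ρ ⁻¹' Ioi 0) :=
      h.contDiffOn.continuousOn.isOpen_inter_preimage h.isOpen isOpen_Ioi
    exact mem_interior.2 ⟨_, fun w hw => (h.mem_range_iff hw.1).2 (le_of_lt hw.2), hopen, hP, h0⟩

/-- Over the interior, the circle model is a trivial circle bundle. -/
theorem isSeifertAt (h : IsCircleModel f U ρ z Ψ) (hf : ContMDiff (𝓡 3) 𝓘(ℝ, ℂ) ∞ f) {P : ℂ}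
    (hP : P ∈ U) (h0 : 0 < ρ P) : IsSeifertAt f P := by
  intro V hV
  have hopen : IsOpen (U ∩ ρ ⁻¹' Ioi 0) :=
    h.contDiffOn.continuousOn.isOpen_inter_preimage h.isOpen isOpen_Ioi
  obtain ⟨ε, hε, hball⟩ := Metric.nhds_basis_closedBall.mem_iff.1
    (Filter.inter_mem hV (hopen.mem_nhds ⟨hP, h0⟩))
  have hεC : (ε : ℂ) ≠ 0 := by exact_mod_cast hε.ne'
  have hU : ∀ w ∈ closedBall P ε, w ∈ U ∧ 0 < ρ w := fun w hw => (hball hw).2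
  have hmem : ∀ y ∈ closedBall (0 : ℂ) 1, P + ε * y ∈ closedBall P ε := by
    intro y hy
    rw [mem_closedBall_zero_iff] at hy
    rw [mem_closedBall_iff_norm, add_sub_cancel_left, norm_mul, Complex.norm_real,
      Real.norm_of_nonneg hε.le]
    exact mul_le_of_le_one_right hε.le hy
  have hmem' : ∀ w ∈ closedBall P ε, (ε : ℂ)⁻¹ * (w - P) ∈ closedBall (0 : ℂ) 1 := by
    intro w hw
    rw [mem_closedBall_iff_norm] at hw
    rwa [mem_closedBall_zero_iff, norm_mul, norm_inv, Complex.norm_real,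
      Real.norm_of_nonneg hε.le, inv_mul_le_one₀ hε]
  have hcancel : ∀ w : ℂ, P + ε * ((ε : ℂ)⁻¹ * (w - P)) = w := fun w => by
    rw [mul_inv_cancel_left₀ hεC]; ring
  have hcancel' : ∀ y : ℂ, (ε : ℂ)⁻¹ * (P + ε * y - P) = y := fun y => by
    rw [add_sub_cancel_left, inv_mul_cancel_left₀ hεC]
  let σ : ℂ → ℝ := fun y => √(ρ (P + ε * y))
  have hσpos : ∀ y ∈ closedBall (0 : ℂ) 1, 0 < σ y := fun y hy =>
    Real.sqrt_pos.2 (hU _ (hmem y hy)).2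
  have hσn : ∀ y, ‖(σ y : ℂ)‖ = σ y := fun y => by
    rw [Complex.norm_real, Real.norm_of_nonneg (Real.sqrt_nonneg _)]
  have hζ : ∀ (u : Circle) (y : ℂ), y ∈ closedBall (0 : ℂ) 1 →
      ‖(σ y : ℂ) * u‖ ^ 2 = ρ (P + ε * y) := by
    intro u y hy
    rw [norm_mul, hσn, Circle.norm_coe, mul_one, Real.sq_sqrt (hU _ (hmem y hy)).2.le]
  have hzn : ∀ m, f m ∈ closedBall P ε → ‖z m‖ = √(ρ (f m)) := fun m hm => by
    rw [← h.norm_sq m (hU _ hm).1, Real.sqrt_sq (norm_nonneg _)]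
  have hz0 : ∀ m, f m ∈ closedBall P ε → z m ≠ 0 := fun m hm => by
    rw [← norm_pos_iff, hzn m hm]
    exact Real.sqrt_pos.2 (hU _ hm).2
  let Φ : PartialEquiv M (Circle × ℂ) :=
    { toFun := fun m => (circlePart (z m), (ε : ℂ)⁻¹ * (f m - P))
      invFun := fun x => Ψ (P + ε * x.2, (σ x.2 : ℂ) * x.1)
      source := f ⁻¹' closedBall P ε
      target := {x : Circle × ℂ | x.2 ∈ closedBall (0 : ℂ) 1}
      map_source' := fun m hm => hmem' _ hm
      map_target' := by
        rintro ⟨u, y⟩ hy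
        rw [mem_preimage, h.apply_inv _ (hU _ (hmem y hy)).1 _ (hζ u y hy)]
        exact hmem y hy
      left_inv' := by
        intro m hm
        simp only [σ]
        rw [hcancel, ← hzn m hm, norm_mul_circlePart, h.left_inv m (hU _ hm).1]
      right_inv' := by
        rintro ⟨u, y⟩ hy
        have hσ0 : (σ y : ℂ) ≠ 0 := by exact_mod_cast (hσpos y hy).ne'
        simp only
        rw [h.apply_inv _ (hU _ (hmem y hy)).1 _ (hζ u y hy),
          h.coord_inv _ (hU _ (hmem y hy)).1 _ (hζ u y hy), hcancel']
        congr 1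
        apply Circle.ext
        rw [circlePart_coe (mul_ne_zero hσ0 u.coe_ne_zero), norm_mul, hσn, Circle.norm_coe, mul_one,
          mul_div_cancel_left₀ _ hσ0] }
  let φ : PartialEquiv ℂ ℂ :=
    { toFun := fun w => (ε : ℂ)⁻¹ * (w - P)
      invFun := fun y => P + ε * y
      source := closedBall P ε
      target := closedBall 0 1
      map_source' := hmem'
      map_target' := hmem
      left_inv' := fun w _ => hcancel w
      right_inv' := fun y _ => hcancel' y }
  have hφs : ContDiff ℝ ∞ fun w : ℂ => (ε : ℂ)⁻¹ * (w - P) :=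
    contDiff_const.mul (contDiff_id.sub contDiff_const)
  have hφs' : ContDiff ℝ ∞ fun y : ℂ => P + ε * y :=
    contDiff_const.add (contDiff_const.mul contDiff_id)
  refine ⟨closedBall P ε, fun w hw => (hball hw).1, closedBall_mem_nhds P hε, isClosed_closedBall,
    1, 0, one_ne_zero, Nat.coprime_one_left 0, Φ, φ, ⟨rfl, rfl, ?_, ?_⟩,
    ⟨rfl, rfl, hφs.contMDiff.contMDiffOn, hφs'.contMDiff.contMDiffOn⟩, fun m hm => ?_⟩
  · refine ContMDiffOn.prodMk (contMDiffOn_circle_of_coe ?_)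
      (hφs.contMDiff.comp hf).contMDiffOn
    have h1 : ContMDiffOn (𝓡 3) 𝓘(ℝ, ℂ) ∞ z (f ⁻¹' closedBall P ε) :=
      h.contMDiffOn.mono fun m hm => (hU _ hm).1
    exact contDiffOn_circlePart.contMDiffOn.comp h1 fun m hm => hz0 m hm
  · have hσs : ContDiffOn ℝ ∞ (fun y => (σ y : ℂ)) (closedBall 0 1) := by
      refine Complex.ofRealCLM.contDiff.comp_contDiffOn (ContDiffOn.sqrt ?_ fun y hy =>
        (hU _ (hmem y hy)).2.ne')
      exact h.contDiffOn.comp hφs'.contDiffOn fun y hy => (hU _ (hmem y hy)).1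
    have h1 : ContDiffOn ℝ ∞ (fun x : ℂ × ℂ => (P + ε * x.2, (σ x.2 : ℂ) * x.1))
        {x | x.2 ∈ closedBall (0 : ℂ) 1} :=
      (hφs'.comp contDiff_snd).contDiffOn.prodMk
        ((hσs.comp contDiffOn_snd fun x hx => hx).mul contDiffOn_fst)
    have h2 : ContMDiff ((𝓡 1).prod 𝓘(ℝ, ℂ)) 𝓘(ℝ, ℂ × ℂ) ∞
        fun x : Circle × ℂ => ((x.1 : ℂ), x.2) :=
      (contMDiff_circle_coe.comp contMDiff_fst).prodMk_space contMDiff_snd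
    have h3 := h1.contMDiffOn.comp (s := {x : Circle × ℂ | x.2 ∈ closedBall (0 : ℂ) 1})
      h2.contMDiffOn fun x hx => hx
    exact h.contMDiffOn_inv.comp h3 fun x hx => ⟨(hU _ (hmem x.2 hx)).1, hζ x.1 x.2 hx⟩
  · change (ε : ℂ)⁻¹ * (f m - P) = (circlePart (z m) : ℂ) ^ 0 * ((ε : ℂ)⁻¹ * (f m - P)) ^ 1
    rw [pow_zero, one_mul, pow_one]

end IsCircleModel

theorem IsSeifertAt.mem_interior_range {P : ℂ} (h : IsSeifertAt f P) : P ∈ interior (range f) := by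
  obtain ⟨U, -, hU, -, p, q, hp, -, Φ, φ, hΦ, hφ, hcomm⟩ := h univ Filter.univ_mem
  refine mem_interior_iff_mem_nhds.2 (Filter.mem_of_superset hU fun w hw => ?_)
  -- The Seifert model is onto the disc.
  have hws : w ∈ φ.source := hφ.source_eq ▸ hw
  have hφw : φ w ∈ closedBall (0 : ℂ) 1 := hφ.target_eq ▸ φ.map_source hws
  obtain ⟨y, hy⟩ := IsAlgClosed.exists_pow_nat_eq (φ w) (Nat.pos_of_ne_zero hp)
  have hyn : ‖y‖ ≤ 1 := by
    rw [mem_closedBall_zero_iff, ← hy, norm_pow] at hφw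
    exact (pow_le_one_iff_of_nonneg (norm_nonneg _) hp).1 hφw
  have hyt : ((1, y) : Circle × ℂ) ∈ Φ.target := by
    rw [hΦ.target_eq]
    exact mem_closedBall_zero_iff.2 hyn
  have hm := Φ.map_target hyt
  rw [hΦ.source_eq] at hm
  refine ⟨Φ.symm (1, y), φ.injOn (hφ.source_eq ▸ hm) hws ?_⟩
  rw [hcomm _ hm, Φ.right_inv hyt, seifertModel, Circle.coe_one, one_pow, one_mul, hy]

/-- The image of a capped Werther map. -/
def IsCappedWertherMap.region (h : IsCappedWertherMap f) : PlaneRegion where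
  carrier := range f
  nonempty := by
    obtain ⟨c, ⟨U, z, Ψ, hU, hm⟩, -⟩ := h.rightCap
    exact ⟨_, (hm.mem_range_iff hU).2 (by simp)⟩
  exists_chart := by
    rintro _ ⟨x, rfl⟩
    rcases h.isWertherAt x with ⟨U, ρ, z, Ψ, hP, hm⟩ | hs
    · rcases ((hm.mem_range_iff hP).1 ⟨x, rfl⟩).lt_or_eq with h0 | h0
      · exact isRegionChart_ball ((hm.mem_interior_range_iff hP).2 h0)
      · obtain ⟨e, he, hPe, -⟩ := hm.exists_isRegionChart hP h0.symm
        exact ⟨e, he, hPe⟩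
    · exact isRegionChart_ball hs.mem_interior_range

/-- The capped Werther map as a map to its image. -/
def IsCappedWertherMap.toRegion (h : IsCappedWertherMap f) (x : M) : h.region.carrier :=
  ⟨f x, mem_range_self x⟩

/-- The polar coordinates `(‖w‖ - 1, arg w)` are smooth on the slit plane. -/
theorem contDiffOn_polar :
    ContDiffOn ℝ ∞ (fun w : ℂ => (⟨‖w‖ - 1, w.arg⟩ : ℂ)) Complex.slitPlane := by
  refine contDiff_complexMk ?_ ?_
  · intro w hw
    exact ((contDiffAt_norm ℝ (Complex.slitPlane_ne_zero hw)).sub contDiffAt_const).contDiffWithinAt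
  · intro w hw
    have h1 : ContDiffAt ℝ ∞ Complex.log w := (Complex.contDiffAt_log hw).restrict_scalars ℝ
    have h2 : ContDiffAt ℝ ∞ (fun w => (Complex.log w).im) w :=
      Complex.imCLM.contDiff.contDiffAt.comp w h1
    exact (h2.congr_of_eventuallyEq (Filter.Eventually.of_forall fun w =>
      (Complex.log_im w).symm)).contDiffWithinAt

/-- Polar coordinates carry a chart with real part `ρ` to a chart of the collar. -/
theorem exists_collar_chart {e : OpenPartialHomeomorph ℂ ℂ} (hs : ContDiffOn ℝ ∞ e e.source)
    (hs' : ContDiffOn ℝ ∞ e.symm e.target) {P : ℂ} (hP : P ∈ e.source) (h0 : (e P).re = 0) :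
    ∃ (g g' : ℂ → ℂ) (N O : Set ℂ), IsOpen N ∧ P ∈ N ∧ N ⊆ e.source ∧ IsOpen O ∧ (1 : ℂ) ∈ O ∧
      MapsTo g N O ∧ MapsTo g' O N ∧ (∀ w ∈ N, g' (g w) = w) ∧ (∀ w ∈ O, g (g' w) = w) ∧
      ContDiffOn ℝ ∞ g N ∧ ContDiffOn ℝ ∞ g' O ∧ (∀ w ∈ N, ‖g w‖ = 1 + (e w).re) ∧
      ∀ w ∈ O, ‖w‖ < 2 := by
  let E : ℂ → ℂ := fun ζ => ((1 + ζ.re : ℝ) : ℂ) * Complex.exp ((ζ.im : ℂ) * Complex.I)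
  let L : ℂ → ℂ := fun w => ⟨‖w‖ - 1, w.arg⟩
  let B : Set ℂ := {ζ | (-1 < ζ.re ∧ ζ.re < 1) ∧ (-Real.pi < ζ.im ∧ ζ.im < Real.pi)}
  let O₁ : Set ℂ := {w | w ∈ Complex.slitPlane ∧ ‖w‖ < 2}
  have hB : IsOpen B :=
    ((isOpen_lt continuous_const Complex.continuous_re).inter
      (isOpen_lt Complex.continuous_re continuous_const)).inter
    ((isOpen_lt continuous_const Complex.continuous_im).inter
      (isOpen_lt Complex.continuous_im continuous_const))
  have hO₁ : IsOpen O₁ := Complex.isOpen_slitPlane.inter (isOpen_lt continuous_norm continuous_const)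
  have hEn : ∀ ζ ∈ B, ‖E ζ‖ = 1 + ζ.re := by
    intro ζ hζ
    simp only [E]
    rw [norm_mul, Complex.norm_exp_ofReal_mul_I, mul_one, Complex.norm_real,
      Real.norm_of_nonneg (by linarith [hζ.1.1])]
  have hEarg : ∀ ζ ∈ B, (E ζ).arg = ζ.im := by
    intro ζ hζ
    simp only [E]
    rw [Complex.exp_mul_I]
    exact Complex.arg_mul_cos_add_sin_mul_I (by linarith [hζ.1.1]) ⟨hζ.2.1, hζ.2.2.le⟩
  have hLE : ∀ ζ ∈ B, L (E ζ) = ζ := by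
    intro ζ hζ
    apply Complex.ext
    · simp only [L]; rw [hEn ζ hζ]; ring
    · exact hEarg ζ hζ
  have hEL : ∀ w, E (L w) = w := by
    intro w
    simp only [E, L]
    rw [add_sub_cancel, Complex.norm_mul_exp_arg_mul_I]
  have hEO : MapsTo E B O₁ := by
    intro ζ hζ
    have h1 := hEn ζ hζ
    refine ⟨?_, by rw [h1]; linarith [hζ.1.2]⟩
    rw [Complex.mem_slitPlane_iff_arg, hEarg ζ hζ]
    refine ⟨hζ.2.2.ne, ?_⟩
    rw [← norm_pos_iff, h1]
    linarith [hζ.1.1]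
  have hLB : MapsTo L O₁ B := by
    rintro w ⟨hw, hw2⟩
    have h1 := Complex.mem_slitPlane_iff_arg.1 hw
    have h2 := norm_pos_iff.2 h1.2
    exact ⟨⟨by simp only [L]; linarith, by simp only [L]; linarith⟩, Complex.neg_pi_lt_arg w,
      (Complex.arg_le_pi w).lt_of_ne h1.1⟩
  have hEs : ContDiff ℝ ∞ E := by
    refine (Complex.ofRealCLM.contDiff.comp (contDiff_const.add Complex.reCLM.contDiff)).mul ?_
    exact ((Complex.ofRealCLM.contDiff.comp Complex.imCLM.contDiff).mul contDiff_const).cexp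
  have hLs : ContDiffOn ℝ ∞ L O₁ := contDiffOn_polar.mono fun w hw => hw.1
  have h1O : (1 : ℂ) ∈ O₁ := ⟨by simp, by norm_num⟩
  have hL1 : L 1 = 0 := by
    apply Complex.ext <;> simp [L]
  have h0B : (0 : ℂ) ∈ B := hL1 ▸ hLB h1O
  refine ⟨fun w => E (e w - e P), fun w => e.symm (L w + e P),
    e.source ∩ e ⁻¹' ((fun ζ => ζ - e P) ⁻¹' B), O₁ ∩ (fun w => L w + e P) ⁻¹' e.target, ?_, ?_,
    inter_subset_left, ?_, ?_, ?_, ?_, ?_, ?_, ?_, ?_, ?_, ?_⟩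
  · exact e.isOpen_inter_preimage (hB.preimage (continuous_id.sub continuous_const))
  · refine ⟨hP, ?_⟩
    change e P - e P ∈ B
    rwa [sub_self]
  · exact (hLs.continuousOn.add continuousOn_const).isOpen_inter_preimage hO₁ e.open_target
  · refine ⟨h1O, ?_⟩
    change L 1 + e P ∈ e.target
    rw [hL1, zero_add]
    exact e.map_source hP
  · rintro w ⟨hw, hwB⟩
    refine ⟨hEO hwB, ?_⟩
    change L (E (e w - e P)) + e P ∈ e.target
    rw [hLE _ hwB, sub_add_cancel]
    exact e.map_source hw
  · rintro w ⟨hw, hwt⟩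
    refine ⟨e.map_target hwt, ?_⟩
    change e (e.symm (L w + e P)) - e P ∈ B
    rw [e.right_inv hwt, add_sub_cancel_right]
    exact hLB hw
  · rintro w ⟨hw, hwB⟩
    simp only
    rw [hLE _ hwB, sub_add_cancel, e.left_inv hw]
  · rintro w ⟨hw, hwt⟩
    simp only
    rw [e.right_inv hwt, add_sub_cancel_right, hEL]
  · exact hEs.comp_contDiffOn ((hs.mono inter_subset_left).sub contDiffOn_const)
  · exact hs'.comp ((hLs.mono inter_subset_left).add contDiffOn_const) fun w hw => hw.2
  · rintro w ⟨hw, hwB⟩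
    simp only
    rw [hEn _ hwB, Complex.sub_re, h0, sub_zero]
  · exact fun w hw => hw.1.2

/-- Over its image, a capped Werther map is a Werther fibration: a circle model is a circle bundle
over `{ρ > 0}`, and polar coordinates with radius `1 + ρ` carry it to the model `ω` at `{ρ = 0}`. -/
theorem IsCappedWertherMap.isWertherFibration (h : IsCappedWertherMap f) :
    IsWertherFibration h.toRegion := by
  refine ⟨?_, ?_, ?_⟩
  · rw [← contMDiffOn_univ]
    exact PlaneRegion.contMDiffOn_of_coe h.contMDiff.contMDiffOn
  · rintro ⟨_, x, rfl⟩ hP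
    rw [PlaneRegion.mem_interior_iff] at hP
    have hS : IsSeifertAt f (f x) := by
      rcases h.isWertherAt x with ⟨U, ρ, z, Ψ, hPU, hm⟩ | hs
      · exact hm.isSeifertAt h.contMDiff hPU ((hm.mem_interior_range_iff hPU).1 hP)
      · exact hs
    obtain ⟨U, hUV, hU, hUc, p, q, hp, hpq, Φ, φ, hΦ, hφ, hcomm⟩ :=
      hS (interior (range f)) (isOpen_interior.mem_nhds hP)
    have hUK : ∀ w ∈ U, w ∈ h.region.carrier := fun w hw => interior_subset (hUV hw)
    have hφt : ∀ y ∈ closedBall (0 : ℂ) 1, φ.symm y ∈ U := fun y hy =>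
      hφ.source_eq ▸ φ.map_target (hφ.target_eq ▸ hy)
    refine ⟨Subtype.val ⁻¹' U, ?_, continuous_subtype_val.continuousAt hU,
      hUc.preimage continuous_subtype_val, p, q, hp, hpq, Φ,
      { toFun := fun w => φ w
        invFun := fun y => h.region.retract (φ.symm y)
        source := Subtype.val ⁻¹' U
        target := closedBall 0 1
        map_source' := fun w hw => hφ.target_eq ▸ φ.map_source (hφ.source_eq ▸ hw)
        map_target' := fun y hy => by
          rw [mem_preimage, PlaneRegion.retract_coe (hUK _ (hφt y hy))]
          exact hφt y hy
        left_inv' := fun w hw => by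
          rw [φ.left_inv (hφ.source_eq ▸ hw), PlaneRegion.retract_self]
        right_inv' := fun y hy => by
          rw [PlaneRegion.retract_coe (hUK _ (hφt y hy)), φ.right_inv (hφ.target_eq ▸ hy)] },
      hΦ, ⟨rfl, rfl, ?_, ?_⟩, hcomm⟩
    · intro w hw
      rw [PlaneRegion.mem_interior_iff]
      exact hUV hw
    · exact hφ.contMDiffOn.comp h.region.contMDiff_coe.contMDiffOn fun w hw => hw
    · refine PlaneRegion.contMDiffOn_of_coe (hφ.contMDiffOn_symm.congr fun y hy => ?_)
      exact PlaneRegion.retract_coe (hUK _ (hφt y hy))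
  · rintro ⟨_, x, rfl⟩ hP
    rw [PlaneRegion.mem_boundary_iff] at hP
    obtain ⟨U, ρ, z, Ψ, hPU, hm⟩ := (h.isWertherAt x).resolve_right fun hs =>
      hP hs.mem_interior_range
    have h0 : ρ (f x) = 0 := by
      have h1 := (hm.mem_range_iff hPU).1 ⟨x, rfl⟩
      exact le_antisymm (not_lt.1 fun h2 => hP ((hm.mem_interior_range_iff hPU).2 h2)) h1
    obtain ⟨e, he, hPe, heU, hre⟩ := hm.exists_isRegionChart hPU h0
    obtain ⟨g, g', N, O, hN, hPN, hNe, hO, h1O, hg, hg', hgg, hgg', hgs, hgs', hgn, hO2⟩ :=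
      exists_collar_chart he.contDiffOn he.contDiffOn_symm hPe ((hre _ hPe).trans h0)
    have hgρ : ∀ w ∈ N, ‖g w‖ = 1 + ρ w := fun w hw => by rw [hgn w hw, hre w (hNe hw)]
    have hNU : N ⊆ U := hNe.trans heU
    have hρ' : ∀ w ∈ O, ρ (g' w) = ‖w‖ - 1 := fun w hw => by
      have h1 := hgρ _ (hg' hw)
      rw [hgg' w hw] at h1
      linarith
    have hK : ∀ w ∈ collar ∩ O, g' w ∈ h.region.carrier := by
      rintro w ⟨hw, hwO⟩
      refine (hm.mem_range_iff (hNU (hg' hwO))).2 ?_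
      rw [hρ' w hwO]
      linarith [hw.1]
    refine ⟨Subtype.val ⁻¹' N, hN.preimage continuous_subtype_val, hPN, O, hO, h1O,
      { toFun := fun m => (g (f m), z m)
        invFun := fun y => Ψ (g' y.1, y.2)
        source := f ⁻¹' N
        target := {y ∈ pinchedSpace | y.1 ∈ O}
        map_source' := fun m hm' => by
          have h1 := hgρ _ hm'
          have h2 := hm.norm_sq m (hNU hm')
          refine ⟨⟨⟨?_, hO2 _ (hg hm')⟩, ?_⟩, hg hm'⟩
          · rw [h1, ← h2]
            linarith [sq_nonneg ‖z m‖]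
          · simp only
            rw [h1, h2]
            ring
        map_target' := fun y hy => by
          have h1 : ‖y.2‖ ^ 2 = ρ (g' y.1) := by rw [hρ' _ hy.2]; exact hy.1.2
          rw [mem_preimage, hm.apply_inv _ (hNU (hg' hy.2)) _ h1]
          exact hg' hy.2
        left_inv' := fun m hm' => by
          rw [hgg _ hm', hm.left_inv m (hNU hm')]
        right_inv' := fun y hy => by
          have h1 : ‖y.2‖ ^ 2 = ρ (g' y.1) := by rw [hρ' _ hy.2]; exact hy.1.2
          rw [hm.apply_inv _ (hNU (hg' hy.2)) _ h1, hm.coord_inv _ (hNU (hg' hy.2)) _ h1,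
            hgg' _ hy.2] },
      { toFun := fun w => g w
        invFun := fun y => h.region.retract (g' y)
        source := Subtype.val ⁻¹' N
        target := collar ∩ O
        map_source' := fun w hw => by
          refine ⟨⟨?_, hO2 _ (hg hw)⟩, hg hw⟩
          rw [hgρ _ hw]
          linarith [(hm.mem_range_iff (hNU hw)).1 w.2]
        map_target' := fun y hy => by
          rw [mem_preimage, PlaneRegion.retract_coe (hK y hy)]
          exact hg' hy.2
        left_inv' := fun w hw => by
          rw [hgg _ hw, PlaneRegion.retract_self]
        right_inv' := fun y hy => by
          rw [PlaneRegion.retract_coe (hK y hy), hgg' _ hy.2] },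
      ⟨rfl, rfl, ?_, ?_⟩, ⟨rfl, rfl, ?_, ?_⟩, fun m _ => rfl⟩
    · exact (hgs.contMDiffOn.comp h.contMDiff.contMDiffOn fun m hm' => hm').prodMk_space
        (hm.contMDiffOn.mono fun m hm' => hNU hm')
    · have h1 : ContDiffOn ℝ ∞ (fun y : ℂ × ℂ => (g' y.1, y.2)) {y ∈ pinchedSpace | y.1 ∈ O} :=
        (hgs'.comp contDiffOn_fst fun y hy => hy.2).prodMk contDiffOn_snd
      refine hm.contMDiffOn_inv.comp h1.contMDiffOn fun y hy => ⟨hNU (hg' hy.2), ?_⟩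
      exact hy.1.2.trans (hρ' _ hy.2).symm
    · exact hgs.contMDiffOn.comp h.region.contMDiff_coe.contMDiffOn fun w hw => hw
    · refine PlaneRegion.contMDiffOn_of_coe ((hgs'.mono inter_subset_right).contMDiffOn.congr
        fun y hy => ?_)
      exact PlaneRegion.retract_coe (hK y hy)

/-- The rightmost point of the image lies on the boundary. -/
theorem IsCappedWertherMap.boundary_nonempty (h : IsCappedWertherMap f) :
    ((𝓡∂ 2).boundary h.region.carrier).Nonempty := by
  obtain ⟨c, ⟨U, z, Ψ, hU, hm⟩, -⟩ := h.rightCap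
  refine ⟨⟨c + 1, (hm.mem_range_iff hU).2 (by simp)⟩, ?_⟩
  rw [PlaneRegion.mem_boundary_iff]
  intro hi
  have h1 := (hm.mem_interior_range_iff hU).1 hi
  simp at h1

end

theorem theorem2p6 (N₁ N₂ M : OrientedThreeManifold.{u})
    (hN₁ : IsFiniteConnectedSum IsLensSpace N₁)
    (hN₂ : IsFiniteConnectedSum IsCircleTimesSphere N₂)
    (hM : IsOrientedConnectedSum M N₁ N₂) :
    ∃ (S : Type) (_ : TopologicalSpace S) (_ : ChartedSpace (EuclideanHalfSpace 2) S),
      IsManifold (𝓡∂ 2) ∞ S ∧ T2Space S ∧ CompactSpace S ∧ ConnectedSpace S ∧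
      ((𝓡∂ 2).boundary S).Nonempty ∧
      ∃ f : M.carrier → S, IsWertherFibration f := by
  have h₁ := hN₁.hasCappedWertherMap fun _ h => h.hasCappedWertherMap
  have h₂ := hN₂.hasCappedWertherMap fun _ ⟨g⟩ =>
    hasCappedWertherMap_of_diffeomorph_circle_prod_sphere g
  obtain ⟨_, _, f, hf⟩ := h₁.of_isOrientedConnectedSum h₂ hM
  have hc := hf.contMDiff.continuous
  exact ⟨hf.region.carrier, inferInstance, inferInstance, inferInstance, inferInstance,
    isCompact_iff_compactSpace.1 (isCompact_range hc),
    isConnected_iff_connectedSpace.1 (isConnected_range hc), hf.boundary_nonempty, hf.toRegion,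
    hf.isWertherFibration⟩
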